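/- **Setting.** Let $n\in\mathbb N$, $L>0$, and let $H:\mathbb R\to\mathbb R$ be $L$-periodic and of class $C^3$; put $\sigma_*=\min H'$ and $\sigma^*=\max H'$. Assume that $H'$ is unimodal (on a suitable period interval it first increases and then decreases) and that $H''(p)=0$ implies $H'(p)\in\{\sigma_*,\sigma^*\}$. Fix $\sigma$, independent of $\nu$, with $0\le\sigma<\sigma^*$ and let $H_{\mathrm{eff}}(p)=H(p)-\sigma p$. Let $P$ be a local minimum point of $H_{\mathrm{eff}}$ and let $Q\in(P,P+L)$ be a local maximum point. Set $$h_{\mathrm L}=H_{\mathrm{eff}}(Q-L)-H_{\mathrm{eff}}(P),\qquad h_{\mathrm R}=H_{\mathrm{eff}}(Q)-H_{\mathrm{eff}}(P),\qquad c_{\mathrm K}=\frac{\sqrt{|H''(P)H''(Q)|}}{2\pi}$$ and, for $\nu>0$, $$\tau=c_{\mathrm K}\exp\Big(-\frac{\min\{h_{\mathrm L},h_{\mathrm R}\}}{\nu^2}\Big).$$ A *solution* is a function $\varrho(t,x,p)\ge 0$, $t\ge 0$, $x\in\mathbb R^n$, $p\in\mathbb R$, with $\int_{\mathbb R^n}\int_{\mathbb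 R}\varrho(t,x,p)\,dp\,dx=1$ for all $t\ge0$, which is of class $C^2$ jointly in $(t,x,p)$ for $t>0$, satisfies $$\tau\big(\partial_t\varrho-\Delta_x\varrho\big)=\nu^2\partial_p^2\varrho+\partial_p\big((H'(p)-\sigma)\varrho\big)\qquad\text{for } t>0,$$ and attains its initial datum in $L^1$, i.e. $\varrho(t)\to\varrho(0)$ in $L^1(\mathbb R^n\times\mathbb R)$ as $t\downarrow0$. Let $$\mathcal V(t)=\iint(|x|^2+p^2)\varrho\,dp\,dx,\qquad \mathcal E(t)=\iint\nu^2\varrho\ln\varrho\,dp\,dx+\iint(H(p)-\sigma p)\varrho\,dp\,dx,$$ $$\mathcal D(t)=\iint\frac{\big(\partial_p\varrho+\nu^{-2}(H'(p)-\sigma)\varrho\big)^2}{\varrho}\,dp\,dx\in[0,\infty].$$ **Lemma ($L^1$-bound for the dissipation).** For every $C_0\in\mathbb R$ there exist constants $C>0$ and $\nu_0>0$, depending only on $n$, $H$, $L$, $\sigma$, $P$, $Q$ and $C_0$, such that the following holds for all $0<\nu<\nu_0$: if $\varrho$ is a solution whose initial datum has finite second moment and finite entropy (that is, $(|x|^2+p^2)\varrho(0)$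 and $\varrho(0)\ln\varrho(0)$ are integrable) with $\mathcal V(0)\le C_0$ and $\mathcal E(0)\le C_0$, then $$\int_0^T\mathcal D(t)\,dt\le\tau\,\nu^{-4}\,C\,(1+T)\qquad\text{for all }0<T<\infty.$$ -/

import Mathlib

open MeasureTheory Filter Topology
open scoped ENNReal Laplacian

noncomputable section

namespace TiltedFP

/-- Position space `ℝⁿ` with its Euclidean structure. -/
abbrev Pos (n : ℕ) : Type := EuclideanSpace ℝ (Fin n)

/-- The critical value `σ_* = min H'`. -/
def sigmaLower (H : ℝ → ℝ) : ℝ := ⨅ p, deriv H p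

/-- The critical value `σ^* = max H'`. -/
def sigmaUpper (H : ℝ → ℝ) : ℝ := ⨆ p, deriv H p

/-- Assumptions on the periodic potential: `H` is `L`-periodic and three times continuously
differentiable (so that `min H'`, `max H'` and `sup |H'''|` are finite and attained by
periodicity), `H'` is unimodal (on a suitable period interval it first increases and then
decreases), and every critical point of `H'` is a global extremum of `H'`. -/
structure IsPotential (H : ℝ → ℝ) (L : ℝ) : Prop where
  period_pos : 0 < L
  smooth : ContDiff ℝ 3 H
  periodic : Function.Periodic H L
  unimodal : ∃ a b : ℝ, a < b ∧ b < a + L ∧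
    MonotoneOn (deriv H) (Set.Icc a b) ∧ AntitoneOn (deriv H) (Set.Icc b (a + L))
  nondegenerate : ∀ p : ℝ, deriv (deriv H) p = 0 →
    deriv H p = sigmaLower H ∨ deriv H p = sigmaUpper H

/-- The effective potential `H_eff(p) = H(p) - σ p`. -/
def effPot (H : ℝ → ℝ) (σ : ℝ) (p : ℝ) : ℝ := H p - σ * p

/-- `P` is the position of a local minimum (well) of the effective potential and `Q` that of the
local maximum between this well and the next one at `P + L`. All wells are then at `P + j L` and
all local maxima at `Q + j L`, `j ∈ ℤ`; the local maximum left of `P` is at `Q - L`. -/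
structure IsWell (H : ℝ → ℝ) (L σ P Q : ℝ) : Prop where
  isLocalMin : IsLocalMin (effPot H σ) P
  isLocalMax : IsLocalMax (effPot H σ) Q
  lt_right : P < Q
  right_lt : Q < P + L

/-- The energy barrier `h_L` on the left of the well `P`. -/
def barrierL (H : ℝ → ℝ) (L σ P Q : ℝ) : ℝ := effPot H σ (Q - L) - effPot H σ P

/-- The energy barrier `h_R` on the right of the well `P`. -/
def barrierR (H : ℝ → ℝ) (σ P Q : ℝ) : ℝ := effPot H σ Q - effPot H σ P

/-- The Kramers constant `c_K = √|H''(P) H''(Q)| / (2π)`. -/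
def kramersConst (H : ℝ → ℝ) (P Q : ℝ) : ℝ :=
  Real.sqrt |deriv (deriv H) P * deriv (deriv H) Q| / (2 * Real.pi)

/-- The time scale `τ = c_K exp(-min{h_L, h_R} / ν²)`. -/
def tau (H : ℝ → ℝ) (L σ P Q ν : ℝ) : ℝ :=
  kramersConst H P Q * Real.exp (-(min (barrierL H L σ P Q) (barrierR H σ P Q)) / ν ^ 2)

/-- The second moment `𝒱 = ∬ (|x|² + p²) u(x,p) dp dx` of a density `u`. -/
def secondMoment {n : ℕ} (u : Pos n → ℝ → ℝ) : ℝ :=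
  ∫ z : Pos n × ℝ, (‖z.1‖ ^ 2 + z.2 ^ 2) * u z.1 z.2

/-- The free energy `ℰ = ∬ ν² u ln u dp dx + ∬ (H(p) - σ p) u dp dx` of a density `u`. -/
def energy {n : ℕ} (H : ℝ → ℝ) (σ ν : ℝ) (u : Pos n → ℝ → ℝ) : ℝ :=
  (∫ z : Pos n × ℝ, ν ^ 2 * (u z.1 z.2 * Real.log (u z.1 z.2)))
    + ∫ z : Pos n × ℝ, (H z.2 - σ * z.2) * u z.1 z.2

/-- The dissipation `𝒟 = ∬ (∂_p u + ν⁻² (H'(p) - σ) u)² / u dp dx` due to the diffusion in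
`p`, as an integral of a nonnegative function with values in `[0, ∞]`. (If a nonnegative
differentiable `u` vanishes at a point, then so does the numerator, and the quotient is read
as `0`.) -/
def dissipation {n : ℕ} (H : ℝ → ℝ) (σ ν : ℝ) (u : Pos n → ℝ → ℝ) : ℝ≥0∞ :=
  ∫⁻ z : Pos n × ℝ, ENNReal.ofReal
    ((deriv (u z.1) z.2 + (ν ^ 2)⁻¹ * (deriv H z.2 - σ) * u z.1 z.2) ^ 2 / u z.1 z.2)

/-- `ρ` is a nonnegative classical solution with unit mass of the Fokker-Planck equation
`τ (∂_t ρ - Δ_x ρ) = ν² ∂_p² ρ + ∂_p ((H'(p) - σ) ρ)` for `t > 0`, `x ∈ ℝⁿ`, `p ∈ ℝ`, which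
attains its initial datum `ρ 0` in the sense of `L¹`. -/
structure IsSolution {n : ℕ} (H : ℝ → ℝ) (σ ν τ : ℝ) (ρ : ℝ → Pos n → ℝ → ℝ) : Prop where
  nonneg : ∀ t, 0 ≤ t → ∀ x p, 0 ≤ ρ t x p
  unit_mass : ∀ t, 0 ≤ t →
    Integrable (fun z : Pos n × ℝ => ρ t z.1 z.2) ∧ ∫ z : Pos n × ℝ, ρ t z.1 z.2 = 1
  regular : ContDiffOn ℝ 2 (fun w : ℝ × Pos n × ℝ => ρ w.1 w.2.1 w.2.2) {w | 0 < w.1}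
  equation : ∀ t, 0 < t → ∀ x p,
    τ * (deriv (fun s => ρ s x p) t - Δ (fun y => ρ t y p) x)
      = ν ^ 2 * deriv (deriv (ρ t x)) p + deriv (fun q => (deriv H q - σ) * ρ t x q) p
  initial : Tendsto
    (fun t => eLpNorm (fun z : Pos n × ℝ => ρ t z.1 z.2 - ρ 0 z.1 z.2) 1 volume)
    (𝓝[>] 0) (𝓝 0)

/-- The density `u` has finite second moment and finite entropy (so that the integrals in the
definitions of `𝒱` and `ℰ` converge), with `𝒱 ≤ C₀` and `ℰ ≤ C₀`. -/
structure InitialBounds {n : ℕ} (H : ℝ → ℝ) (σ ν C₀ : ℝ) (u : Pos n → ℝ → ℝ) : Prop where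
  integrable_moment : Integrable (fun z : Pos n × ℝ => (‖z.1‖ ^ 2 + z.2 ^ 2) * u z.1 z.2)
  integrable_entropy : Integrable (fun z : Pos n × ℝ => u z.1 z.2 * Real.log (u z.1 z.2))
  moment_le : secondMoment u ≤ C₀
  energy_le : energy H σ ν u ≤ C₀

end TiltedFP

end

noncomputable section

namespace TiltedFP

/-! Formally, with the Gibbs weight `μ = exp(-H_eff/ν²)` and `f = ρ/μ`, the equation reads `∂_t ρ =
div_x(μ ∇_x f) + (ν²/τ) ∂_p(μ ∂_p f)`, and the relative entropy `∬ μ f log f` equals `ℰ/ν²`. Its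
time derivative is at most `-(ν²/τ) 𝒟`, so `∫ 𝒟 dt ≤ τ ν⁻⁴ (ℰ(0) - ℰ(T))`. It remains to bound
`ℰ(T)` from below by `-C(1+T)`. By convex duality this follows from a bound `C(1+T)` on the moment
`∬ (|x|² + |p|) ρ(T)`.

The `x`-moment grows at rate `2n`. The `p`-moment is the crux: the drift acts at speed of order
`1/τ`, which is exponentially large, so `|p|` must be replaced by a comparable Lyapunov function `φ`
with `ν² φ'' - H_eff' φ' ≤ A τ` (`IsWell.exists_lyapunov`). Take `φ' = ψ` close to `ν⁻¹ exp((H_eff -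
H_eff(Q))/ν²)` around the maximum `Q`: this solves `ν² ψ' - H_eff' ψ = 0`, it has mass of order one
by Laplace's method, and at the well `P`, where it is switched on, it has size `exp(-h_R/ν²)` up to
a power of `ν`. Switching it off to the right of `Q` produces a term of favourable sign. Repeating
the step in every period (`stairs`) gives linear growth to the right; the reflected construction
handles the left, with barrier `h_L`. Both errors are at most a constant times `τ`.

Solutions have no prescribed decay in space, so both balances are proved for compactly supported
weights `η` and entropy densities `β` of bounded slope (`IsSolution.locEntropy_le`); bounded slope
also makes the functional continuous in `L¹` and so gives access to time `0`. With `β(r) = r` and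
truncations of `|x|² + φ` one obtains `IsSolution.moment_le`. With `β = entropyApprox δ M` and
spatial cutoffs one obtains the dissipation estimate: the entropy drop is bounded uniformly in the
regularization by `IsSolution.locEntropy_sub_le`, and Fatou's lemma removes the localization in
`IsSolution.lintegral_dissipation_le`. -/

/-! ### The potential near a well -/

/-- `U` climbs from the critical point `P` to the nondegenerate maximum point `Q`, and its
derivative is periodic. -/
structure IsBarrier (U : ℝ → ℝ) (L P Q : ℝ) : Prop where
  smooth : ContDiff ℝ 2 U
  lt_right : P < Q
  right_lt : Q < P + L
  periodic : Function.Periodic (deriv U) L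
  critical_left : deriv U P = 0
  critical_right : deriv U Q = 0
  nonneg : ∀ p ∈ Set.Icc P Q, 0 ≤ deriv U p
  concave : deriv (deriv U) Q < 0

lemma deriv_nonneg_of_monotoneOn_Icc {g : ℝ → ℝ} {a b x : ℝ} (hab : a < b)
    (hx : x ∈ Set.Icc a b) (hg : DifferentiableAt ℝ g x) (hm : MonotoneOn g (Set.Icc a b)) :
    0 ≤ deriv g x := by
  rw [← hg.derivWithin (uniqueDiffOn_Icc hab x hx)]
  exact hm.derivWithin_nonneg

lemma deriv_nonpos_of_antitoneOn_Icc {g : ℝ → ℝ} {a b x : ℝ} (hab : a < b)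
    (hx : x ∈ Set.Icc a b) (hg : DifferentiableAt ℝ g x) (hm : AntitoneOn g (Set.Icc a b)) :
    deriv g x ≤ 0 := by
  rw [← hg.derivWithin (uniqueDiffOn_Icc hab x hx)]
  exact hm.derivWithin_nonpos

lemma deriv_periodic {f : ℝ → ℝ} {L : ℝ} (hf : Function.Periodic f L) :
    Function.Periodic (deriv f) L := by
  intro p
  have : (fun q => f (q + L)) = f := funext hf
  rw [← deriv_comp_add_const, this]

lemma exists_abs_le_of_periodic {f : ℝ → ℝ} {L : ℝ} (hL : 0 < L) (hf : Function.Periodic f L)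
    (hc : Continuous f) : ∃ B : ℝ, 0 ≤ B ∧ ∀ p, |f p| ≤ B := by
  obtain ⟨B, hB⟩ := (isCompact_Icc (a := (0 : ℝ)) (b := L)).exists_bound_of_continuousOn
    hc.continuousOn
  have h0 : ∀ p, |f p| ≤ B := by
    intro p
    obtain ⟨y, hy, hyp⟩ := hf.exists_mem_Ico₀ hL p
    rw [hyp]
    exact hB y ⟨hy.1, hy.2.le⟩
  exact ⟨B, (abs_nonneg _).trans (h0 0), h0⟩

/-- A positive second derivative would make `x` a local minimum as well, so `f` would be locally
constant and the second derivative zero. -/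
lemma second_deriv_nonpos_of_isLocalMax {f : ℝ → ℝ} {x : ℝ} (hf : ContinuousAt f x)
    (h : IsLocalMax f x) : deriv (deriv f) x ≤ 0 := by
  by_contra! hpos
  have hmin := isLocalMin_of_deriv_deriv_pos hpos h.deriv_eq_zero hf
  have hconst : f =ᶠ[𝓝 x] fun _ => f x := by
    filter_upwards [h, hmin] with y h1 h2 using le_antisymm h1 h2
  have : deriv (deriv f) x = 0 := by
    rw [hconst.deriv.deriv_eq]; simp
  linarith

lemma second_deriv_nonneg_of_isLocalMin {f : ℝ → ℝ} {x : ℝ} (hf : ContinuousAt f x)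
    (h : IsLocalMin f x) : 0 ≤ deriv (deriv f) x := by
  have := second_deriv_nonpos_of_isLocalMax hf.neg h.neg
  have e : deriv (-f) = -deriv f := by ext y; simp
  rw [e] at this
  simpa using this

/-- Otherwise `H' ≥ σ ≥ 0`, so the periodic function `H` is monotone, hence constant, and `σ^* = 0 ≤
σ`. -/
lemma IsPotential.sigmaLower_lt {H : ℝ → ℝ} {L : ℝ} (hH : IsPotential H L) {σ : ℝ}
    (hσ : 0 ≤ σ) (hσ' : σ < sigmaUpper H) : sigmaLower H < σ := by
  by_contra! hle
  have hd : Differentiable ℝ H := hH.smooth.differentiable (by norm_num)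
  have hc : Continuous (deriv H) := hH.smooth.continuous_deriv (by norm_num)
  obtain ⟨B, -, hB⟩ := exists_abs_le_of_periodic hH.period_pos (deriv_periodic hH.periodic) hc
  have hbdd : BddBelow (Set.range (deriv H)) := ⟨-B, by
    rintro _ ⟨p, rfl⟩; exact (abs_le.1 (hB p)).1⟩
  have hnn : ∀ p, 0 ≤ deriv H p := fun p => hσ.trans (hle.trans (ciInf_le hbdd p))
  have hmono : Monotone H := monotone_of_deriv_nonneg hd hnn
  have hconst : ∀ p q : ℝ, p ≤ q → H q ≤ H p := by
    intro p q _
    obtain ⟨y, hy, hyq⟩ := hH.periodic.exists_mem_Ico hH.period_pos q (p - L)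
    rw [hyq]
    exact hmono (by linarith [hy.2])
  have hz : ∀ p, deriv H p = 0 := by
    have : H = fun _ => H 0 := by
      ext p
      rcases le_total p 0 with h | h
      · exact le_antisymm (hmono h) (hconst _ _ h)
      · exact le_antisymm (hconst _ _ h) (hmono h)
    intro p; rw [this]; simp
  have : sigmaUpper H = 0 := by simp [sigmaUpper, hz]
  linarith

section Well

variable {H : ℝ → ℝ} {L σ P Q : ℝ}

lemma contDiff_effPot (hH : ContDiff ℝ 3 H) : ContDiff ℝ 3 (effPot H σ) := by
  unfold effPot; fun_prop

lemma deriv_effPot (hH : ContDiff ℝ 3 H) : deriv (effPot H σ) = fun p => deriv H p - σ := by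
  ext p
  have h1 : HasDerivAt H (deriv H p) p :=
    (hH.differentiable (by norm_num)).differentiableAt.hasDerivAt
  have h2 : HasDerivAt (effPot H σ) (deriv H p - σ * 1) p := h1.sub ((hasDerivAt_id p).const_mul σ)
  rw [h2.deriv, mul_one]

lemma deriv_deriv_effPot (hH : ContDiff ℝ 3 H) :
    deriv (deriv (effPot H σ)) = deriv (deriv H) := by
  rw [deriv_effPot hH]; ext p; simp

/-- A critical point of `H_eff` has `H' = σ`, which lies strictly between the two extreme values
that degenerate points are allowed to take. -/
lemma IsWell.second_deriv_ne_zero (hH : IsPotential H L) (hσ : 0 ≤ σ) (hσ' : σ < sigmaUpper H)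
    {p : ℝ} (hp : deriv (effPot H σ) p = 0) : deriv (deriv H) p ≠ 0 := by
  intro h0
  simp only [deriv_effPot hH.smooth] at hp
  have hl := hH.sigmaLower_lt hσ hσ'
  rcases hH.nondegenerate p h0 with h | h
  · rw [h] at hp; linarith
  · rw [h] at hp; linarith

lemma IsWell.second_deriv_pos (h : IsWell H L σ P Q) (hH : IsPotential H L) (hσ : 0 ≤ σ)
    (hσ' : σ < sigmaUpper H) : 0 < deriv (deriv H) P := by
  have h1 := second_deriv_nonneg_of_isLocalMin
    (contDiff_effPot (σ := σ) hH.smooth).continuous.continuousAt h.isLocalMin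
  rw [deriv_deriv_effPot hH.smooth] at h1
  exact lt_of_le_of_ne h1 (IsWell.second_deriv_ne_zero hH hσ hσ' h.isLocalMin.deriv_eq_zero).symm

lemma IsWell.second_deriv_neg (h : IsWell H L σ P Q) (hH : IsPotential H L) (hσ : 0 ≤ σ)
    (hσ' : σ < sigmaUpper H) : deriv (deriv H) Q < 0 := by
  have h1 := second_deriv_nonpos_of_isLocalMax
    (contDiff_effPot (σ := σ) hH.smooth).continuous.continuousAt h.isLocalMax
  rw [deriv_deriv_effPot hH.smooth] at h1
  exact lt_of_le_of_ne h1 (IsWell.second_deriv_ne_zero hH hσ hσ' h.isLocalMax.deriv_eq_zero)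

/-- The sign of the curvature places `P` on an increasing branch of `H'` and `Q` on the following
decreasing branch. Between `P` and `Q` the slope therefore rises from `σ` and falls back to `σ`, and
between `Q` and `P + L` it does the opposite. -/
lemma IsWell.deriv_sign (h : IsWell H L σ P Q) (hH : IsPotential H L) (hσ : 0 ≤ σ)
    (hσ' : σ < sigmaUpper H) :
    (∀ p ∈ Set.Icc P Q, σ ≤ deriv H p) ∧ ∀ p ∈ Set.Icc Q (P + L), deriv H p ≤ σ := by
  have hPpos := h.second_deriv_pos hH hσ hσ'
  have hQneg := h.second_deriv_neg hH hσ hσ'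
  have hP : deriv H P = σ := by
    have := h.isLocalMin.deriv_eq_zero; rw [deriv_effPot hH.smooth] at this; linarith
  have hQ : deriv H Q = σ := by
    have := h.isLocalMax.deriv_eq_zero; rw [deriv_effPot hH.smooth] at this; linarith
  have hL := hH.period_pos
  have hper := deriv_periodic hH.periodic
  have hdd : Differentiable ℝ (deriv H) :=
    ((contDiff_succ_iff_deriv (n := 2)).1 hH.smooth).2.2.differentiable (by norm_num)
  obtain ⟨a, b, hab, hba, hmono, hanti, haP, hPa⟩ : ∃ a b : ℝ, a < b ∧ b < a + L ∧
      MonotoneOn (deriv H) (Set.Icc a b) ∧ AntitoneOn (deriv H) (Set.Icc b (a + L)) ∧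
      a ≤ P ∧ P < a + L := by
    obtain ⟨a, b, hab, hba, hmono, hanti⟩ := hH.unimodal
    -- The unimodality interval is translated by a multiple of the period so that it contains `P`.
    obtain ⟨k, hk, -⟩ := existsUnique_sub_zsmul_mem_Ico hL P a
    rw [zsmul_eq_mul] at hk
    have hs : ∀ x, deriv H (x - k * L) = deriv H x := fun x => hper.sub_int_mul_eq k
    refine ⟨a + k * L, b + k * L, by linarith, by linarith, ?_, ?_, by linarith [hk.1],
      by linarith [hk.2]⟩
    · intro x hx y hy hxy
      rw [← hs x, ← hs y]
      exact hmono ⟨by linarith [hx.1], by linarith [hx.2]⟩ ⟨by linarith [hy.1], by linarith [hy.2]⟩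
        (by linarith)
    · intro x hx y hy hxy
      rw [← hs x, ← hs y]
      exact hanti ⟨by linarith [hx.1], by linarith [hx.2]⟩ ⟨by linarith [hy.1], by linarith [hy.2]⟩
        (by linarith)
  have hPb : P < b := by
    by_contra! hb
    have := deriv_nonpos_of_antitoneOn_Icc hba ⟨hb, hPa.le⟩ hdd.differentiableAt hanti
    linarith
  have hmono' : MonotoneOn (deriv H) (Set.Icc (a + L) (b + L)) := by
    intro x hx y hy hxy
    rw [← hper.sub_eq x, ← hper.sub_eq y]
    exact hmono ⟨by linarith [hx.1], by linarith [hx.2]⟩ ⟨by linarith [hy.1], by linarith [hy.2]⟩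
        (by linarith)
  have hPQ := h.lt_right
  have hQP := h.right_lt
  have hbQ : b < Q := by
    by_contra! hb
    have := deriv_nonneg_of_monotoneOn_Icc hab ⟨by linarith, hb⟩ hdd.differentiableAt hmono
    linarith
  have hQa : Q < a + L := by
    by_contra! hb
    have := deriv_nonneg_of_monotoneOn_Icc (by linarith) ⟨hb, by linarith⟩
      hdd.differentiableAt hmono'
    linarith
  constructor
  · intro p hp
    rcases le_total p b with hpb | hpb
    · rw [← hP]
      exact hmono ⟨haP, hPb.le⟩ ⟨by linarith [hp.1], hpb⟩ hp.1
    · rw [← hQ]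
      exact hanti ⟨hpb, by linarith [hp.2]⟩ ⟨hbQ.le, hQa.le⟩ hp.2
  · intro p hp
    rcases le_total p (a + L) with hpa | hpa
    · rw [← hQ]
      exact hanti ⟨hbQ.le, hQa.le⟩ ⟨by linarith [hp.1], hpa⟩ hp.1
    · rw [← hP, ← hper P]
      exact hmono' ⟨hpa, by linarith [hp.2]⟩ ⟨by linarith, by linarith⟩ hp.2

lemma IsWell.isBarrier_right (h : IsWell H L σ P Q) (hH : IsPotential H L) (hσ : 0 ≤ σ)
    (hσ' : σ < sigmaUpper H) : IsBarrier (effPot H σ) L P Q where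
  smooth := (contDiff_effPot hH.smooth).of_le (by norm_num)
  lt_right := h.lt_right
  right_lt := h.right_lt
  periodic := by
    rw [deriv_effPot hH.smooth]
    intro p
    simp [deriv_periodic hH.periodic p]
  critical_left := h.isLocalMin.deriv_eq_zero
  critical_right := h.isLocalMax.deriv_eq_zero
  nonneg p hp := by
    rw [deriv_effPot hH.smooth]
    linarith [(h.deriv_sign hH hσ hσ').1 p hp]
  concave := by
    rw [deriv_deriv_effPot hH.smooth]
    exact h.second_deriv_neg hH hσ hσ'

/-- Under `p ↦ -p` the maximum `Q - L` to the left of `P` becomes the maximum `L - Q` to the right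
of `-P`. -/
lemma IsWell.isBarrier_left (h : IsWell H L σ P Q) (hH : IsPotential H L) (hσ : 0 ≤ σ)
    (hσ' : σ < sigmaUpper H) : IsBarrier (fun p => effPot H σ (-p)) L (-P) (L - Q) := by
  have hr := h.isBarrier_right hH hσ hσ'
  have hd : deriv (fun p => effPot H σ (-p)) = fun p => -deriv (effPot H σ) (-p) := by
    ext p; exact deriv_comp_neg _ _
  have hdd : deriv (deriv (fun p => effPot H σ (-p))) =
      fun p => deriv (deriv (effPot H σ)) (-p) := by
    rw [hd]; ext p
    have : (fun p => -deriv (effPot H σ) (-p)) = -(fun p => deriv (effPot H σ) (-p)) := rfl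
    rw [this, deriv.neg, deriv_comp_neg, neg_neg]
  have hQ' : -(L - Q) = Q - L := by ring
  refine ⟨hr.smooth.comp contDiff_neg, by linarith [h.right_lt], by linarith [h.lt_right], ?_, ?_,
    ?_, ?_, ?_⟩
  · intro p
    rw [hd]
    simp only
    rw [neg_add, ← sub_eq_add_neg, hr.periodic.sub_eq]
  · rw [hd]; simp [hr.critical_left]
  · rw [hd]; simp [hr.periodic.sub_eq, hr.critical_right]
  · intro p hp
    rw [hd]
    simp only
    rw [← hr.periodic (-p), deriv_effPot hH.smooth]
    linarith [(h.deriv_sign hH hσ hσ').2 (-p + L) ⟨by linarith [hp.2], by linarith [hp.1]⟩]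
  · rw [hdd]
    simp only
    rw [hQ', (deriv_periodic hr.periodic).sub_eq]
    exact hr.concave

end Well

/-! ### A Lyapunov function for the drift across the barriers -/

lemma abs_sub_le_mul_sq {U : ℝ → ℝ} (hU : ContDiff ℝ 2 U) {K c : ℝ}
    (hK : ∀ p, |deriv (deriv U) p| ≤ K) (hc : deriv U c = 0) (p : ℝ) :
    |U p - U c| ≤ K * (p - c) ^ 2 := by
  have hd1 : Differentiable ℝ U := hU.differentiable (by norm_num)
  have hd2 : Differentiable ℝ (deriv U) :=
    ((contDiff_succ_iff_deriv (n := 1)).1 hU).2.2.differentiable (by norm_num)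
  have h1 : ∀ q, |deriv U q| ≤ K * |q - c| := by
    intro q
    have := convex_univ.norm_image_sub_le_of_norm_deriv_le (f := deriv U) (C := K) (x := c) (y := q)
      (fun x _ => hd2.differentiableAt) (fun x _ => hK x) (Set.mem_univ _) (Set.mem_univ _)
    simpa [hc] using this
  have hK0 : 0 ≤ K := (abs_nonneg _).trans (hK c)
  have := (convex_uIcc c p).norm_image_sub_le_of_norm_deriv_le (f := U) (C := K * |p - c|)
    (x := c) (y := p) (fun x _ => hd1.differentiableAt)
    (fun x hx => (h1 x).trans (mul_le_mul_of_nonneg_left ?_ hK0))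
    Set.left_mem_uIcc Set.right_mem_uIcc
  · rw [Real.norm_eq_abs, Real.norm_eq_abs, mul_assoc, abs_mul_abs_self] at this
    rw [pow_two]; exact this
  · exact Set.abs_sub_left_of_mem_uIcc hx

namespace IsBarrier

variable {U : ℝ → ℝ} {L P Q : ℝ}

/-- Strict concavity gives the quadratic drop on `[Q - δ, Q]`; further left `U` is no larger than at
`Q - δ`, and shrinking the constant by `δ² / (Q - P)²` covers all of `[P, Q]`. This is the Gaussian
bound used for the mass of the profile. -/
lemma le_sub_sq (h : IsBarrier U L P Q) :
    ∃ κ : ℝ, 0 < κ ∧ ∀ p ∈ Set.Icc P Q, U p ≤ U Q - κ * (Q - p) ^ 2 := by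
  have hd1 : Differentiable ℝ U := h.smooth.differentiable (by norm_num)
  have hC2 : ContDiff ℝ 1 (deriv U) := ((contDiff_succ_iff_deriv (n := 1)).1 h.smooth).2.2
  have hd2 : Differentiable ℝ (deriv U) := hC2.differentiable (by norm_num)
  have hcont : Continuous (deriv (deriv U)) := hC2.continuous_deriv (by norm_num)
  obtain ⟨m, hm0, hm⟩ : ∃ m : ℝ, 0 < m ∧ deriv (deriv U) Q < -(2 * m) :=
    ⟨-(deriv (deriv U) Q) / 4, by linarith [h.concave], by linarith [h.concave]⟩
  obtain ⟨δ₀, hδ₀, hδ₀'⟩ := Metric.eventually_nhds_iff.1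
    (hcont.continuousAt.eventually_lt continuousAt_const hm)
  set δ := min (δ₀ / 2) (Q - P) with hδdef
  have hδ : 0 < δ := lt_min (by linarith) (by linarith [h.lt_right])
  have hδP : δ ≤ Q - P := min_le_right _ _
  have hnear : ∀ p ∈ Set.Icc (Q - δ) Q, deriv (deriv U) p ≤ -(2 * m) := by
    intro p hp
    refine (hδ₀' ?_).le
    rw [Real.dist_eq, abs_lt]
    have : δ ≤ δ₀ / 2 := min_le_left _ _
    constructor <;> linarith [hp.1, hp.2]
  have hslope : ∀ p ∈ Set.Icc (Q - δ) Q, 2 * m * (Q - p) ≤ deriv U p := by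
    intro p hp
    have hanti : AntitoneOn (fun p => deriv U p + 2 * m * p) (Set.Icc (Q - δ) Q) := by
      have hder : ∀ x, HasDerivAt (fun p => deriv U p + 2 * m * p)
          (deriv (deriv U) x + 2 * m * 1) x := fun x =>
        (hd2 x).hasDerivAt.add ((hasDerivAt_id x).const_mul (2 * m))
      refine antitoneOn_of_deriv_nonpos (convex_Icc _ _)
        (fun x _ => (hder x).continuousAt.continuousWithinAt)
        (fun x _ => (hder x).differentiableAt.differentiableWithinAt) fun x hx => ?_
      rw [(hder x).deriv]
      have := hnear x (interior_subset hx)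
      linarith
    have := hanti hp ⟨by linarith, le_rfl⟩ hp.2
    simp only [h.critical_right] at this
    linarith
  have hlocal : ∀ p ∈ Set.Icc (Q - δ) Q, U p ≤ U Q - m * (Q - p) ^ 2 := by
    intro p hp
    have hmono : MonotoneOn (fun p => U p + m * (Q - p) ^ 2) (Set.Icc (Q - δ) Q) := by
      have hder : ∀ x, HasDerivAt (fun p => U p + m * (Q - p) ^ 2)
          (deriv U x + m * (2 * (Q - x) * (-1))) x := fun x => by
        have h2 := (((hasDerivAt_id x).const_sub Q).pow 2).const_mul m
        have h3 := (hd1 x).hasDerivAt.add h2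
        exact h3.congr_deriv (by simp)
      refine monotoneOn_of_deriv_nonneg (convex_Icc _ _)
        (fun x _ => (hder x).continuousAt.continuousWithinAt)
        (fun x _ => (hder x).differentiableAt.differentiableWithinAt) fun x hx => ?_
      rw [(hder x).deriv]
      have := hslope x (interior_subset hx)
      linarith
    have := hmono hp ⟨by linarith, le_rfl⟩ hp.2
    simp only [sub_self] at this
    linarith
  have hUmono : MonotoneOn U (Set.Icc P Q) :=
    monotoneOn_of_deriv_nonneg (convex_Icc _ _) hd1.continuous.continuousOn
      hd1.differentiableOn fun x hx => h.nonneg x (interior_subset hx)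
  have hPQ : 0 < Q - P := by linarith [h.lt_right]
  have hr : δ ^ 2 / (Q - P) ^ 2 ≤ 1 := by
    rw [div_le_one (by positivity)]; gcongr
  refine ⟨m * (δ ^ 2 / (Q - P) ^ 2), by positivity, fun p hp => ?_⟩
  rcases le_total (Q - δ) p with hpδ | hpδ
  · refine (hlocal p ⟨hpδ, hp.2⟩).trans ?_
    have : m * (δ ^ 2 / (Q - P) ^ 2) * (Q - p) ^ 2 ≤ m * 1 * (Q - p) ^ 2 := by gcongr
    linarith
  · have h1 := hUmono hp ⟨by linarith, by linarith⟩ hpδ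
    have h2 := hlocal (Q - δ) ⟨le_rfl, by linarith⟩
    have h3 : m * (δ ^ 2 / (Q - P) ^ 2) * (Q - p) ^ 2 ≤
        m * (δ ^ 2 / (Q - P) ^ 2) * (Q - P) ^ 2 := by
      have h0 : 0 ≤ Q - p := by linarith [hp.2]
      have h0' : Q - p ≤ Q - P := by linarith [hp.1]
      gcongr
    have h4 : m * (δ ^ 2 / (Q - P) ^ 2) * (Q - P) ^ 2 = m * δ ^ 2 := by field_simp
    have h5 : Q - (Q - δ) = δ := by ring
    rw [h5] at h2
    linarith

/-- The density `ψ = ν⁻¹ exp((U - U Q)/ν²) S₁ S₂` is annihilated by `ν² ∂ - U'` except where a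
cutoff varies. The term from `S₁'` lives on `[P, P + ν]`, where the exponential is as small as
`exp(-(U Q - U P)/ν²)`; the term from the decreasing cutoff `S₂` is nonpositive and needs no
smallness. -/
lemma exists_profile (h : IsBarrier U L P Q) :
    ∃ c A ν₀ : ℝ, 0 < c ∧ 0 < A ∧ 0 < ν₀ ∧ ∀ ν, 0 < ν → ν < ν₀ → ∃ ψ : ℝ → ℝ,
      ContDiff ℝ 1 ψ ∧ (∀ p, 0 ≤ ψ p) ∧ (∀ p ≤ P, ψ p = 0) ∧
      (∃ q < P + L, ∀ p, q ≤ p → ψ p = 0) ∧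
      c ≤ ∫ p in P..(P + L), ψ p ∧ ∫ p in P..(P + L), ψ p ≤ A ∧
      ∀ p, ν ^ 2 * deriv ψ p - deriv U p * ψ p ≤ A * Real.exp (-(U Q - U P) / ν ^ 2) := by
  have hd1 : Differentiable ℝ U := h.smooth.differentiable (by norm_num)
  have hC2 : ContDiff ℝ 1 (deriv U) := ((contDiff_succ_iff_deriv (n := 1)).1 h.smooth).2.2
  obtain ⟨κ, hκ, hquad⟩ := h.le_sub_sq
  obtain ⟨K, hK0, hK⟩ := exists_abs_le_of_periodic (by linarith [h.lt_right, h.right_lt])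
    (deriv_periodic h.periodic) (hC2.continuous_deriv (by norm_num))
  have hS2 : ContDiff ℝ 1 Real.smoothTransition := Real.smoothTransition.contDiff
  have hSd : Differentiable ℝ Real.smoothTransition := hS2.differentiable (by norm_num)
  obtain ⟨B, hB⟩ := (isCompact_Icc (a := (0 : ℝ)) (b := 1)).exists_bound_of_continuousOn
    (hS2.continuous_deriv (by norm_num)).continuousOn
  have hB0 : 0 ≤ B := (norm_nonneg _).trans (hB 0 ⟨le_rfl, zero_le_one⟩)
  -- The lower bound `c` comes from `[Q, Q + ν]`, where `ψ ≥ ν⁻¹ exp(-K)`. The first entry of `A` is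
  -- a Gaussian integral over `[P, Q]` plus the contribution of `[Q, Q + 2ν]`; the second bounds the
  -- error of the cutoff at `P`.
  set c := Real.exp (-K) with hc
  set A := max (√(Real.pi / κ) + 2 * Real.exp (4 * K)) (B * Real.exp K) with hA
  have hApos : 0 < A := lt_max_of_lt_left (by positivity)
  refine ⟨c, A, min (Q - P) ((P + L - Q) / 3), Real.exp_pos _, hApos,
    lt_min (by linarith [h.lt_right]) (by linarith [h.right_lt]), fun ν hν hνlt => ?_⟩
  have hν1 : ν < Q - P := hνlt.trans_le (min_le_left _ _)
  have hν2 : 3 * ν < P + L - Q := by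
    have := hνlt.trans_le (min_le_right _ _); linarith
  set E : ℝ → ℝ := fun p => Real.exp ((U p - U Q) / ν ^ 2) with hE
  set S₁ : ℝ → ℝ := fun p => Real.smoothTransition ((p - P) / ν) with hS₁
  set S₂ : ℝ → ℝ := fun p => Real.smoothTransition ((Q + 2 * ν - p) / ν) with hS₂
  have hS₁0 : ∀ p, 0 ≤ S₁ p := fun p => Real.smoothTransition.nonneg _
  have hS₂0 : ∀ p, 0 ≤ S₂ p := fun p => Real.smoothTransition.nonneg _
  have hS₁1 : ∀ p, S₁ p ≤ 1 := fun p => Real.smoothTransition.le_one _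
  have hS₂1 : ∀ p, S₂ p ≤ 1 := fun p => Real.smoothTransition.le_one _
  set ψ : ℝ → ℝ := fun p => ν⁻¹ * (E p * (S₁ p * S₂ p)) with hψ
  have hψ1 : ContDiff ℝ 1 ψ := by
    have hU1 : ContDiff ℝ 1 U := h.smooth.of_le (by norm_num)
    have e1 : ContDiff ℝ 1 E := by simp only [hE]; fun_prop
    have e2 : ContDiff ℝ 1 S₁ := hS2.comp (by fun_prop)
    have e3 : ContDiff ℝ 1 S₂ := hS2.comp (by fun_prop)
    exact contDiff_const.mul (e1.mul (e2.mul e3))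
  have hψ0 : ∀ p, 0 ≤ ψ p := fun p =>
    mul_nonneg (by positivity) (mul_nonneg (Real.exp_pos _).le (mul_nonneg (hS₁0 p) (hS₂0 p)))
  have hψE : ∀ p, ψ p ≤ ν⁻¹ * E p := fun p => by
    refine mul_le_mul_of_nonneg_left ?_ (by positivity)
    exact mul_le_of_le_one_right (Real.exp_pos _).le (mul_le_one₀ (hS₁1 p) (hS₂0 p) (hS₂1 p))
  have hψleft : ∀ p ≤ P, ψ p = 0 := fun p hp => by
    have : S₁ p = 0 := Real.smoothTransition.zero_of_nonpos
      (div_nonpos_of_nonpos_of_nonneg (by linarith) hν.le)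
    simp [hψ, this]
  have hψright : ∀ p, Q + 2 * ν ≤ p → ψ p = 0 := fun p hp => by
    have : S₂ p = 0 := Real.smoothTransition.zero_of_nonpos
      (div_nonpos_of_nonpos_of_nonneg (by linarith) hν.le)
    simp [hψ, this]
  have hint : ∀ a b, IntervalIntegrable ψ volume a b := fun a b =>
    hψ1.continuous.intervalIntegrable a b
  have hsplit : ∫ p in P..(P + L), ψ p =
      (∫ p in P..Q, ψ p) + (∫ p in Q..(Q + 2 * ν), ψ p) := by
    rw [← intervalIntegral.integral_add_adjacent_intervals (hint P (Q + 2 * ν))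
      (hint (Q + 2 * ν) (P + L)),
      ← intervalIntegral.integral_add_adjacent_intervals (hint P Q) (hint Q (Q + 2 * ν))]
    have : ∫ p in (Q + 2 * ν)..(P + L), ψ p = 0 := by
      rw [intervalIntegral.integral_congr (g := fun _ => (0 : ℝ))]
      · simp
      · intro p hp
        rw [Set.uIcc_of_le (by linarith)] at hp
        exact hψright p hp.1
    rw [this, add_zero]
  refine ⟨ψ, hψ1, hψ0, hψleft, ⟨Q + 2 * ν, by linarith, hψright⟩, ?_, ?_, ?_⟩
  · rw [hsplit, ← intervalIntegral.integral_add_adjacent_intervals (hint Q (Q + ν))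
      (hint (Q + ν) (Q + 2 * ν))]
    have h1 : 0 ≤ ∫ p in P..Q, ψ p :=
      intervalIntegral.integral_nonneg h.lt_right.le fun p _ => hψ0 p
    have h2 : 0 ≤ ∫ p in (Q + ν)..(Q + 2 * ν), ψ p :=
      intervalIntegral.integral_nonneg (by linarith) fun p _ => hψ0 p
    have h3 : ∫ _ in Q..(Q + ν), ν⁻¹ * c ≤ ∫ p in Q..(Q + ν), ψ p := by
      refine intervalIntegral.integral_mono_on (by linarith) (by simp) (hint _ _) fun p hp => ?_
      have e1 : S₁ p = 1 := Real.smoothTransition.one_of_one_le (by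
        rw [one_le_div hν]; linarith [hp.1])
      have e2 : S₂ p = 1 := Real.smoothTransition.one_of_one_le (by
        rw [one_le_div hν]; linarith [hp.2])
      simp only [hψ, e1, e2, mul_one]
      refine mul_le_mul_of_nonneg_left (Real.exp_le_exp.2 ?_) (by positivity)
      rw [le_div_iff₀ (by positivity)]
      have := (abs_le.1 (abs_sub_le_mul_sq h.smooth hK h.critical_right p)).1
      have h5 : (p - Q) ^ 2 ≤ ν ^ 2 := by
        apply pow_le_pow_left₀ (by linarith [hp.1]); linarith [hp.2]
      have := mul_le_mul_of_nonneg_left h5 hK0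
      linarith
    rw [intervalIntegral.integral_const] at h3
    have : (Q + ν - Q) • (ν⁻¹ * c) = c := by simp; field_simp
    linarith
  · rw [hsplit]
    refine le_trans (add_le_add ?_ ?_) (le_max_left _ _)
    · have hg : Integrable fun x : ℝ => Real.exp (-(κ / ν ^ 2) * x ^ 2) :=
        integrable_exp_neg_mul_sq (by positivity)
      have hg' : Integrable fun p : ℝ => ν⁻¹ * Real.exp (-(κ / ν ^ 2) * (p - Q) ^ 2) :=
        (hg.comp_sub_right Q).const_mul _
      calc ∫ p in P..Q, ψ p
          ≤ ∫ p in P..Q, ν⁻¹ * Real.exp (-(κ / ν ^ 2) * (p - Q) ^ 2) := by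
            refine intervalIntegral.integral_mono_on h.lt_right.le (hint _ _)
              hg'.intervalIntegrable fun p hp => (hψE p).trans ?_
            refine mul_le_mul_of_nonneg_left (Real.exp_le_exp.2 ?_) (by positivity)
            have := hquad p hp
            rw [neg_mul, div_mul_eq_mul_div, ← neg_div]
            gcongr
            linarith [show (p - Q) ^ 2 = (Q - p) ^ 2 by ring]
        _ ≤ ∫ p, ν⁻¹ * Real.exp (-(κ / ν ^ 2) * (p - Q) ^ 2) := by
            rw [intervalIntegral.integral_of_le h.lt_right.le]
            exact setIntegral_le_integral hg' (Eventually.of_forall fun p => by positivity)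
        _ = √(Real.pi / κ) := by
            rw [integral_const_mul,
              integral_sub_right_eq_self (fun x : ℝ => Real.exp (-(κ / ν ^ 2) * x ^ 2)),
              integral_gaussian, div_div_eq_mul_div, mul_div_right_comm,
              Real.sqrt_mul (by positivity), Real.sqrt_sq hν.le]
            field_simp
    · calc ∫ p in Q..(Q + 2 * ν), ψ p
          ≤ ∫ _ in Q..(Q + 2 * ν), ν⁻¹ * Real.exp (4 * K) := by
            refine intervalIntegral.integral_mono_on (by linarith) (hint _ _)
              (by simp) fun p hp => (hψE p).trans ?_
            refine mul_le_mul_of_nonneg_left (Real.exp_le_exp.2 ?_) (by positivity)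
            rw [div_le_iff₀ (by positivity)]
            have := (abs_le.1 (abs_sub_le_mul_sq h.smooth hK h.critical_right p)).2
            have h5 : (p - Q) ^ 2 ≤ (2 * ν) ^ 2 := by
              apply pow_le_pow_left₀ (by linarith [hp.1]); linarith [hp.2]
            have := mul_le_mul_of_nonneg_left h5 hK0
            linarith
        _ = 2 * Real.exp (4 * K) := by
            rw [intervalIntegral.integral_const]; simp; field_simp
  · intro p
    have hE' : HasDerivAt E (E p * (deriv U p / ν ^ 2)) p :=
      (((hd1 p).hasDerivAt.sub_const (U Q)).div_const (ν ^ 2)).exp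
    have h1' : HasDerivAt S₁ (deriv Real.smoothTransition ((p - P) / ν) * (1 / ν)) p :=
      HasDerivAt.comp p (h := fun p => (p - P) / ν) (hSd _).hasDerivAt
        (((hasDerivAt_id p).sub_const P).div_const ν)
    have h2' : HasDerivAt S₂ (deriv Real.smoothTransition ((Q + 2 * ν - p) / ν) * (-1 / ν)) p :=
      HasDerivAt.comp p (h := fun p => (Q + 2 * ν - p) / ν) (hSd _).hasDerivAt
        (((hasDerivAt_id p).const_sub (Q + 2 * ν)).div_const ν)
    have hψ' := (hE'.mul (h1'.mul h2')).const_mul ν⁻¹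
    have hmono : ∀ x, 0 ≤ deriv Real.smoothTransition x := fun x =>
      Real.smoothTransition.monotone.deriv_nonneg
    have hder : deriv ψ p = _ := hψ'.deriv
    set s₁ := deriv Real.smoothTransition ((p - P) / ν) with hs₁
    set s₂ := deriv Real.smoothTransition ((Q + 2 * ν - p) / ν) with hs₂
    have hEp : 0 < E p := Real.exp_pos _
    have heq : ν ^ 2 * deriv ψ p - deriv U p * ψ p =
        E p * (s₁ * S₂ p) - E p * (S₁ p * s₂) := by
      rw [hder]
      simp only [hψ, Pi.mul_apply]
      field_simp
      ring
    -- The exponential factor cancels the drift, and the term of the right cutoff is dropped because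
    -- of its sign.
    have hle : ν ^ 2 * deriv ψ p - deriv U p * ψ p ≤ E p * s₁ := by
      rw [heq]
      have e1 : 0 ≤ E p * (S₁ p * s₂) := mul_nonneg hEp.le (mul_nonneg (hS₁0 p) (hmono _))
      have e2 : E p * (s₁ * S₂ p) ≤ E p * s₁ := by
        gcongr
        exact mul_le_of_le_one_right (hmono _) (hS₂1 p)
      linarith
    refine hle.trans ?_
    by_cases hp : p ∈ Set.Icc P (P + ν)
    · have hs₁B : s₁ ≤ B := (le_abs_self _).trans (hB _ ⟨div_nonneg (by linarith [hp.1]) hν.le, by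
        rw [div_le_one hν]; linarith [hp.2]⟩)
      have hEle : E p ≤ Real.exp K * Real.exp (-(U Q - U P) / ν ^ 2) := by
        rw [← Real.exp_add]
        apply Real.exp_le_exp.2
        have := (abs_le.1 (abs_sub_le_mul_sq h.smooth hK h.critical_left p)).2
        have h5 : (p - P) ^ 2 ≤ ν ^ 2 := by
          apply pow_le_pow_left₀ (by linarith [hp.1]); linarith [hp.2]
        have h6 := mul_le_mul_of_nonneg_left h5 hK0
        rw [div_le_iff₀ (by positivity), add_mul, div_mul_cancel₀ _ (by positivity)]
        linarith
      calc E p * s₁ ≤ (Real.exp K * Real.exp (-(U Q - U P) / ν ^ 2)) * B := by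
            gcongr
            exact hmono _
        _ = B * Real.exp K * Real.exp (-(U Q - U P) / ν ^ 2) := by ring
        _ ≤ _ := by
            gcongr
            exact le_max_right _ _
    · have : s₁ = 0 := by
        rw [Set.mem_Icc, not_and_or, not_le, not_le] at hp
        rcases hp with hp | hp
        · have hev : Real.smoothTransition =ᶠ[𝓝 ((p - P) / ν)] fun _ => 0 := by
            filter_upwards [eventually_lt_nhds (div_neg_of_neg_of_pos (by linarith) hν)] with x hx
            exact Real.smoothTransition.zero_of_nonpos hx.le
          rw [hs₁, hev.deriv_eq]; simp
        · have hev : Real.smoothTransition =ᶠ[𝓝 ((p - P) / ν)] fun _ => 1 := by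
            filter_upwards [eventually_gt_nhds ((one_lt_div hν).2 (by linarith))] with x hx
            exact Real.smoothTransition.one_of_one_le hx.le
          rw [hs₁, hev.deriv_eq]; simp
      rw [this, mul_zero]
      positivity

end IsBarrier

/-- The function that repeats the increase of a primitive of `ψ` over `[P, P + L]` on every period
to the right of `P`. -/
def stairs (ψ : ℝ → ℝ) (L P p : ℝ) : ℝ :=
  ⌊(p - P) / L⌋₊ * (∫ q in P..(P + L), ψ q) + ∫ q in P..(p - ⌊(p - P) / L⌋₊ * L), ψ q

section Stairs

variable {ψ : ℝ → ℝ} {L P q : ℝ}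

lemma stairs_eq_of_mem (hL : 0 < L) {k : ℕ} {p : ℝ} (h1 : P + k * L ≤ p)
    (h2 : p < P + (k + 1) * L) :
    stairs ψ L P p = k * (∫ q in P..(P + L), ψ q) + ∫ q in P..(p - k * L), ψ q := by
  have : ⌊(p - P) / L⌋₊ = k := by
    rw [Nat.floor_eq_iff (div_nonneg (by nlinarith [k.cast_nonneg (α := ℝ)]) hL.le),
      le_div_iff₀ hL, div_lt_iff₀ hL]
    constructor <;> linarith
  rw [stairs, this]

lemma stairs_eq_of_lt (hL : 0 < L) {p : ℝ} (h : p < P + L) :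
    stairs ψ L P p = ∫ q in P..p, ψ q := by
  have : ⌊(p - P) / L⌋₊ = 0 := by
    rw [Nat.floor_eq_zero, div_lt_one hL]; linarith
  rw [stairs, this]; simp

lemma integral_eq_zero_of_le (hleft : ∀ p ≤ P, ψ p = 0) {p : ℝ} (hp : p ≤ P) :
    ∫ q in P..p, ψ q = 0 := by
  rw [intervalIntegral.integral_congr (g := fun _ => (0 : ℝ))]
  · simp
  · intro x hx
    rw [Set.uIcc_of_ge hp] at hx
    exact hleft x hx.2

/-- Since `ψ` vanishes at both ends of `[P, P + L]`, just to the left of a jump of the floor the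
formulas with `k - 1` and `k` agree. The natural-number floor is `0` to the left of `P`, where the
primitive vanishes too, so smoothness holds at every point. -/
lemma stairs_eventuallyEq (hL : 0 < L) (hψ : Continuous ψ) (hleft : ∀ p ≤ P, ψ p = 0)
    (hq : q < P + L) (hright : ∀ p, q ≤ p → ψ p = 0) (p : ℝ) :
    ∃ k : ℕ, stairs ψ L P =ᶠ[𝓝 p]
      fun p => k * (∫ q in P..(P + L), ψ q) + ∫ q in P..(p - k * L), ψ q := by
  rcases lt_or_ge p (P + L) with hp | hp
  · refine ⟨0, ?_⟩
    filter_upwards [eventually_lt_nhds hp] with x hx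
    simp [stairs_eq_of_lt hL hx]
  · set k := ⌊(p - P) / L⌋₊ with hk
    have hk1 : 1 ≤ k := by
      rw [hk, Nat.one_le_floor_iff, one_le_div hL]; linarith
    have hnn : 0 ≤ (p - P) / L := div_nonneg (by linarith) hL.le
    have hle : P + k * L ≤ p := by
      have := (le_div_iff₀ hL).1 (Nat.floor_le hnn); linarith
    have hlt : p < P + (k + 1) * L := by
      have := (div_lt_iff₀ hL).1 (Nat.lt_floor_add_one ((p - P) / L)); linarith
    obtain ⟨j, hj⟩ : ∃ j : ℕ, k = j + 1 := ⟨k - 1, by omega⟩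
    have hjr : (k : ℝ) = j + 1 := by rw [hj]; push_cast; ring
    refine ⟨k, ?_⟩
    have hlow : q + j * L < p := by rw [hjr] at hle; linarith
    have hlow' : P + j * L < p := by rw [hjr] at hle; linarith
    filter_upwards [eventually_lt_nhds hlt, eventually_gt_nhds hlow, eventually_gt_nhds hlow']
      with x hx hx' hx''
    rcases le_or_gt (P + k * L) x with hxk | hxk
    · exact stairs_eq_of_mem hL hxk hx
    · have e1 : stairs ψ L P x = j * (∫ q in P..(P + L), ψ q) + ∫ q in P..(x - j * L), ψ q :=
        stairs_eq_of_mem hL hx''.le (by rw [hjr] at hxk; exact hxk)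
      have e2 : ∫ q in P..(x - j * L), ψ q = ∫ q in P..(P + L), ψ q := by
        rw [← intervalIntegral.integral_add_adjacent_intervals
          (hψ.intervalIntegrable P (x - j * L)) (hψ.intervalIntegrable (x - j * L) (P + L)),
          intervalIntegral.integral_congr (a := x - j * L) (g := fun _ => (0 : ℝ))]
        · simp
        · intro y hy
          rw [hjr] at hxk
          rw [Set.uIcc_of_le (by linarith)] at hy
          exact hright y (by linarith [hy.1])
      have e3 : ∫ q in P..(x - k * L), ψ q = 0 :=
        integral_eq_zero_of_le hleft (by linarith)
      rw [e1, e2, e3, hjr]; ring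

end Stairs

/-- Locally the derivative of `stairs` is a translate of `ψ` by a multiple of `L`. As `U'` is
periodic (`U` itself is tilted), the bound on the generator carries over from one period to all.
Steps of height between `c` and `A` per length `L` give linear growth to the right only. -/
lemma IsBarrier.exists_lyapunov {U : ℝ → ℝ} {L P Q : ℝ} (h : IsBarrier U L P Q) :
    ∃ c A ν₀ : ℝ, 0 < c ∧ 0 < A ∧ 0 < ν₀ ∧ ∀ ν, 0 < ν → ν < ν₀ → ∃ φ : ℝ → ℝ,
      ContDiff ℝ 2 φ ∧ (∀ p, 0 ≤ φ p) ∧ (∀ p, c * p - A ≤ φ p) ∧ (∀ p, φ p ≤ A * (1 + |p|)) ∧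
      ∀ p, ν ^ 2 * deriv (deriv φ) p - deriv U p * deriv φ p ≤
        A * Real.exp (-(U Q - U P) / ν ^ 2) := by
  have hL : 0 < L := by linarith [h.lt_right, h.right_lt]
  obtain ⟨c, A, ν₀, hc, hA, hν₀, H⟩ := h.exists_profile
  refine ⟨c / L, max A (max (c * (|P| / L + 1)) (A * (|P| / L + 1) + A / L)), ν₀, by positivity,
    lt_max_of_lt_left hA, hν₀, fun ν hν hνlt => ?_⟩
  obtain ⟨ψ, hψ1, hψ0, hleft, ⟨q, hq, hright⟩, hlow, hup, hgen⟩ := H ν hν hνlt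
  set a := ∫ p in P..(P + L), ψ p with ha
  have hψc := hψ1.continuous
  have hev := stairs_eventuallyEq hL hψc hleft hq hright
  have hprim : ∀ p, HasDerivAt (fun x => ∫ q in P..x, ψ q) (ψ p) p := fun p =>
    intervalIntegral.integral_hasDerivAt_right (hψc.intervalIntegrable _ _)
      hψc.aestronglyMeasurable.stronglyMeasurableAtFilter hψc.continuousAt
  have hprimC : ContDiff ℝ 2 (fun x => ∫ q in P..x, ψ q) := by
    rw [show (2 : WithTop ℕ∞) = 1 + 1 by norm_num, contDiff_succ_iff_deriv]
    refine ⟨fun p => (hprim p).differentiableAt, by simp, ?_⟩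
    rwa [funext fun p => (hprim p).deriv]
  have hmono : ∀ x y, x ≤ y → ∫ q in P..x, ψ q ≤ ∫ q in P..y, ψ q := by
    intro x y hxy
    rw [← intervalIntegral.integral_add_adjacent_intervals
          (hψc.intervalIntegrable P x) (hψc.intervalIntegrable x y)]
    linarith [intervalIntegral.integral_nonneg (μ := volume) hxy fun p _ => hψ0 p]
  have hprim0 : ∀ x, 0 ≤ ∫ q in P..x, ψ q := by
    intro x
    rcases le_total x P with hx | hx
    · rw [integral_eq_zero_of_le hleft hx]
    · exact intervalIntegral.integral_nonneg hx fun p _ => hψ0 p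
  have ha0 : 0 ≤ a := hprim0 _
  have hfloor : ∀ p, (⌊(p - P) / L⌋₊ : ℝ) ≤ |p - P| / L := fun p =>
    (Nat.cast_le.2 (Nat.floor_le_floor (by gcongr; exact le_abs_self _))).trans
      (Nat.floor_le (by positivity))
  refine ⟨stairs ψ L P, ?_, ?_, ?_, ?_, ?_⟩
  · rw [contDiff_iff_contDiffAt]
    intro p
    obtain ⟨k, hk⟩ := hev p
    refine ContDiffAt.congr_of_eventuallyEq ?_ hk
    exact (contDiff_const.add (hprimC.comp (contDiff_id.sub contDiff_const))).contDiffAt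
  · intro p
    exact add_nonneg (mul_nonneg (Nat.cast_nonneg _) ha0) (hprim0 _)
  · intro p
    have h1 : (p - P) / L - 1 ≤ ⌊(p - P) / L⌋₊ := (Nat.sub_one_lt_floor _).le
    have h2 : c * ((p - P) / L - 1) ≤ ⌊(p - P) / L⌋₊ * a :=
      calc c * ((p - P) / L - 1) ≤ c * ⌊(p - P) / L⌋₊ := by gcongr
        _ ≤ a * ⌊(p - P) / L⌋₊ := by gcongr
        _ = _ := mul_comm _ _
    have h3 : c * (|P| / L + 1) ≤ max A (max (c * (|P| / L + 1)) (A * (|P| / L + 1) + A / L)) :=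
      (le_max_left _ _).trans (le_max_right _ _)
    have h4 : c * (P / L) ≤ c * (|P| / L) := by gcongr; exact le_abs_self _
    have h5 : c * ((p - P) / L - 1) = c / L * p - c * (P / L) - c := by field_simp
    have h6 := hprim0 (p - ⌊(p - P) / L⌋₊ * L)
    simp only [stairs]
    linarith
  · intro p
    have h1 : ∫ q in P..(p - ⌊(p - P) / L⌋₊ * L), ψ q ≤ a := by
      refine hmono _ _ ?_
      have := (div_lt_iff₀ hL).1 (Nat.lt_floor_add_one ((p - P) / L))
      linarith
    have h2 : ⌊(p - P) / L⌋₊ * a ≤ |p - P| / L * A :=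
      mul_le_mul (hfloor p) hup ha0 (by positivity)
    have h3 : |p - P| / L * A ≤ (|p| + |P|) / L * A := by gcongr; exact abs_sub _ _
    have h4 : A * (|P| / L + 1) + A / L ≤
      max A (max (c * (|P| / L + 1)) (A * (|P| / L + 1) + A / L)) :=
      (le_max_right _ _).trans (le_max_right _ _)
    have h5 := mul_le_mul_of_nonneg_right h4 (show 0 ≤ 1 + |p| by positivity)
    refine le_trans ?_ h5
    have h6 : (|p| + |P|) / L * A + A ≤ (A * (|P| / L + 1) + A / L) * (1 + |p|) := by
      have : (A * (|P| / L + 1) + A / L) * (1 + |p|) - ((|p| + |P|) / L * A + A) =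
        A / L + A * (|P| / L + 1) * |p| := by field_simp; ring
      have : 0 ≤ A / L + A * (|P| / L + 1) * |p| := by positivity
      linarith
    simp only [stairs]
    linarith
  · intro p
    obtain ⟨k, hk⟩ := hev p
    have hd : ∀ x, HasDerivAt (fun p => k * a + ∫ q in P..(p - k * L), ψ q) (ψ (x - k * L)) x := by
      intro x
      simpa using ((hprim (x - k * L)).comp_sub_const x (k * L)).const_add (k * a)
    have hd' : deriv (fun p => k * a + ∫ q in P..(p - k * L), ψ q) = fun x => ψ (x - k * L) :=
      funext fun x => (hd x).deriv
    have e1 := hk.deriv_eq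
    have e2 := hk.deriv.deriv_eq
    rw [hd'] at e1 e2
    rw [e1, e2, deriv_comp_sub_const]
    have hper : deriv U p = deriv U (p - k * L) := (h.periodic.sub_nat_mul_eq k).symm
    rw [hper]
    refine (hgen (p - k * L)).trans ?_
    gcongr
    exact le_max_left _ _

lemma IsWell.kramersConst_pos {H : ℝ → ℝ} {L σ P Q : ℝ} (h : IsWell H L σ P Q)
    (hH : IsPotential H L) (hσ : 0 ≤ σ) (hσ' : σ < sigmaUpper H) : 0 < kramersConst H P Q := by
  have h1 := (h.second_deriv_pos hH hσ hσ').ne'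
  have h2 := (h.second_deriv_neg hH hσ hσ').ne
  unfold kramersConst
  have : 0 < |deriv (deriv H) P * deriv (deriv H) Q| := abs_pos.2 (mul_ne_zero h1 h2)
  positivity

/-- A Lyapunov function growing linearly in both directions, on which the drift of the generator
is at most of the order of the Kramers rate. -/
lemma IsWell.exists_lyapunov {H : ℝ → ℝ} {L σ P Q : ℝ} (h : IsWell H L σ P Q)
    (hH : IsPotential H L) (hσ : 0 ≤ σ) (hσ' : σ < sigmaUpper H) :
    ∃ c A ν₀ : ℝ, 0 < c ∧ 0 < A ∧ 0 < ν₀ ∧ ∀ ν, 0 < ν → ν < ν₀ → ∃ φ : ℝ → ℝ,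
      ContDiff ℝ 2 φ ∧ (∀ p, 0 ≤ φ p) ∧ (∀ p, c * |p| - A ≤ φ p) ∧
      (∀ p, φ p ≤ A * (1 + |p|)) ∧
      ∀ p, ν ^ 2 * deriv (deriv φ) p - deriv (effPot H σ) p * deriv φ p ≤
        A * tau H L σ P Q ν := by
  obtain ⟨c₁, A₁, ν₁, hc₁, hA₁, hν₁, H₁⟩ := (h.isBarrier_right hH hσ hσ').exists_lyapunov
  obtain ⟨c₂, A₂, ν₂, hc₂, hA₂, hν₂, H₂⟩ := (h.isBarrier_left hH hσ hσ').exists_lyapunov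
  have hk := h.kramersConst_pos hH hσ hσ'
  set κ := kramersConst H P Q with hκ
  -- The summand `A₁ + A₂` serves the growth bounds; the summand divided by `κ` turns both
  -- exponentials, each at most `τ / κ`, into multiples of `τ`.
  refine ⟨min c₁ c₂, (A₁ + A₂) + (A₁ + A₂) / κ, min ν₁ ν₂, lt_min hc₁ hc₂, by positivity,
    lt_min hν₁ hν₂, fun ν hν hνlt => ?_⟩
  obtain ⟨φ₁, hC₁, hn₁, hl₁, hu₁, hg₁⟩ := H₁ ν hν (hνlt.trans_le (min_le_left _ _))
  obtain ⟨φ₂, hC₂, hn₂, hl₂, hu₂, hg₂⟩ := H₂ ν hν (hνlt.trans_le (min_le_right _ _))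
  have hAκ : 0 ≤ (A₁ + A₂) / κ := by positivity
  refine ⟨fun p => φ₁ p + φ₂ (-p), hC₁.add (hC₂.comp contDiff_neg),
    fun p => add_nonneg (hn₁ p) (hn₂ _), fun p => ?_, fun p => ?_, fun p => ?_⟩
  · have e1 := hl₁ p
    have e2 := hl₂ (-p)
    have n1 := hn₁ p
    have n2 := hn₂ (-p)
    show _ ≤ φ₁ p + φ₂ (-p)
    rcases le_total 0 p with hp | hp
    · rw [abs_of_nonneg hp]
      have := mul_le_mul_of_nonneg_right (min_le_left c₁ c₂) hp
      linarith
    · rw [abs_of_nonpos hp]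
      have := mul_le_mul_of_nonneg_right (min_le_right c₁ c₂) (neg_nonneg.2 hp)
      linarith
  · have e1 := hu₁ p
    have e2 := hu₂ (-p)
    rw [abs_neg] at e2
    have : 0 ≤ (A₁ + A₂) / κ * (1 + |p|) := by positivity
    show φ₁ p + φ₂ (-p) ≤ _
    linarith
  · have hd1 : ∀ p, HasDerivAt φ₁ (deriv φ₁ p) p := fun p =>
      (hC₁.differentiable (by norm_num) p).hasDerivAt
    have hd2 : ∀ p, HasDerivAt φ₂ (deriv φ₂ p) p := fun p =>
      (hC₂.differentiable (by norm_num) p).hasDerivAt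
    have hdd1 : ∀ p, HasDerivAt (deriv φ₁) (deriv (deriv φ₁) p) p := fun p =>
      (((contDiff_succ_iff_deriv (n := 1)).1 hC₁).2.2.differentiable (by norm_num) p).hasDerivAt
    have hdd2 : ∀ p, HasDerivAt (deriv φ₂) (deriv (deriv φ₂) p) p := fun p =>
      (((contDiff_succ_iff_deriv (n := 1)).1 hC₂).2.2.differentiable (by norm_num) p).hasDerivAt
    have hneg : ∀ p : ℝ, HasDerivAt (fun p : ℝ => -p) (-1) p := fun p => hasDerivAt_neg p
    have e1 : deriv (fun p => φ₁ p + φ₂ (-p)) = fun p => deriv φ₁ p - deriv φ₂ (-p) := by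
      ext p
      have := (hd1 p).add (HasDerivAt.comp p (h := fun p => -p) (hd2 (-p)) (hneg p))
      exact (this.congr_deriv (by ring)).deriv
    have e2 : deriv (fun p => deriv φ₁ p - deriv φ₂ (-p)) p =
        deriv (deriv φ₁) p + deriv (deriv φ₂) (-p) := by
      have := (hdd1 p).sub (HasDerivAt.comp p (h := fun p => -p) (hdd2 (-p)) (hneg p))
      exact (this.congr_deriv (by ring)).deriv
    rw [e1, e2]
    have g1 := hg₁ p
    have g2 := hg₂ (-p)
    rw [deriv_comp_neg, neg_neg] at g2
    have hb1 : Real.exp (-(effPot H σ Q - effPot H σ P) / ν ^ 2) ≤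
        tau H L σ P Q ν / κ := by
      rw [tau, mul_div_cancel_left₀ _ hk.ne']
      gcongr
      exact min_le_right _ _
    have hb2 : Real.exp (-(effPot H σ (-(L - Q)) - effPot H σ P) / ν ^ 2) ≤
        tau H L σ P Q ν / κ := by
      rw [tau, mul_div_cancel_left₀ _ hk.ne', show -(L - Q) = Q - L by ring]
      gcongr
      exact min_le_left _ _
    have hτ : 0 ≤ tau H L σ P Q ν := by unfold tau; positivity
    have b1 := mul_le_mul_of_nonneg_left hb1 hA₁.le
    have b2 := mul_le_mul_of_nonneg_left hb2 hA₂.le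
    have b3 : ((A₁ + A₂) + (A₁ + A₂) / κ) * tau H L σ P Q ν =
        (A₁ + A₂) * tau H L σ P Q ν + A₁ * (tau H L σ P Q ν / κ) +
        A₂ * (tau H L σ P Q ν / κ) := by field_simp; ring
    have b4 : 0 ≤ (A₁ + A₂) * tau H L σ P Q ν := by positivity
    simp only [neg_neg] at g2
    rw [b3]
    linarith

/-! ### Second order operators in divergence form -/

/-- `β` is of class `C²` on `[0, ∞)` with first and second derivative `β'` and `β''`. -/
structure IsC2OnNonneg (β β' β'' : ℝ → ℝ) : Prop where
  deriv_one : ∀ r, 0 ≤ r → HasDerivAt β (β' r) r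
  deriv_two : ∀ r, 0 ≤ r → HasDerivAt β' (β'' r) r
  continuousOn : ContinuousOn β'' (Set.Ici 0)

section WeakForm

variable {E : Type*} [NormedAddCommGroup E] [NormedSpace ℝ E]

lemma contDiff_fderiv_apply_const {u : E → ℝ} (hu : ContDiff ℝ 2 u) (v : E) :
    ContDiff ℝ 1 fun y => fderiv ℝ u y v :=
  (hu.fderiv_right (m := 1) (by norm_num)).clm_apply contDiff_const

lemma IsC2OnNonneg.fderiv_comp {β β' β'' : ℝ → ℝ} (hβ : IsC2OnNonneg β β' β'') {u : E → ℝ}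
    (hu : ContDiff ℝ 2 u) (hu0 : ∀ z, 0 ≤ u z) (z : E) :
    HasFDerivAt (fun y => β (u y)) (β' (u z) • fderiv ℝ u z) z ∧
    HasFDerivAt (fun y => β' (u y)) (β'' (u z) • fderiv ℝ u z) z := by
  have hd : HasFDerivAt u (fderiv ℝ u z) z := (hu.differentiable (by norm_num) z).hasFDerivAt
  exact ⟨(hβ.deriv_one _ (hu0 z)).comp_hasFDerivAt z hd,
    (hβ.deriv_two _ (hu0 z)).comp_hasFDerivAt z hd⟩

/-- Chain rule for a diffusion operator: the second derivative of `θ` multiplies the squared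
gradient, so a concave `θ` contributes a term of good sign when `m ≥ 0`. -/
lemma fderiv_mul_fderiv_comp {θ θ' θ'' : ℝ → ℝ} (h1 : ∀ r, HasDerivAt θ (θ' r) r)
    (h2 : ∀ r, HasDerivAt θ' (θ'' r) r) {m Ψ : E → ℝ} (hm : ContDiff ℝ 1 m)
    (hΨ : ContDiff ℝ 2 Ψ) (v z : E) :
    fderiv ℝ (fun y => m y * fderiv ℝ (fun x => θ (Ψ x)) y v) z v =
      θ' (Ψ z) * fderiv ℝ (fun y => m y * fderiv ℝ Ψ y v) z v
        + θ'' (Ψ z) * (m z * fderiv ℝ Ψ z v ^ 2) := by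
  have hd : ∀ z, HasFDerivAt Ψ (fderiv ℝ Ψ z) z := fun z =>
    (hΨ.differentiable (by norm_num) z).hasFDerivAt
  have e1 : (fun y => m y * fderiv ℝ (fun x => θ (Ψ x)) y v) =
      fun y => θ' (Ψ y) * (m y * fderiv ℝ Ψ y v) := by
    ext y
    have h0 : fderiv ℝ (fun x => θ (Ψ x)) y = _ := ((h1 _).comp_hasFDerivAt y (hd y)).fderiv
    rw [h0]
    simp only [smul_apply, smul_eq_mul]
    ring
  have hg : HasFDerivAt (fun y => m y * fderiv ℝ Ψ y v) _ z :=
    ((hm.mul (contDiff_fderiv_apply_const hΨ v)).differentiable (by norm_num) z).hasFDerivAt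
  have h3 := ((h2 _).comp_hasFDerivAt z (hd z)).mul hg
  have h4 : fderiv ℝ (fun y => θ' (Ψ y) * (m y * fderiv ℝ Ψ y v)) z = _ := h3.fderiv
  rw [e1, h4]
  simp only [add_apply, smul_apply, smul_eq_mul,
    Function.comp_apply]
  ring

variable [FiniteDimensional ℝ E] [MeasurableSpace E] [BorelSpace E] {vol : Measure E}
  [vol.IsAddHaarMeasure]

/-- Two integrations by parts in direction `v`: the first moves the outer derivative onto `η β'(u)`
and produces the dissipation term with `β''`; in the other term `β'(u) ∂u = ∂ β(u)`, and the second
moves this derivative onto `m ∂η`. Compact support of `η` excludes boundary terms. -/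
lemma integral_mul_divergence_form {β β' β'' : ℝ → ℝ} (hβ : IsC2OnNonneg β β' β'')
    {u m η : E → ℝ} (hu : ContDiff ℝ 2 u) (hu0 : ∀ z, 0 ≤ u z) (hm : ContDiff ℝ 1 m)
    (hη : ContDiff ℝ 2 η) (hηs : HasCompactSupport η) (v : E) :
    Integrable (fun z => β (u z) * fderiv ℝ (fun y => m y * fderiv ℝ η y v) z v) vol ∧
    Integrable (fun z => η z * β'' (u z) * (m z * fderiv ℝ u z v ^ 2)) vol ∧
    Integrable (fun z => η z * β' (u z) * fderiv ℝ (fun y => m y * fderiv ℝ u y v) z v) vol ∧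
    ∫ z, η z * β' (u z) * fderiv ℝ (fun y => m y * fderiv ℝ u y v) z v ∂vol =
      ∫ z, β (u z) * fderiv ℝ (fun y => m y * fderiv ℝ η y v) z v ∂vol
        - ∫ z, η z * β'' (u z) * (m z * fderiv ℝ u z v ^ 2) ∂vol := by
  have hβu := hβ.fderiv_comp hu hu0
  have hu1 := contDiff_fderiv_apply_const hu v
  have hη1 := contDiff_fderiv_apply_const hη v
  have hw : ContDiff ℝ 1 fun y => m y * fderiv ℝ η y v := hm.mul hη1
  have hg : ContDiff ℝ 1 fun y => m y * fderiv ℝ u y v := hm.mul hu1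
  have hηs1 : HasCompactSupport fun y => fderiv ℝ η y v := hηs.fderiv_apply (𝕜 := ℝ) v
  have hws : HasCompactSupport fun y => m y * fderiv ℝ η y v := hηs1.mul_left
  have hws1 : HasCompactSupport fun z => fderiv ℝ (fun y => m y * fderiv ℝ η y v) z v :=
    hws.fderiv_apply (𝕜 := ℝ) v
  have cβ : Continuous fun z => β (u z) :=
    continuous_iff_continuousAt.2 fun z => (hβu z).1.continuousAt
  have cβ' : Continuous fun z => β' (u z) :=
    continuous_iff_continuousAt.2 fun z => (hβu z).2.continuousAt
  have cβ'' : Continuous fun z => β'' (u z) :=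
    hβ.continuousOn.comp_continuous hu.continuous hu0
  have cw := (hw.continuous_fderiv (by norm_num)).clm_apply (continuous_const (y := v))
  have cg := (hg.continuous_fderiv (by norm_num)).clm_apply (continuous_const (y := v))
  have cη := hη.continuous
  have cη1 := hη1.continuous
  have cu1 := hu1.continuous
  have cm := hm.continuous
  have i1 : Integrable (fun z => β (u z) * fderiv ℝ (fun y => m y * fderiv ℝ η y v) z v) vol :=
    (cβ.mul cw).integrable_of_hasCompactSupport hws1.mul_left
  have i2 : Integrable (fun z => η z * β'' (u z) * (m z * fderiv ℝ u z v ^ 2)) vol :=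
    ((cη.mul cβ'').mul (cm.mul (cu1.pow 2))).integrable_of_hasCompactSupport
      hηs.mul_right.mul_right
  have i3 : Integrable
      (fun z => η z * β' (u z) * fderiv ℝ (fun y => m y * fderiv ℝ u y v) z v) vol :=
    ((cη.mul cβ').mul cg).integrable_of_hasCompactSupport hηs.mul_right.mul_right
  refine ⟨i1, i2, i3, ?_⟩
  have ha : ∀ z, HasFDerivAt (fun z => η z * β' (u z)) _ z := fun z =>
    (hη.differentiable (by norm_num) z).hasFDerivAt.mul (hβu z).2
  have hae : ∀ z, fderiv ℝ (fun z => η z * β' (u z)) z v =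
      η z * (β'' (u z) * fderiv ℝ u z v) + β' (u z) * fderiv ℝ η z v := by
    intro z
    rw [(ha z).fderiv]
    simp
  have i4 : Integrable (fun z => (m z * fderiv ℝ η z v) * (β' (u z) * fderiv ℝ u z v)) vol :=
    ((cm.mul cη1).mul (cβ'.mul cu1)).integrable_of_hasCompactSupport hws.mul_right
  have e0 : (fun z => fderiv ℝ (fun z => η z * β' (u z)) z v * (m z * fderiv ℝ u z v)) =
      fun z => (m z * fderiv ℝ η z v) * (β' (u z) * fderiv ℝ u z v)
        + η z * β'' (u z) * (m z * fderiv ℝ u z v ^ 2) := by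
    ext z; rw [hae]; ring
  have hβe : ∀ z, fderiv ℝ (fun z => β (u z)) z v = β' (u z) * fderiv ℝ u z v := by
    intro z; rw [(hβu z).1.fderiv]; simp
  have P1 := integral_mul_fderiv_eq_neg_fderiv_mul_of_integrable (μ := vol)
    (f := fun z => η z * β' (u z)) (g := fun y => m y * fderiv ℝ u y v) (v := v)
    (by rw [e0]; exact i4.add i2) i3
    (((cη.mul cβ').mul hg.continuous).integrable_of_hasCompactSupport hηs.mul_right.mul_right)
    (fun z _ => (ha z).differentiableAt) (fun z _ => hg.differentiable (by norm_num) z)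
  have P2 := integral_mul_fderiv_eq_neg_fderiv_mul_of_integrable (μ := vol)
    (f := fun z => m z * fderiv ℝ η z v) (g := fun y => β (u y)) (v := v)
    ((cw.mul cβ).integrable_of_hasCompactSupport hws1.mul_right)
    (by simp only [hβe]; exact i4)
    ((hw.continuous.mul cβ).integrable_of_hasCompactSupport hws.mul_right)
    (fun z _ => hw.differentiable (by norm_num) z) (fun z _ => (hβu z).1.differentiableAt)
  simp only [hβe] at P2
  rw [P1, e0, integral_add i4 i2, P2, neg_add, neg_neg, ← sub_eq_add_neg]
  congr 1
  exact integral_congr_ae (Eventually.of_forall fun z => mul_comm _ _)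

end WeakForm

/-! ### The Fokker-Planck operator in symmetric form relative to the Gibbs weight. -/

section Generator

variable {n : ℕ} {H : ℝ → ℝ} {σ ν τ : ℝ}

/-- The coordinate directions of position space, as directions in phase space. -/
def dirX (i : Fin n) : Pos n × ℝ := (EuclideanSpace.single i 1, 0)

/-- The direction of the `p`-axis in phase space. -/
def dirP : Pos n × ℝ := (0, 1)

/-- The (not normalizable) Gibbs weight `exp(-H_eff / ν²)`. -/
def gibbs (H : ℝ → ℝ) (σ ν : ℝ) (z : Pos n × ℝ) : ℝ := Real.exp (-(effPot H σ z.2) / ν ^ 2)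

/-- The density of `u` relative to the Gibbs weight. -/
def relDensity (H : ℝ → ℝ) (σ ν : ℝ) (u : Pos n → ℝ → ℝ) (z : Pos n × ℝ) : ℝ :=
  u z.1 z.2 * Real.exp (effPot H σ z.2 / ν ^ 2)

/-- The Gibbs weight times the generator of the diffusion, in divergence form. -/
def gen (H : ℝ → ℝ) (σ ν τ : ℝ) (η : Pos n × ℝ → ℝ) (z : Pos n × ℝ) : ℝ :=
  ∑ i, fderiv ℝ (fun y => gibbs H σ ν y * fderiv ℝ η y (dirX i)) z (dirX i)
    + ν ^ 2 / τ * fderiv ℝ (fun y => gibbs H σ ν y * fderiv ℝ η y dirP) z dirP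

lemma gibbs_pos (z : Pos n × ℝ) : 0 < gibbs H σ ν z := Real.exp_pos _

lemma gibbs_mul_relDensity (u : Pos n → ℝ → ℝ) (z : Pos n × ℝ) :
    relDensity H σ ν u z * gibbs H σ ν z = u z.1 z.2 := by
  rw [relDensity, gibbs, mul_assoc, ← Real.exp_add, neg_div, add_neg_cancel, Real.exp_zero, mul_one]

lemma contDiff_gibbs (hH : ContDiff ℝ 3 H) : ContDiff ℝ 1 (gibbs (n := n) H σ ν) := by
  have := (contDiff_effPot (σ := σ) hH).of_le (show (1 : WithTop ℕ∞) ≤ 3 by norm_num)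
  unfold gibbs; fun_prop

lemma contDiff_relDensity (hH : ContDiff ℝ 3 H) {u : Pos n → ℝ → ℝ}
    (hu : ContDiff ℝ 2 fun z : Pos n × ℝ => u z.1 z.2) : ContDiff ℝ 2 (relDensity H σ ν u) := by
  have := (contDiff_effPot (σ := σ) hH).of_le (show (2 : WithTop ℕ∞) ≤ 3 by norm_num)
  unfold relDensity; fun_prop

lemma gen_comp (hH : ContDiff ℝ 3 H) {θ θ' θ'' : ℝ → ℝ} (h1 : ∀ r, HasDerivAt θ (θ' r) r)
    (h2 : ∀ r, HasDerivAt θ' (θ'' r) r) {Ψ : Pos n × ℝ → ℝ} (hΨ : ContDiff ℝ 2 Ψ)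
    (z : Pos n × ℝ) :
    gen H σ ν τ (fun y => θ (Ψ y)) z = θ' (Ψ z) * gen H σ ν τ Ψ z + θ'' (Ψ z) * (gibbs H σ ν z *
      (∑ i, fderiv ℝ Ψ z (dirX i) ^ 2 + ν ^ 2 / τ * fderiv ℝ Ψ z dirP ^ 2)) := by
  have := contDiff_gibbs (n := n) (σ := σ) (ν := ν) hH
  simp only [gen, fderiv_mul_fderiv_comp h1 h2 this hΨ, Finset.sum_add_distrib, mul_add,
    Finset.mul_sum]
  ring

lemma fderiv_dirP {F : Pos n × ℝ → ℝ} {z : Pos n × ℝ} (hF : DifferentiableAt ℝ F z) :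
    fderiv ℝ F z dirP = deriv (fun q => F (z.1, q)) z.2 := by
  have h : HasDerivAt (fun q : ℝ => ((z.1, q) : Pos n × ℝ)) dirP z.2 :=
    (hasDerivAt_const z.2 z.1).prodMk (hasDerivAt_id z.2)
  exact (HasFDerivAt.comp_hasDerivAt z.2 (f := fun q : ℝ => ((z.1, q) : Pos n × ℝ))
    hF.hasFDerivAt h).deriv.symm

lemma laplacian_slice {F : Pos n × ℝ → ℝ} (hF : ContDiff ℝ 2 F) (x : Pos n) (p : ℝ) :
    Δ (fun y => F (y, p)) x = ∑ i, fderiv ℝ (fun y => fderiv ℝ F y (dirX i)) (x, p) (dirX i) := by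
  have hι : ∀ x : Pos n, HasFDerivAt (fun y : Pos n => ((y, p) : Pos n × ℝ))
      (ContinuousLinearMap.inl ℝ (Pos n) ℝ) x := fun x => hasFDerivAt_prodMk_left x p
  have h1 : ∀ x v, fderiv ℝ (fun y => F (y, p)) x v = fderiv ℝ F (x, p) (v, 0) := by
    intro x v
    have := HasFDerivAt.comp x (f := fun y : Pos n => ((y, p) : Pos n × ℝ))
      (hF.differentiable (by norm_num) (x, p)).hasFDerivAt (hι x)
    rw [show (fun y => F (y, p)) = F ∘ fun y : Pos n => ((y, p) : Pos n × ℝ) from rfl, this.fderiv]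
    simp
  have hslice : ContDiff ℝ 2 fun y => F (y, p) := hF.comp (contDiff_id.prodMk contDiff_const)
  rw [InnerProductSpace.laplacian_eq_iteratedFDeriv_orthonormalBasis _
    (EuclideanSpace.basisFun (Fin n) ℝ)]
  refine Finset.sum_congr rfl fun i _ => ?_
  rw [iteratedFDeriv_two_apply]
  simp only [EuclideanSpace.basisFun_apply, Matrix.cons_val_zero, Matrix.cons_val_one]
  have hd2 : DifferentiableAt ℝ (fderiv ℝ fun y => F (y, p)) x :=
    (hslice.fderiv_right (m := 1) (by norm_num)).differentiable (by norm_num) x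
  have e1 : fderiv ℝ (fderiv ℝ fun y => F (y, p)) x (EuclideanSpace.single i 1)
      (EuclideanSpace.single i 1) = fderiv ℝ (fun y => fderiv ℝ (fun y => F (y, p)) y
        (EuclideanSpace.single i 1)) x (EuclideanSpace.single i 1) := by
    rw [fderiv_clm_apply hd2 (differentiableAt_const _)]
    simp
  rw [e1]
  simp only [h1]
  have hG := (contDiff_fderiv_apply_const hF (dirX i)).differentiable (by norm_num) (x, p)
  have := HasFDerivAt.comp x (f := fun y : Pos n => ((y, p) : Pos n × ℝ)) hG.hasFDerivAt (hι x)
  rw [show (fun y => fderiv ℝ F (y, p) (EuclideanSpace.single i 1, 0)) =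
    (fun z => fderiv ℝ F z (dirX i)) ∘ fun y : Pos n => ((y, p) : Pos n × ℝ) from rfl, this.fderiv]
  simp [dirX]

/-- For a function `‖x‖² + g(p)` the generator is explicit. -/
lemma gen_norm_sq_add (hH : ContDiff ℝ 3 H) (hν : ν ≠ 0) {g : ℝ → ℝ}
    (hg : ContDiff ℝ 2 g) (z : Pos n × ℝ) :
    (gen H σ ν τ (fun y => ‖y.1‖ ^ 2 + g y.2) z = gibbs H σ ν z *
      (2 * n + (ν ^ 2 * deriv (deriv g) z.2 - deriv (effPot H σ) z.2 * deriv g z.2) / τ)) ∧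
    (∑ i, fderiv ℝ (fun y : Pos n × ℝ => ‖y.1‖ ^ 2 + g y.2) z (dirX i) ^ 2
      = 4 * ‖z.1‖ ^ 2) ∧
    fderiv ℝ (fun y : Pos n × ℝ => ‖y.1‖ ^ 2 + g y.2) z dirP = deriv g z.2 := by
  have hgd : ∀ y : Pos n × ℝ, HasFDerivAt (fun y : Pos n × ℝ => g y.2)
      (deriv g y.2 • ContinuousLinearMap.snd ℝ (Pos n) ℝ) y := fun y =>
    HasDerivAt.comp_hasFDerivAt y (hg.differentiable (by norm_num) y.2).hasDerivAt hasFDerivAt_snd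
  have hx : ∀ y : Pos n × ℝ, HasFDerivAt (fun y : Pos n × ℝ => ‖y.1‖ ^ 2)
      (2 • (innerSL ℝ y.1).comp (ContinuousLinearMap.fst ℝ (Pos n) ℝ)) y := fun y =>
    (hasFDerivAt_fst (𝕜 := ℝ) (p := y)).norm_sq
  have hd : ∀ y : Pos n × ℝ, fderiv ℝ (fun y : Pos n × ℝ => ‖y.1‖ ^ 2 + g y.2) y =
      2 • (innerSL ℝ y.1).comp (ContinuousLinearMap.fst ℝ (Pos n) ℝ)
        + deriv g y.2 • ContinuousLinearMap.snd ℝ (Pos n) ℝ := fun y =>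
    ((hx y).add (hgd y)).fderiv
  have hX : ∀ (i : Fin n) (y : Pos n × ℝ),
      fderiv ℝ (fun y : Pos n × ℝ => ‖y.1‖ ^ 2 + g y.2) y (dirX i) = 2 * y.1 i := by
    intro i y
    rw [hd]
    simp [dirX, EuclideanSpace.inner_single_right]
  have hP : ∀ y : Pos n × ℝ,
      fderiv ℝ (fun y : Pos n × ℝ => ‖y.1‖ ^ 2 + g y.2) y dirP = deriv g y.2 := by
    intro y
    rw [hd]
    simp [dirP]
  refine ⟨?_, ?_, hP z⟩
  · have hU : ∀ p, HasDerivAt (effPot H σ) (deriv (effPot H σ) p) p := fun p =>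
      ((contDiff_effPot hH).differentiable (by norm_num) p).hasDerivAt
    have hμ : HasFDerivAt (gibbs H σ ν) ((gibbs H σ ν z * (-(deriv (effPot H σ) z.2) / ν ^ 2)) •
        ContinuousLinearMap.snd ℝ (Pos n) ℝ) z :=
      HasDerivAt.comp_hasFDerivAt (h₂ := fun p => Real.exp (-(effPot H σ p) / ν ^ 2)) z
        (((hU z.2).neg.div_const (ν ^ 2)).exp) hasFDerivAt_snd
    have hg2 : HasFDerivAt (fun y : Pos n × ℝ => deriv g y.2)
      (deriv (deriv g) z.2 • ContinuousLinearMap.snd ℝ (Pos n) ℝ) z :=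
      HasDerivAt.comp_hasFDerivAt z
        ((((contDiff_succ_iff_deriv (n := 1)).1 hg).2.2.differentiable (by norm_num)
          z.2).hasDerivAt) hasFDerivAt_snd
    have hcoord : ∀ i : Fin n, HasFDerivAt (fun y : Pos n × ℝ => 2 * y.1 i)
        ((2 : ℝ) • (EuclideanSpace.proj (𝕜 := ℝ) i).comp (ContinuousLinearMap.fst ℝ (Pos n) ℝ))
          z := fun i =>
      (((EuclideanSpace.proj (𝕜 := ℝ) i).comp
        (ContinuousLinearMap.fst ℝ (Pos n) ℝ)).hasFDerivAt).const_mul 2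
    have eX : ∀ i : Fin n, fderiv ℝ (fun y => gibbs H σ ν y *
        fderiv ℝ (fun y : Pos n × ℝ => ‖y.1‖ ^ 2 + g y.2) y (dirX i)) z (dirX i) =
        2 * gibbs H σ ν z := by
      intro i
      simp only [hX]
      have h0 : fderiv ℝ (fun y => gibbs H σ ν y * (2 * y.1 i)) z = _ := (hμ.mul (hcoord i)).fderiv
      rw [h0]
      simp [dirX]
      ring
    have eP : fderiv ℝ (fun y => gibbs H σ ν y *
        fderiv ℝ (fun y : Pos n × ℝ => ‖y.1‖ ^ 2 + g y.2) y dirP) z dirP =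
        gibbs H σ ν z * (deriv (deriv g) z.2 - deriv (effPot H σ) z.2 * deriv g z.2 / ν ^ 2) := by
      simp only [hP]
      have h0 : fderiv ℝ (fun y => gibbs H σ ν y * deriv g y.2) z = _ := (hμ.mul hg2).fderiv
      rw [h0]
      simp [dirP]
      ring
    simp only [gen, eX, eP, Finset.sum_const, Finset.card_univ, Fintype.card_fin, nsmul_eq_mul]
    field_simp
  · simp only [hX]
    rw [EuclideanSpace.real_norm_sq_eq, Finset.mul_sum]
    exact Finset.sum_congr rfl fun i _ => by ring

end Generator

/-! ### Localized entropy inequalities for solutions -/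

instance {n : ℕ} : (volume : Measure (Pos n × ℝ)).IsAddHaarMeasure :=
  inferInstanceAs ((volume : Measure (Pos n)).prod (volume : Measure ℝ)).IsAddHaarMeasure

namespace IsSolution

variable {n : ℕ} {H : ℝ → ℝ} {σ ν τ : ℝ} {ρ : ℝ → Pos n → ℝ → ℝ}

lemma isOpen_posTime : IsOpen {w : ℝ × Pos n × ℝ | 0 < w.1} :=
  isOpen_lt continuous_const continuous_fst

lemma contDiff_slice (sol : IsSolution H σ ν τ ρ) {t : ℝ} (ht : 0 < t) :
    ContDiff ℝ 2 fun z : Pos n × ℝ => ρ t z.1 z.2 :=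
  sol.regular.comp_contDiff (f := fun z : Pos n × ℝ => ((t, z) : ℝ × Pos n × ℝ))
    (contDiff_const.prodMk contDiff_id) fun _ => ht

lemma hasDerivAt_time (sol : IsSolution H σ ν τ ρ) {t : ℝ} (ht : 0 < t) (z : Pos n × ℝ) :
    HasDerivAt (fun s => ρ s z.1 z.2) (fderiv ℝ
      (fun w : ℝ × Pos n × ℝ => ρ w.1 w.2.1 w.2.2) (t, z) (1, 0)) t := by
  have h1 : HasFDerivAt (fun w : ℝ × Pos n × ℝ => ρ w.1 w.2.1 w.2.2) _ (t, z) :=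
    ((sol.regular.contDiffAt (isOpen_posTime.mem_nhds ht)).differentiableAt
      (by norm_num)).hasFDerivAt
  exact HasFDerivAt.comp_hasDerivAt t (f := fun s : ℝ => ((s, z) : ℝ × Pos n × ℝ)) h1
    ((hasDerivAt_id t).prodMk (hasDerivAt_const t z))

lemma continuousOn_deriv_time (sol : IsSolution H σ ν τ ρ) :
    ContinuousOn (fun w : ℝ × Pos n × ℝ => deriv (fun s => ρ s w.2.1 w.2.2) w.1)
      {w | 0 < w.1} := by
  have h := (sol.regular.continuousOn_fderiv_of_isOpen isOpen_posTime (by norm_num)).clm_apply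
    (continuousOn_const (c := ((1 : ℝ), (0 : Pos n × ℝ))))
  exact h.congr fun w hw => (sol.hasDerivAt_time (z := w.2) hw).deriv

lemma relDensity_nonneg (sol : IsSolution H σ ν τ ρ) {t : ℝ} (ht : 0 ≤ t) (z : Pos n × ℝ) :
    0 ≤ relDensity H σ ν (ρ t) z := mul_nonneg (sol.nonneg t ht _ _) (Real.exp_pos _).le

/-- Multiplying the gradient of `f = ρ/μ` by `μ` gives `∂ρ` in the `x`-directions and `∂_p ρ + ν⁻²
(H' - σ) ρ` in the `p`-direction, so the equation takes divergence form. -/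
lemma deriv_time_eq_gen (sol : IsSolution H σ ν τ ρ) (hH : ContDiff ℝ 3 H) (hν : ν ≠ 0)
    (hτ : τ ≠ 0) {t : ℝ} (ht : 0 < t) (z : Pos n × ℝ) :
    deriv (fun s => ρ s z.1 z.2) t = gen H σ ν τ (relDensity H σ ν (ρ t)) z := by
  have hu := sol.contDiff_slice ht
  set u : Pos n × ℝ → ℝ := fun z => ρ t z.1 z.2 with hudef
  have hud : ∀ y, HasFDerivAt u (fderiv ℝ u y) y := fun y =>
    (hu.differentiable (by norm_num) y).hasFDerivAt
  have hU : ∀ p, HasDerivAt (effPot H σ) (deriv H p - σ) p := fun p => by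
    have := ((contDiff_effPot (σ := σ) hH).differentiable (by norm_num) p).hasDerivAt
    rwa [deriv_effPot hH] at this
  have hexp : ∀ y : Pos n × ℝ, HasFDerivAt
      (fun y : Pos n × ℝ => Real.exp (effPot H σ y.2 / ν ^ 2))
      ((Real.exp (effPot H σ y.2 / ν ^ 2) * ((deriv H y.2 - σ) / ν ^ 2)) •
        ContinuousLinearMap.snd ℝ (Pos n) ℝ) y := fun y =>
    HasDerivAt.comp_hasFDerivAt (h₂ := fun p => Real.exp (effPot H σ p / ν ^ 2)) y
      ((hU y.2).div_const (ν ^ 2)).exp hasFDerivAt_snd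
  have hf : ∀ y, fderiv ℝ (relDensity H σ ν (ρ t)) y = _ := fun y => ((hud y).mul (hexp y)).fderiv
  have hcancel : ∀ y : Pos n × ℝ, gibbs H σ ν y * Real.exp (effPot H σ y.2 / ν ^ 2) = 1 := by
    intro y
    rw [gibbs, ← Real.exp_add, neg_div, neg_add_cancel, Real.exp_zero]
  have eX : ∀ (i : Fin n) (y : Pos n × ℝ), gibbs H σ ν y *
      fderiv ℝ (relDensity H σ ν (ρ t)) y (dirX i) = fderiv ℝ u y (dirX i) := by
    intro i y
    rw [hf y]
    simp [dirX]
    rw [← mul_assoc, hcancel, one_mul]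
  have eP : ∀ y : Pos n × ℝ, gibbs H σ ν y *
      fderiv ℝ (relDensity H σ ν (ρ t)) y dirP =
        fderiv ℝ u y dirP + (ν ^ 2)⁻¹ * ((deriv H y.2 - σ) * u y) := by
    intro y
    rw [hf y]
    simp [dirP]
    rw [mul_add, ← mul_assoc _ _ (fderiv ℝ u y (0, 1)), hcancel]
    linear_combination (u y * (deriv H y.2 - σ) / ν ^ 2) * hcancel y
  have hdH : ContDiff ℝ 1 (deriv H) :=
    (((contDiff_succ_iff_deriv (n := 2)).1 hH).2.2).of_le (by norm_num)
  have hflux : ContDiff ℝ 1 fun y : Pos n × ℝ => (deriv H y.2 - σ) * u y :=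
    ((hdH.comp contDiff_snd).sub contDiff_const).mul (hu.of_le (by norm_num))
  have hpd := contDiff_fderiv_apply_const hu dirP
  have e3 : fderiv ℝ (fun y => fderiv ℝ u y dirP + (ν ^ 2)⁻¹ * ((deriv H y.2 - σ) * u y)) z dirP =
      deriv (deriv (ρ t z.1)) z.2
        + (ν ^ 2)⁻¹ * deriv (fun q => (deriv H q - σ) * ρ t z.1 q) z.2 := by
    have h1 := hpd.differentiable (by norm_num) z
    have h2 := hflux.differentiable (by norm_num) z
    have h3 : fderiv ℝ (fun y => fderiv ℝ u y dirP + (ν ^ 2)⁻¹ * ((deriv H y.2 - σ) * u y)) z = _ :=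
      (h1.hasFDerivAt.add (h2.hasFDerivAt.const_mul (ν ^ 2)⁻¹)).fderiv
    rw [h3]
    simp only [add_apply, smul_apply, smul_eq_mul]
    rw [fderiv_dirP h1, fderiv_dirP h2]
    congr 2
    ext q
    rw [fderiv_dirP (hu.differentiable (by norm_num) _)]
  have heq := sol.equation t ht z.1 z.2
  have hΔ := laplacian_slice hu z.1 z.2
  simp only [hudef] at hΔ
  rw [hΔ] at heq
  simp only [gen, eX, eP, e3]
  have : ν ^ 2 / τ * (deriv (deriv (ρ t z.1)) z.2
        + (ν ^ 2)⁻¹ * deriv (fun q => (deriv H q - σ) * ρ t z.1 q) z.2) =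
      (ν ^ 2 * deriv (deriv (ρ t z.1)) z.2 + deriv (fun q => (deriv H q - σ) * ρ t z.1 q) z.2) / τ := by
    field_simp
  rw [this, ← heq, mul_div_cancel_left₀ _ hτ]
  ring

/-- The flux in direction `p`, in terms of the relative density. -/
lemma gibbs_mul_fderiv_dirP (sol : IsSolution H σ ν τ ρ) (hH : ContDiff ℝ 3 H) {t : ℝ}
    (ht : 0 < t) (z : Pos n × ℝ) :
    gibbs H σ ν z * fderiv ℝ (relDensity H σ ν (ρ t)) z dirP =
      deriv (ρ t z.1) z.2 + (ν ^ 2)⁻¹ * (deriv H z.2 - σ) * ρ t z.1 z.2 := by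
  have hu := sol.contDiff_slice ht
  rw [fderiv_dirP ((contDiff_relDensity hH hu).differentiable (by norm_num) z)]
  have hU : HasDerivAt (effPot H σ) (deriv H z.2 - σ) z.2 := by
    have := ((contDiff_effPot (σ := σ) hH).differentiable (by norm_num) z.2).hasDerivAt
    rwa [deriv_effPot hH] at this
  have hρ : HasDerivAt (fun q => ρ t z.1 q) (deriv (ρ t z.1) z.2) z.2 :=
    ((hu.comp (contDiff_const.prodMk contDiff_id)).differentiable (by norm_num) z.2).hasDerivAt
  have h : deriv (fun q => relDensity H σ ν (ρ t) (z.1, q)) z.2 = _ :=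
    (hρ.mul (hU.div_const (ν ^ 2)).exp).deriv
  have hcancel : gibbs H σ ν z * Real.exp (effPot H σ z.2 / ν ^ 2) = 1 := by
    rw [gibbs, ← Real.exp_add, neg_div, neg_add_cancel, Real.exp_zero]
  rw [h]
  linear_combination (deriv (ρ t z.1) z.2 + (ν ^ 2)⁻¹ * (deriv H z.2 - σ) * ρ t z.1 z.2) * hcancel

/-- The integral of the time derivative of `η β(f) e^{-H_eff/ν²}`, where `f` is the relative
density. -/
def rate (β' : ℝ → ℝ) (H : ℝ → ℝ) (σ ν : ℝ) (ρ : ℝ → Pos n → ℝ → ℝ) (η : Pos n × ℝ → ℝ)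
    (t : ℝ) : ℝ :=
  ∫ z, η z * β' (relDensity H σ ν (ρ t) z) * deriv (fun s => ρ s z.1 z.2) t

/-- The localized entropy with density `β` relative to the Gibbs weight. -/
def locEntropy (β : ℝ → ℝ) (H : ℝ → ℝ) (σ ν : ℝ) (η : Pos n × ℝ → ℝ) (u : Pos n → ℝ → ℝ) : ℝ :=
  ∫ z, η z * (β (relDensity H σ ν u z) * gibbs H σ ν z)

/-- The density of the localized dissipation in `p` belonging to the entropy density `β`. -/
def locDiss (β'' : ℝ → ℝ) (H : ℝ → ℝ) (σ ν τ : ℝ) (η : Pos n × ℝ → ℝ) (u : Pos n → ℝ → ℝ)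
    (z : Pos n × ℝ) : ℝ :=
  ν ^ 2 / τ * (η z * β'' (relDensity H σ ν u z) *
    (gibbs H σ ν z * fderiv ℝ (relDensity H σ ν u) z dirP ^ 2))

variable {β β' β'' : ℝ → ℝ} {η : Pos n × ℝ → ℝ}

/-- By the double integration by parts, the localization enters only through `∫ β(f) gen η`, which
`hB` bounds by `B ∫ ρ = B`. The dissipation in `x` has a sign and is discarded. -/
lemma rate_add_diss_le (sol : IsSolution H σ ν τ ρ) (hH : ContDiff ℝ 3 H) (hν : ν ≠ 0)
    (hτ : 0 < τ) (hβ : IsC2OnNonneg β β' β'') (hη : ContDiff ℝ 2 η) (hηs : HasCompactSupport η)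
    (hsign : ∀ z r, 0 ≤ r → 0 ≤ η z * β'' r) {B : ℝ}
    (hB : ∀ z r, 0 ≤ r → β r * gen H σ ν τ η z ≤ B * (r * gibbs H σ ν z))
    {t : ℝ} (ht : 0 < t) :
    Integrable (locDiss β'' H σ ν τ η (ρ t)) ∧ (∀ z, 0 ≤ locDiss β'' H σ ν τ η (ρ t) z) ∧
    rate β' H σ ν ρ η t + ∫ z, locDiss β'' H σ ν τ η (ρ t) z ≤ B := by
  set f := relDensity H σ ν (ρ t) with hf
  have hf0 : ∀ z, 0 ≤ f z := sol.relDensity_nonneg ht.le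
  have hfC : ContDiff ℝ 2 f := contDiff_relDensity hH (sol.contDiff_slice ht)
  have hμ : ContDiff ℝ 1 (gibbs (n := n) H σ ν) := contDiff_gibbs hH
  have key := fun v => integral_mul_divergence_form (vol := volume) hβ hfC hf0 hμ hη hηs v
  have hDint : Integrable (locDiss β'' H σ ν τ η (ρ t)) := (key dirP).2.1.const_mul _
  have hnn : ∀ v z, 0 ≤ η z * β'' (f z) * (gibbs H σ ν z * fderiv ℝ f z v ^ 2) := fun v z =>
    mul_nonneg (hsign z _ (hf0 z)) (mul_nonneg (gibbs_pos z).le (sq_nonneg _))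
  refine ⟨hDint, fun z => mul_nonneg (by positivity) (hnn dirP z), ?_⟩
  have hrate : rate β' H σ ν ρ η t = ∑ i : Fin n, (∫ z, η z * β' (f z) *
        fderiv ℝ (fun y => gibbs H σ ν y * fderiv ℝ f y (dirX i)) z (dirX i)) +
      ν ^ 2 / τ * ∫ z, η z * β' (f z) *
        fderiv ℝ (fun y => gibbs H σ ν y * fderiv ℝ f y dirP) z dirP := by
    rw [← integral_finsetSum _ fun i _ => (key (dirX i)).2.2.1, ← integral_const_mul,
      ← integral_add (integrable_finsetSum _ fun i _ => (key (dirX i)).2.2.1)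
        ((key dirP).2.2.1.const_mul _)]
    refine integral_congr_ae (Eventually.of_forall fun z => ?_)
    simp only [sol.deriv_time_eq_gen hH hν hτ.ne' ht z, gen, ← hf]
    rw [mul_add, Finset.mul_sum]
    ring
  have hbd : ∑ i : Fin n, (∫ z, β (f z) *
        fderiv ℝ (fun y => gibbs H σ ν y * fderiv ℝ η y (dirX i)) z (dirX i)) +
      ν ^ 2 / τ * ∫ z, β (f z) *
        fderiv ℝ (fun y => gibbs H σ ν y * fderiv ℝ η y dirP) z dirP ≤ B := by
    rw [← integral_finsetSum _ fun i _ => (key (dirX i)).1, ← integral_const_mul,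
      ← integral_add (integrable_finsetSum _ fun i _ => (key (dirX i)).1)
        ((key dirP).1.const_mul _)]
    have hmass := sol.unit_mass t ht.le
    have : B = ∫ z : Pos n × ℝ, B * ρ t z.1 z.2 := by
      rw [integral_const_mul, hmass.2, mul_one]
    rw [this]
    refine integral_mono ((integrable_finsetSum _ fun i _ => (key (dirX i)).1).add
        ((key dirP).1.const_mul _)) (hmass.1.const_mul _) fun z => ?_
    have h := hB z (f z) (hf0 z)
    rw [hf, gibbs_mul_relDensity, ← hf] at h
    refine le_trans (le_of_eq ?_) h
    simp only [gen]
    rw [mul_add, Finset.mul_sum]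
    ring
  have hX : 0 ≤ ∑ i : Fin n, ∫ z, η z * β'' (f z) *
      (gibbs H σ ν z * fderiv ℝ f z (dirX i) ^ 2) :=
    Finset.sum_nonneg fun i _ => integral_nonneg (hnn _)
  have hD : ∫ z, locDiss β'' H σ ν τ η (ρ t) z = ν ^ 2 / τ * ∫ z, η z * β'' (f z) *
      (gibbs H σ ν z * fderiv ℝ f z dirP ^ 2) := integral_const_mul _ _
  rw [hrate, hD]
  simp only [(key _).2.2.2, Finset.sum_sub_distrib]
  linarith

/-- For fixed `z` the rate integrand is an exact time derivative. Fubini applies because it is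
continuous for positive times and supported in the compact set `[s, T] × tsupport η`; `s > 0` keeps
it away from the initial time, where only `L¹` convergence is known. -/
lemma integral_rate (sol : IsSolution H σ ν τ ρ) (hH : ContDiff ℝ 3 H)
    (hβ : IsC2OnNonneg β β' β'') (hη : Continuous η) (hηs : HasCompactSupport η)
    {s T : ℝ} (hs : 0 < s) (hsT : s ≤ T) :
    IntegrableOn (rate β' H σ ν ρ η) (Set.Ioc s T) ∧
    ∫ t in Set.Ioc s T, rate β' H σ ν ρ η t =
      locEntropy β H σ ν η (ρ T) - locEntropy β H σ ν η (ρ s) := by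
  set F : ℝ → Pos n × ℝ → ℝ := fun t z =>
    η z * β' (relDensity H σ ν (ρ t) z) * deriv (fun s => ρ s z.1 z.2) t with hF
  have hUc : Continuous (effPot H σ) := (contDiff_effPot hH).continuous
  have hfc : ContinuousOn (fun w : ℝ × Pos n × ℝ => relDensity H σ ν (ρ w.1) w.2)
      {w | 0 < w.1} := by
    refine sol.regular.continuousOn.mul (Continuous.continuousOn ?_)
    fun_prop
  have hβ'c : ContinuousOn β' (Set.Ici 0) := fun r hr =>
    (hβ.deriv_two r hr).continuousAt.continuousWithinAt
  have hβc : ContinuousOn β (Set.Ici 0) := fun r hr =>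
    (hβ.deriv_one r hr).continuousAt.continuousWithinAt
  have hFc : ContinuousOn (Function.uncurry F) {w | 0 < w.1} :=
    ((hη.comp continuous_snd).continuousOn.mul
      (hβ'c.comp hfc fun w hw => sol.relDensity_nonneg (le_of_lt hw) w.2)).mul
      sol.continuousOn_deriv_time
  have hFint : Integrable (Function.uncurry F) ((volume.restrict (Set.Ioc s T)).prod volume) := by
    have h1 : IntegrableOn (Function.uncurry F) (Set.Icc s T ×ˢ tsupport η)
        (volume.prod volume) :=
      (hFc.mono fun w hw => hs.trans_le hw.1.1).integrableOn_compact
        (isCompact_Icc.prod hηs.isCompact)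
    have h2 : IntegrableOn (Function.uncurry F) (Set.Ioc s T ×ˢ Set.univ)
        (volume.prod volume) := by
      refine h1.of_forall_sdiff_eq_zero (measurableSet_Ioc.prod MeasurableSet.univ) fun w hw => ?_
      have : w.2 ∉ tsupport η := fun hmem =>
        hw.2 ⟨⟨hw.1.1.1.le, hw.1.1.2⟩, hmem⟩
      simp [Function.uncurry, hF, image_eq_zero_of_notMem_tsupport this]
    rwa [IntegrableOn, ← Measure.prod_restrict, Measure.restrict_univ] at h2
  refine ⟨hFint.integral_prod_left, ?_⟩
  have hslice : ∀ t, 0 < t → Integrable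
      fun z => η z * (β (relDensity H σ ν (ρ t) z) * gibbs H σ ν z) := by
    intro t ht
    have hfC : Continuous (relDensity H σ ν (ρ t)) :=
      (contDiff_relDensity hH (sol.contDiff_slice ht)).continuous
    have : Continuous fun z => β (relDensity H σ ν (ρ t) z) :=
      hβc.comp_continuous hfC fun z => sol.relDensity_nonneg ht.le z
    exact (hη.mul (this.mul (contDiff_gibbs hH).continuous)).integrable_of_hasCompactSupport
      hηs.mul_right
  calc ∫ t in Set.Ioc s T, rate β' H σ ν ρ η t
      = ∫ z, ∫ t in Set.Ioc s T, F t z := integral_integral_swap hFint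
    _ = ∫ z, (η z * (β (relDensity H σ ν (ρ T) z) * gibbs H σ ν z) -
          η z * (β (relDensity H σ ν (ρ s) z) * gibbs H σ ν z)) := by
        refine integral_congr_ae (Eventually.of_forall fun z => ?_)
        show ∫ t in Set.Ioc s T, F t z = _
        rw [← intervalIntegral.integral_of_le hsT]
        refine intervalIntegral.integral_eq_sub_of_hasDerivAt
          (f := fun t => η z * (β (relDensity H σ ν (ρ t) z) * gibbs H σ ν z)) (fun t ht => ?_) ?_
        · rw [Set.uIcc_of_le hsT] at ht
          have ht0 : 0 < t := hs.trans_le ht.1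
          have h1 : HasDerivAt (fun t => relDensity H σ ν (ρ t) z) _ t :=
            (sol.hasDerivAt_time ht0 z).mul_const (Real.exp (effPot H σ z.2 / ν ^ 2))
          have h2 := (hβ.deriv_one _ (sol.relDensity_nonneg ht0.le z)).comp t h1
          refine ((h2.mul_const (gibbs H σ ν z)).const_mul (η z)).congr_deriv ?_
          have hc : Real.exp (effPot H σ z.2 / ν ^ 2) * gibbs H σ ν z = 1 := by
            rw [gibbs, ← Real.exp_add, neg_div, add_neg_cancel, Real.exp_zero]
          simp only [hF, (sol.hasDerivAt_time ht0 z).deriv]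
          linear_combination (η z * β' (relDensity H σ ν (ρ t) z) *
            (fderiv ℝ (fun w : ℝ × Pos n × ℝ => ρ w.1 w.2.1 w.2.2) (t, z) (1, 0))) * hc
        · refine ContinuousOn.intervalIntegrable ?_
          rw [Set.uIcc_of_le hsT]
          exact hFc.comp (f := fun t : ℝ => (t, z)) (by fun_prop) fun t ht => hs.trans_le ht.1
    _ = _ := integral_sub (hslice T (hs.trans_le hsT)) (hslice s hs)

/-- For `β` of slope at most `Λ`, `|β(f_s) - β(f_0)| μ ≤ Λ |ρ_s - ρ_0|`, so `L¹` convergence of the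
densities suffices. The function `r log r` has no such bound, whence the approximations used below.
-/
lemma tendsto_locEntropy (sol : IsSolution H σ ν τ ρ) (hH : ContDiff ℝ 3 H)
    (hβm : Measurable β) (hβ0 : β 0 = 0) {Λ : ℝ}
    (hΛ : ∀ r r', 0 ≤ r → 0 ≤ r' → |β r - β r'| ≤ Λ * |r - r'|)
    (hη : Continuous η) (hηs : HasCompactSupport η) :
    (∀ t, 0 ≤ t → Integrable fun z => η z * (β (relDensity H σ ν (ρ t) z) * gibbs H σ ν z)) ∧
    Tendsto (fun s => locEntropy β H σ ν η (ρ s)) (𝓝[>] 0)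
      (𝓝 (locEntropy β H σ ν η (ρ 0))) := by
  obtain ⟨M, hM⟩ := hη.bounded_above_of_compact_support hηs
  have hΛ0 : 0 ≤ Λ := by
    have := hΛ 1 0 zero_le_one le_rfl
    simp only [sub_zero, abs_one, mul_one] at this
    exact (abs_nonneg _).trans this
  have hM0 : 0 ≤ M := (norm_nonneg _).trans (hM 0)
  have hUc : Continuous (effPot H σ) := (contDiff_effPot hH).continuous
  have hgc : Continuous (gibbs (n := n) H σ ν) := (contDiff_gibbs hH).continuous
  set G : ℝ → Pos n × ℝ → ℝ := fun t z =>
    η z * (β (relDensity H σ ν (ρ t) z) * gibbs H σ ν z) with hG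
  have hdiff : ∀ s t, 0 ≤ s → 0 ≤ t → ∀ z, |G s z - G t z| ≤
      M * Λ * |ρ s z.1 z.2 - ρ t z.1 z.2| := by
    intro s t hs ht z
    have e1 : |ρ s z.1 z.2 - ρ t z.1 z.2| =
        |relDensity H σ ν (ρ s) z - relDensity H σ ν (ρ t) z| * gibbs H σ ν z := by
      rw [← gibbs_mul_relDensity (H := H) (σ := σ) (ν := ν) (ρ s) z,
        ← gibbs_mul_relDensity (H := H) (σ := σ) (ν := ν) (ρ t) z, ← sub_mul, abs_mul,
        abs_of_pos (gibbs_pos z)]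
    have e2 : |G s z - G t z| = |η z| *
        (|β (relDensity H σ ν (ρ s) z) - β (relDensity H σ ν (ρ t) z)| * gibbs H σ ν z) := by
      simp only [hG]
      rw [← mul_sub, ← sub_mul, abs_mul, abs_mul, abs_of_pos (gibbs_pos _)]
    rw [e1, e2]
    have := hΛ _ _ (sol.relDensity_nonneg hs z) (sol.relDensity_nonneg ht z)
    have hg := (gibbs_pos (H := H) (σ := σ) (ν := ν) z).le
    calc _ ≤ M * ((Λ * |relDensity H σ ν (ρ s) z - relDensity H σ ν (ρ t) z|)
          * gibbs H σ ν z) := by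
          gcongr
          exact hM z
      _ = _ := by ring
  have hmeas : ∀ t, 0 ≤ t → AEStronglyMeasurable (G t) volume := by
    intro t ht
    have h1 : AEMeasurable (relDensity H σ ν (ρ t)) volume :=
      (sol.unit_mass t ht).1.aemeasurable.mul (by fun_prop)
    exact (hη.measurable.aemeasurable.mul ((hβm.comp_aemeasurable h1).mul
      hgc.measurable.aemeasurable)).aestronglyMeasurable
  have hint : ∀ t, 0 ≤ t → Integrable (G t) := by
    intro t ht
    refine ((sol.unit_mass t ht).1.const_mul (M * Λ)).mono' (hmeas t ht)
      (Eventually.of_forall fun z => ?_)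
    have h1 := hΛ _ 0 (sol.relDensity_nonneg ht z) le_rfl
    rw [hβ0, sub_zero, sub_zero, abs_of_nonneg (sol.relDensity_nonneg ht z)] at h1
    have hg := (gibbs_pos (H := H) (σ := σ) (ν := ν) z).le
    simp only [hG, Real.norm_eq_abs, abs_mul, abs_of_pos (gibbs_pos _)]
    calc _ ≤ M * ((Λ * relDensity H σ ν (ρ t) z) * gibbs H σ ν z) := by
          gcongr
          exact hM z
      _ = M * Λ * (relDensity H σ ν (ρ t) z * gibbs H σ ν z) := by ring
      _ = _ := by rw [gibbs_mul_relDensity]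
  refine ⟨hint, tendsto_integral_of_L1 (G 0) (hmeas 0 le_rfl) ?_ ?_⟩
  · filter_upwards [self_mem_nhdsWithin] with s hs using hint s (le_of_lt hs)
  · have h0 : Tendsto (fun t => ENNReal.ofReal (M * Λ) *
        eLpNorm (fun z : Pos n × ℝ => ρ t z.1 z.2 - ρ 0 z.1 z.2) 1 volume) (𝓝[>] 0) (𝓝 0) := by
      have := ENNReal.Tendsto.const_mul (a := ENNReal.ofReal (M * Λ)) sol.initial
        (Or.inr ENNReal.ofReal_ne_top)
      simpa using this
    refine tendsto_of_tendsto_of_tendsto_of_le_of_le' tendsto_const_nhds h0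
      (Eventually.of_forall fun _ => zero_le) ?_
    filter_upwards [self_mem_nhdsWithin] with s hs
    rw [eLpNorm_one_eq_lintegral_enorm, ← lintegral_const_mul' _ _ ENNReal.ofReal_ne_top]
    refine lintegral_mono fun z => ?_
    show ‖G s z - G 0 z‖ₑ ≤ _
    rw [Real.enorm_eq_ofReal_abs, Real.enorm_eq_ofReal_abs, ← ENNReal.ofReal_mul (by positivity)]
    exact ENNReal.ofReal_le_ofReal (hdiff s 0 (le_of_lt hs) le_rfl z)

/-- The localized entropy inequality, up to the initial time. -/
lemma locEntropy_le (sol : IsSolution H σ ν τ ρ) (hH : ContDiff ℝ 3 H) (hν : ν ≠ 0)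
    (hτ : 0 < τ) (hβ : IsC2OnNonneg β β' β'') (hβm : Measurable β) (hβ0 : β 0 = 0) {Λ : ℝ}
    (hΛ : ∀ r r', 0 ≤ r → 0 ≤ r' → |β r - β r'| ≤ Λ * |r - r'|)
    (hη : ContDiff ℝ 2 η) (hηs : HasCompactSupport η)
    (hsign : ∀ z r, 0 ≤ r → 0 ≤ η z * β'' r) {B : ℝ}
    (hB : ∀ z r, 0 ≤ r → β r * gen H σ ν τ η z ≤ B * (r * gibbs H σ ν z)) {T : ℝ} (hT : 0 < T) :
    locEntropy β H σ ν η (ρ T) ≤ locEntropy β H σ ν η (ρ 0) + B * T ∧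
    ∫⁻ t in Set.Ioc 0 T, ∫⁻ z, ENNReal.ofReal (locDiss β'' H σ ν τ η (ρ t) z) ≤
      ENNReal.ofReal (locEntropy β H σ ν η (ρ 0) - locEntropy β H σ ν η (ρ T) + B * T) := by
  have hlim := (sol.tendsto_locEntropy hH hβm hβ0 hΛ hη.continuous hηs).2
  set D : ℝ → ℝ≥0∞ := fun t => ∫⁻ z, ENNReal.ofReal (locDiss β'' H σ ν τ η (ρ t) z) with hD
  have hstep : ∀ s, 0 < s → s ≤ T →
      0 ≤ locEntropy β H σ ν η (ρ s) - locEntropy β H σ ν η (ρ T) + B * (T - s) ∧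
      ∫⁻ t in Set.Ioc s T, D t ≤
        ENNReal.ofReal (locEntropy β H σ ν η (ρ s) - locEntropy β H σ ν η (ρ T) + B * (T - s)) := by
    intro s hs hsT
    obtain ⟨hi, he⟩ := sol.integral_rate hH hβ hη.continuous hηs hs hsT
    have hc : IntegrableOn (fun _ : ℝ => B) (Set.Ioc s T) :=
      integrableOn_const (by simp) (by simp)
    have hi2 : IntegrableOn (fun t => B - rate β' H σ ν ρ η t) (Set.Ioc s T) := hc.sub hi
    have hval : ∫ t in Set.Ioc s T, (B - rate β' H σ ν ρ η t) =
        locEntropy β H σ ν η (ρ s) - locEntropy β H σ ν η (ρ T) + B * (T - s) := by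
      rw [integral_sub hc.integrable hi.integrable, he, setIntegral_const]
      simp [hsT]
      ring
    have hpt : ∀ t ∈ Set.Ioc s T, 0 ≤ B - rate β' H σ ν ρ η t ∧
        D t ≤ ENNReal.ofReal (B - rate β' H σ ν ρ η t) := by
      intro t ht
      obtain ⟨h1, h2, h3⟩ := sol.rate_add_diss_le hH hν hτ hβ hη hηs hsign hB (hs.trans ht.1)
      have h4 := integral_nonneg (μ := volume) (f := locDiss β'' H σ ν τ η (ρ t)) h2
      refine ⟨by linarith, ?_⟩
      rw [hD]
      simp only
      rw [← ofReal_integral_eq_lintegral_ofReal h1 (Eventually.of_forall h2)]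
      exact ENNReal.ofReal_le_ofReal (by linarith)
    have hae : ∀ᵐ t ∂(volume.restrict (Set.Ioc s T)), 0 ≤ B - rate β' H σ ν ρ η t :=
      (ae_restrict_mem measurableSet_Ioc).mono fun t ht => (hpt t ht).1
    constructor
    · rw [← hval]
      exact integral_nonneg_of_ae hae
    · rw [← hval, ofReal_integral_eq_lintegral_ofReal hi2 hae]
      exact setLIntegral_mono_ae' measurableSet_Ioc (Eventually.of_forall fun t ht => (hpt t ht).2)
  -- Starting times decreasing to `0`: the right-hand sides converge by `L¹` continuity, the
  -- dissipation integrals over the growing intervals by monotone convergence.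
  set s : ℕ → ℝ := fun k => T / (k + 1) with hsdef
  have hs0 : ∀ k, 0 < s k := fun k => by simp only [hsdef]; positivity
  have hsT : ∀ k, s k ≤ T := fun k => div_le_self hT.le (by
    have := k.cast_nonneg (α := ℝ); linarith)
  have hsanti : Antitone s := fun j k hjk => by
    simp only [hsdef]
    have : (j : ℝ) ≤ k := Nat.cast_le.2 hjk
    gcongr
  have hslim0 : Tendsto s atTop (𝓝 0) := by
    have := (tendsto_one_div_add_atTop_nhds_zero_nat (𝕜 := ℝ)).const_mul T
    simpa [hsdef, div_eq_mul_inv] using this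
  have hslim : Tendsto s atTop (𝓝[>] 0) :=
    tendsto_nhdsWithin_iff.2 ⟨hslim0, Eventually.of_forall hs0⟩
  have hR : Tendsto (fun k => locEntropy β H σ ν η (ρ (s k)) - locEntropy β H σ ν η (ρ T)
      + B * (T - s k)) atTop
      (𝓝 (locEntropy β H σ ν η (ρ 0) - locEntropy β H σ ν η (ρ T) + B * T)) := by
    have h1 := (hlim.comp hslim).sub_const (locEntropy β H σ ν η (ρ T))
    have h2 := (hslim0.const_sub T).const_mul B
    rw [sub_zero] at h2
    exact h1.add h2
  constructor
  · have := ge_of_tendsto' hR fun k => (hstep (s k) (hs0 k) (hsT k)).1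
    linarith
  · have hU : ⋃ k, Set.Ioc (s k) T = Set.Ioc 0 T := by
      ext t
      simp only [Set.mem_iUnion, Set.mem_Ioc]
      constructor
      · rintro ⟨k, h1, h2⟩
        exact ⟨(hs0 k).trans h1, h2⟩
      · rintro ⟨h1, h2⟩
        obtain ⟨k, hk⟩ := (hslim0.eventually_lt_const h1).exists
        exact ⟨k, hk, h2⟩
    have hmono : Monotone fun k => Set.Ioc (s k) T := fun j k hjk =>
      Set.Ioc_subset_Ioc_left (hsanti hjk)
    rw [← hU, setLIntegral_iUnion_of_directed _ hmono.directed_le]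
    have hmonoI : Monotone fun k => ∫⁻ t in Set.Ioc (s k) T, D t := fun j k hjk =>
      lintegral_mono_set (hmono hjk)
    exact le_of_tendsto_of_tendsto' (tendsto_atTop_iSup hmonoI)
      (ENNReal.tendsto_ofReal hR) fun k => (hstep (s k) (hs0 k) (hsT k)).2

end IsSolution

/-! ### Cutoffs and the moment bound -/

/-- A smooth cutoff: `1` for `s ≤ R` and `0` for `s ≥ 2R`. -/
def cutoff (R s : ℝ) : ℝ := Real.smoothTransition (2 - s / R)

/-- The first derivative of `cutoff`. -/
def cutoffDeriv (R s : ℝ) : ℝ := -(deriv Real.smoothTransition (2 - s / R) / R)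

/-- The second derivative of `cutoff`. -/
def cutoffDeriv2 (R s : ℝ) : ℝ := deriv (deriv Real.smoothTransition) (2 - s / R) / R ^ 2

/-- A concave truncation: the primitive of `cutoff` vanishing at `2R`. -/
def truncation (R s : ℝ) : ℝ := ∫ r in (2 * R)..s, cutoff R r

section Cutoff

variable {R s : ℝ}

lemma cutoff_nonneg (R s : ℝ) : 0 ≤ cutoff R s := Real.smoothTransition.nonneg _

lemma cutoff_le_one (R s : ℝ) : cutoff R s ≤ 1 := Real.smoothTransition.le_one _

lemma cutoff_eq_one (hR : 0 < R) (hs : s ≤ R) : cutoff R s = 1 :=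
  Real.smoothTransition.one_of_one_le (by
    have := (div_le_one hR).2 hs; linarith)

lemma cutoff_eq_zero (hR : 0 < R) (hs : 2 * R ≤ s) : cutoff R s = 0 :=
  Real.smoothTransition.zero_of_nonpos (by
    have := (le_div_iff₀ hR).2 hs; linarith)

lemma contDiff_cutoff : ContDiff ℝ 2 (cutoff R) :=
  Real.smoothTransition.contDiff.comp (by fun_prop)

lemma hasDerivAt_cutoff (R s : ℝ) : HasDerivAt (cutoff R) (cutoffDeriv R s) s := by
  have h1 : HasDerivAt Real.smoothTransition (deriv Real.smoothTransition (2 - s / R))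
      (2 - s / R) :=
    ((Real.smoothTransition.contDiff (n := 1)).differentiable (by norm_num) _).hasDerivAt
  have h2 := HasDerivAt.comp s (h := fun s => 2 - s / R) h1
    (((hasDerivAt_id s).div_const R).const_sub 2)
  exact h2.congr_deriv (by rw [cutoffDeriv]; ring)

lemma hasDerivAt_cutoffDeriv (R s : ℝ) : HasDerivAt (cutoffDeriv R) (cutoffDeriv2 R s) s := by
  have hC : ContDiff ℝ 1 (deriv Real.smoothTransition) :=
    ((contDiff_succ_iff_deriv (n := 1)).1 (Real.smoothTransition.contDiff (n := 2))).2.2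
  have h1 := (hC.differentiable (by norm_num) (2 - s / R)).hasDerivAt
  have h2 := ((HasDerivAt.comp s (h := fun s => 2 - s / R) h1
    (((hasDerivAt_id s).div_const R).const_sub 2)).div_const R).neg
  exact h2.congr_deriv (by rw [cutoffDeriv2]; ring)

lemma cutoffDeriv_nonpos (hR : 0 < R) : cutoffDeriv R s ≤ 0 :=
  neg_nonpos.2 (div_nonneg Real.smoothTransition.monotone.deriv_nonneg hR.le)

lemma cutoff_derivs_eq_zero (hR : 0 < R) (hs : 2 * R < s) :
    cutoffDeriv R s = 0 ∧ cutoffDeriv2 R s = 0 := by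
  have hev : Real.smoothTransition =ᶠ[𝓝 (2 - s / R)] fun _ => 0 := by
    have : 2 - s / R < 0 := by
      have := (lt_div_iff₀ hR).2 hs; linarith
    filter_upwards [eventually_lt_nhds this] with x hx
    exact Real.smoothTransition.zero_of_nonpos hx.le
  rw [cutoffDeriv, cutoffDeriv2, hev.deriv_eq, hev.deriv.deriv_eq]
  simp

lemma exists_cutoff_derivs_bound : ∃ C : ℝ, 0 ≤ C ∧ ∀ R, 0 < R → ∀ s, 0 ≤ s →
    |cutoffDeriv R s| ≤ C / R ∧ |cutoffDeriv2 R s| ≤ C / R ^ 2 := by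
  have hC : ContDiff ℝ 1 (deriv Real.smoothTransition) :=
    ((contDiff_succ_iff_deriv (n := 1)).1 (Real.smoothTransition.contDiff (n := 2))).2.2
  obtain ⟨C₁, h₁⟩ := (isCompact_Icc (a := (0 : ℝ)) (b := 2)).exists_bound_of_continuousOn
    hC.continuous.continuousOn
  obtain ⟨C₂, h₂⟩ := (isCompact_Icc (a := (0 : ℝ)) (b := 2)).exists_bound_of_continuousOn
    (hC.continuous_deriv (by norm_num)).continuousOn
  have hC0 : 0 ≤ max C₁ C₂ :=
    ((norm_nonneg _).trans (h₁ 0 ⟨le_rfl, by norm_num⟩)).trans (le_max_left _ _)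
  refine ⟨max C₁ C₂, hC0, fun R hR s hs => ?_⟩
  rcases lt_or_ge (2 * R) s with h | h
  · rw [(cutoff_derivs_eq_zero hR h).1, (cutoff_derivs_eq_zero hR h).2, abs_zero]
    constructor <;> positivity
  · have hmem : 2 - s / R ∈ Set.Icc (0 : ℝ) 2 := by
      have h1 := (div_le_iff₀ hR).2 h
      have h2 : 0 ≤ s / R := by positivity
      constructor <;> linarith
    rw [cutoffDeriv, cutoffDeriv2, abs_neg, abs_div, abs_div, abs_of_pos hR,
      abs_of_pos (by positivity : 0 < R ^ 2)]
    constructor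
    · gcongr
      exact (h₁ _ hmem).trans (le_max_left _ _)
    · gcongr
      exact (h₂ _ hmem).trans (le_max_right _ _)

lemma hasDerivAt_truncation (R s : ℝ) : HasDerivAt (truncation R) (cutoff R s) s :=
  intervalIntegral.integral_hasDerivAt_right (contDiff_cutoff.continuous.intervalIntegrable _ _)
    contDiff_cutoff.continuous.aestronglyMeasurable.stronglyMeasurableAtFilter
    contDiff_cutoff.continuous.continuousAt

lemma contDiff_truncation : ContDiff ℝ 2 (truncation R) := by
  rw [show (2 : WithTop ℕ∞) = 1 + 1 by norm_num, contDiff_succ_iff_deriv]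
  refine ⟨fun s => (hasDerivAt_truncation R s).differentiableAt, by simp, ?_⟩
  rw [funext fun s => (hasDerivAt_truncation R s).deriv]
  exact contDiff_cutoff.of_le (by norm_num)

lemma truncation_eq_zero (hR : 0 < R) (hs : 2 * R ≤ s) : truncation R s = 0 := by
  rw [truncation, intervalIntegral.integral_congr (g := fun _ => (0 : ℝ))]
  · simp
  · intro x hx
    rw [Set.uIcc_of_le hs] at hx
    exact cutoff_eq_zero hR hx.1

/-- `truncation` vanishes for large arguments, which gives compact support. Subtracting its value at
`0` gives a nonnegative truncation of the identity, and mass conservation makes this constant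
harmless. -/
lemma truncation_sub_zero_eq (R s : ℝ) :
    truncation R s - truncation R 0 = ∫ r in (0 : ℝ)..s, cutoff R r :=
  intervalIntegral.integral_interval_sub_left
    (contDiff_cutoff.continuous.intervalIntegrable _ _)
    (contDiff_cutoff.continuous.intervalIntegrable _ _)

lemma truncation_sub_zero_of_le (hR : 0 < R) (hs : 0 ≤ s) (hsR : s ≤ R) :
    truncation R s - truncation R 0 = s := by
  rw [truncation_sub_zero_eq, intervalIntegral.integral_congr (g := fun _ => (1 : ℝ))]
  · simp
  · intro x hx
    rw [Set.uIcc_of_le hs] at hx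
    exact cutoff_eq_one hR (hx.2.trans hsR)

lemma truncation_sub_zero_mem (hs : 0 ≤ s) :
    0 ≤ truncation R s - truncation R 0 ∧ truncation R s - truncation R 0 ≤ s := by
  rw [truncation_sub_zero_eq]
  refine ⟨intervalIntegral.integral_nonneg hs fun x _ => cutoff_nonneg R x, ?_⟩
  calc ∫ r in (0 : ℝ)..s, cutoff R r ≤ ∫ _ in (0 : ℝ)..s, (1 : ℝ) :=
        intervalIntegral.integral_mono_on hs
          (contDiff_cutoff.continuous.intervalIntegrable _ _) (by simp)
          fun x _ => cutoff_le_one R x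
    _ = s := by simp

end Cutoff

lemma hasCompactSupport_of_coercive {n : ℕ} {g : ℝ → ℝ} {c A R : ℝ} (hc : 0 < c)
    (hg : ∀ p, 0 ≤ g p) (hgA : ∀ p, c * |p| - A ≤ g p) {θ : ℝ → ℝ} (hθ : ∀ s, R ≤ s → θ s = 0) :
    HasCompactSupport fun z : Pos n × ℝ => θ (‖z.1‖ ^ 2 + g z.2) := by
  refine HasCompactSupport.of_support_subset_isCompact
    ((isCompact_closedBall (0 : Pos n) (R + 1)).prod
      (isCompact_closedBall (0 : ℝ) ((R + A) / c))) fun z hz => ?_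
  have hlt : ‖z.1‖ ^ 2 + g z.2 < R := by
    by_contra! h
    exact hz (hθ _ h)
  have h1 := hg z.2
  have h2 := hgA z.2
  have h3 := sq_nonneg ‖z.1‖
  refine ⟨mem_closedBall_zero_iff.2 ?_, mem_closedBall_zero_iff.2 ?_⟩
  · nlinarith [sq_nonneg (‖z.1‖ - 1)]
  · rw [le_div_iff₀ hc, Real.norm_eq_abs]
    linarith

/-- Moments that are controlled by a Lyapunov function grow at most linearly in time. -/
lemma IsSolution.moment_le {n : ℕ} {H : ℝ → ℝ} {σ ν τ : ℝ} {ρ : ℝ → Pos n → ℝ → ℝ}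
    (sol : IsSolution H σ ν τ ρ) (hH : ContDiff ℝ 3 H) (hν : ν ≠ 0) (hτ : 0 < τ) {φ : ℝ → ℝ}
    (hφ : ContDiff ℝ 2 φ) (hφ0 : ∀ p, 0 ≤ φ p) {c A K : ℝ} (hc : 0 < c) (hK : 0 ≤ K)
    (hφA : ∀ p, c * |p| - A ≤ φ p)
    (hgen : ∀ p, ν ^ 2 * deriv (deriv φ) p - deriv (effPot H σ) p * deriv φ p ≤ K * τ)
    (hint : Integrable fun z : Pos n × ℝ => (‖z.1‖ ^ 2 + φ z.2) * ρ 0 z.1 z.2)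
    {T : ℝ} (hT : 0 < T) :
    Integrable (fun z : Pos n × ℝ => (‖z.1‖ ^ 2 + φ z.2) * ρ T z.1 z.2) ∧
    ∫ z : Pos n × ℝ, (‖z.1‖ ^ 2 + φ z.2) * ρ T z.1 z.2 ≤
      (∫ z : Pos n × ℝ, (‖z.1‖ ^ 2 + φ z.2) * ρ 0 z.1 z.2) + (2 * n + K) * T := by
  set Φ : Pos n × ℝ → ℝ := fun z => ‖z.1‖ ^ 2 + φ z.2 with hΦ
  have hΦC : ContDiff ℝ 2 Φ := (contDiff_fst.norm_sq ℝ).add (hφ.comp contDiff_snd)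
  have hΦ0 : ∀ z, 0 ≤ Φ z := fun z => add_nonneg (sq_nonneg _) (hφ0 _)
  have hβ : IsC2OnNonneg (fun r => r) (fun _ => 1) (fun _ => 0) :=
    ⟨fun r _ => hasDerivAt_id r, fun r _ => hasDerivAt_const r 1, continuousOn_const⟩
  have hm0 := sol.unit_mass 0 le_rfl
  have hmT := sol.unit_mass T hT.le
  have htr : ∀ R : ℝ, 0 < R →
      Integrable (fun z : Pos n × ℝ =>
        (truncation R (Φ z) - truncation R 0) * ρ T z.1 z.2) ∧
      ∫ z : Pos n × ℝ, (truncation R (Φ z) - truncation R 0) * ρ T z.1 z.2 ≤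
        (∫ z : Pos n × ℝ, Φ z * ρ 0 z.1 z.2) + (2 * n + K) * T := by
    intro R hR
    set η : Pos n × ℝ → ℝ := fun z => truncation R (Φ z) with hη
    have hηC : ContDiff ℝ 2 η := contDiff_truncation.comp hΦC
    have hηs : HasCompactSupport η :=
      hasCompactSupport_of_coercive hc hφ0 hφA fun s hs => truncation_eq_zero hR hs
    have hB : ∀ z r, 0 ≤ r → r * gen H σ ν τ η z ≤ (2 * n + K) * (r * gibbs H σ ν z) := by
      intro z r hr
      have h1 := gen_comp (ν := ν) (τ := τ) (σ := σ) hH (hasDerivAt_truncation R)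
        (hasDerivAt_cutoff R) hΦC z
      obtain ⟨h2, h3, h4⟩ := gen_norm_sq_add (τ := τ) (σ := σ) hH hν hφ z
      have h5 : gen H σ ν τ η z ≤ (2 * n + K) * gibbs H σ ν z := by
        rw [h1]
        have e1 : gen H σ ν τ Φ z ≤ (2 * n + K) * gibbs H σ ν z := by
          rw [h2, mul_comm]
          gcongr
          · exact (gibbs_pos z).le
          · rw [div_le_iff₀ hτ]; exact hgen _
        have e2 : cutoff R (Φ z) * gen H σ ν τ Φ z ≤ (2 * n + K) * gibbs H σ ν z := by
          have e3 : 0 ≤ (2 * n + K) * gibbs H σ ν z := by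
            have := gibbs_pos (H := H) (σ := σ) (ν := ν) z; positivity
          calc cutoff R (Φ z) * gen H σ ν τ Φ z
              ≤ cutoff R (Φ z) * ((2 * n + K) * gibbs H σ ν z) := by
                gcongr; exact cutoff_nonneg _ _
            _ ≤ 1 * ((2 * n + K) * gibbs H σ ν z) := by
                gcongr; exact cutoff_le_one _ _
            _ = _ := one_mul _
        -- Concavity of the truncation: the squared-gradient term can be dropped, so no bound
        -- uniform in `R` is needed for it.
        have e4 : cutoffDeriv R (Φ z) * (gibbs H σ ν z *
            (∑ i, fderiv ℝ Φ z (dirX i) ^ 2 + ν ^ 2 / τ * fderiv ℝ Φ z dirP ^ 2)) ≤ 0 := by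
          refine mul_nonpos_of_nonpos_of_nonneg (cutoffDeriv_nonpos hR)
            (mul_nonneg (gibbs_pos z).le (add_nonneg ?_ ?_))
          · exact Finset.sum_nonneg fun i _ => sq_nonneg _
          · positivity
        linarith
      calc r * gen H σ ν τ η z ≤ r * ((2 * n + K) * gibbs H σ ν z) := by gcongr
        _ = _ := by ring
    have hmain := (sol.locEntropy_le hH hν hτ hβ measurable_id rfl (Λ := 1)
      (fun r r' _ _ => by simp) hηC hηs (fun z r _ => by simp) hB hT).1
    simp only [locEntropy, gibbs_mul_relDensity] at hmain
    obtain ⟨M, hM⟩ := hηC.continuous.bounded_above_of_compact_support hηs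
    have hηi : ∀ t, 0 ≤ t → Integrable fun z : Pos n × ℝ => η z * ρ t z.1 z.2 := fun t ht =>
      (sol.unit_mass t ht).1.bdd_mul hηC.continuous.aestronglyMeasurable
        (Eventually.of_forall hM)
    have hsub : ∀ t, 0 ≤ t → Integrable (fun z : Pos n × ℝ =>
        (η z - truncation R 0) * ρ t z.1 z.2) ∧
        ∫ z : Pos n × ℝ, (η z - truncation R 0) * ρ t z.1 z.2 =
          (∫ z : Pos n × ℝ, η z * ρ t z.1 z.2) - truncation R 0 := by
      intro t ht
      have h1 := (sol.unit_mass t ht).1.const_mul (truncation R 0)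
      simp only [sub_mul]
      refine ⟨(hηi t ht).sub h1, ?_⟩
      rw [integral_sub (hηi t ht) h1, integral_const_mul, (sol.unit_mass t ht).2, mul_one]
    refine ⟨(hsub T hT.le).1, ?_⟩
    have h0 : ∫ z : Pos n × ℝ, (η z - truncation R 0) * ρ 0 z.1 z.2 ≤
        ∫ z : Pos n × ℝ, Φ z * ρ 0 z.1 z.2 :=
      integral_mono (hsub 0 le_rfl).1 hint fun z =>
        mul_le_mul_of_nonneg_right (truncation_sub_zero_mem (hΦ0 z)).2 (sol.nonneg 0 le_rfl _ _)
    have e0 := (hsub 0 le_rfl).2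
    have eT := (hsub T hT.le).2
    rw [eT]
    linarith
  have hmeasT : AEMeasurable (fun z : Pos n × ℝ => Φ z * ρ T z.1 z.2) :=
    hΦC.continuous.measurable.aemeasurable.mul hmT.1.aemeasurable
  have hnn : ∀ z : Pos n × ℝ, 0 ≤ Φ z * ρ T z.1 z.2 := fun z =>
    mul_nonneg (hΦ0 z) (sol.nonneg T hT.le _ _)
  set S := (∫ z : Pos n × ℝ, Φ z * ρ 0 z.1 z.2) + (2 * n + K) * T with hS
  have hS0 : 0 ≤ S := by
    have : 0 ≤ ∫ z : Pos n × ℝ, Φ z * ρ 0 z.1 z.2 :=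
      integral_nonneg fun z => mul_nonneg (hΦ0 z) (sol.nonneg 0 le_rfl _ _)
    positivity
  -- Fatou's lemma as the truncation level grows; at each `z` the truncated moment is eventually
  -- exact.
  have hlint : ∫⁻ z : Pos n × ℝ, ENNReal.ofReal (Φ z * ρ T z.1 z.2) ≤ ENNReal.ofReal S := by
    calc ∫⁻ z : Pos n × ℝ, ENNReal.ofReal (Φ z * ρ T z.1 z.2)
        ≤ ∫⁻ z : Pos n × ℝ, liminf (fun k : ℕ => ENNReal.ofReal
            ((truncation (k + 1) (Φ z) - truncation (k + 1) 0) * ρ T z.1 z.2)) atTop := by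
          refine lintegral_mono fun z => ?_
          refine le_of_eq (Tendsto.liminf_eq (tendsto_const_nhds.congr' ?_)).symm
          obtain ⟨N, hN⟩ := exists_nat_ge (Φ z)
          filter_upwards [eventually_ge_atTop N] with k hk
          rw [truncation_sub_zero_of_le (by positivity) (hΦ0 z)]
          have : (N : ℝ) ≤ k := Nat.cast_le.2 hk
          linarith
      _ ≤ liminf (fun k : ℕ => ∫⁻ z : Pos n × ℝ, ENNReal.ofReal
            ((truncation (k + 1) (Φ z) - truncation (k + 1) 0) * ρ T z.1 z.2)) atTop :=
          lintegral_liminf_le' fun k => (htr (k + 1) (by positivity)).1.aemeasurable.ennreal_ofReal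
      _ ≤ ENNReal.ofReal S := by
          refine liminf_le_of_frequently_le' (Frequently.of_forall fun k => ?_)
          obtain ⟨h1, h2⟩ := htr (k + 1) (by positivity)
          rw [← ofReal_integral_eq_lintegral_ofReal h1 (Eventually.of_forall fun z =>
            mul_nonneg (truncation_sub_zero_mem (hΦ0 z)).1 (sol.nonneg T hT.le _ _))]
          exact ENNReal.ofReal_le_ofReal h2
  have hInt : Integrable (fun z : Pos n × ℝ => Φ z * ρ T z.1 z.2) :=
    ⟨hmeasT.aestronglyMeasurable, by
      rw [hasFiniteIntegral_iff_ofReal (Eventually.of_forall hnn)]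
      exact hlint.trans_lt ENNReal.ofReal_lt_top⟩
  refine ⟨hInt, ?_⟩
  rw [← ofReal_integral_eq_lintegral_ofReal hInt (Eventually.of_forall hnn)] at hlint
  exact (ENNReal.ofReal_le_ofReal_iff hS0).1 hlint

/-! ### Approximations of the Boltzmann entropy with bounded slope -/

/-- A convex function with bounded slope that tends to `r log r` as `δ → 0` and `M → ∞`. -/
def entropyApprox (δ M r : ℝ) : ℝ :=
  (r + δ) * Real.log (r + δ) - δ * Real.log δ - (r + M) * (Real.log (r + M) - Real.log M) + r

section EntropyApprox

variable {δ M r y : ℝ}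

lemma isC2OnNonneg_entropyApprox (hδ : 0 < δ) (hM : 0 < M) :
    IsC2OnNonneg (entropyApprox δ M)
      (fun r => Real.log (r + δ) - Real.log (r + M) + (Real.log M + 1))
      (fun r => (r + δ)⁻¹ - (r + M)⁻¹) := by
  have hlog : ∀ a r : ℝ, 0 < a → 0 ≤ r → HasDerivAt (fun r => Real.log (r + a)) (r + a)⁻¹ r := by
    intro a r ha hr
    exact (((hasDerivAt_id r).add_const a).log (by simp only [id]; positivity)).congr_deriv
      (by simp)
  refine ⟨fun r hr => ?_, fun r hr => ?_, ?_⟩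
  · have h1 := (((hasDerivAt_id r).add_const δ).mul (hlog δ r hδ hr)).sub_const (δ * Real.log δ)
    have h2 := ((hasDerivAt_id r).add_const M).mul ((hlog M r hM hr).sub_const (Real.log M))
    refine ((h1.sub h2).add (hasDerivAt_id r)).congr_deriv ?_
    have e1 : r + δ ≠ 0 := by positivity
    have e2 : r + M ≠ 0 := by positivity
    simp only [id]
    field_simp
    ring
  · exact ((hlog δ r hδ hr).sub (hlog M r hM hr)).add_const _
  · refine ContinuousOn.sub ?_ ?_ <;>
    · refine ContinuousOn.inv₀ (by fun_prop) fun r hr => ?_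
      have : (0 : ℝ) ≤ r := hr
      positivity

lemma entropyApprox_zero : entropyApprox δ M 0 = 0 := by simp [entropyApprox]

lemma measurable_entropyApprox : Measurable (entropyApprox δ M) := by
  unfold entropyApprox; fun_prop

/-- The derivative is `log((r + δ)/(r + M))` plus a constant, and for `r ≥ 0` the quotient lies
between `δ/M` and `1`. -/
lemma exists_lipschitz_entropyApprox (hδ : 0 < δ) (hM : 0 < M) : ∃ Λ : ℝ, 0 ≤ Λ ∧
    ∀ r r', 0 ≤ r → 0 ≤ r' → |entropyApprox δ M r - entropyApprox δ M r'| ≤ Λ * |r - r'| := by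
  have hC2 := isC2OnNonneg_entropyApprox hδ hM
  set Λ := |Real.log δ - Real.log M| + |Real.log M + 1| with hΛ
  refine ⟨Λ, by positivity, fun r r' hr hr' => ?_⟩
  have hbound : ∀ x ∈ Set.Ici (0 : ℝ),
      ‖Real.log (x + δ) - Real.log (x + M) + (Real.log M + 1)‖ ≤ Λ := by
    intro x hx
    have hx0 : (0 : ℝ) ≤ x := hx
    refine (norm_add_le _ _).trans (add_le_add ?_ le_rfl)
    rw [Real.norm_eq_abs, ← Real.log_div (by positivity) (by positivity),
      ← Real.log_div hδ.ne' hM.ne']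
    rcases le_total δ M with h | h
    · have h1 : δ / M ≤ (x + δ) / (x + M) := by
        rw [div_le_div_iff₀ hM (by positivity)]
        nlinarith
      have h2 : (x + δ) / (x + M) ≤ 1 := by
        rw [div_le_one (by positivity)]; linarith
      have h3 := Real.log_le_log (by positivity) h1
      have h4 := Real.log_nonpos (by positivity) h2
      rw [abs_of_nonpos h4, abs_of_nonpos (h3.trans h4)]
      linarith
    · have h1 : (x + δ) / (x + M) ≤ δ / M := by
        rw [div_le_div_iff₀ (by positivity) hM]
        nlinarith
      have h2 : 1 ≤ (x + δ) / (x + M) := by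
        rw [one_le_div (by positivity)]; linarith
      have h3 := Real.log_le_log (by positivity) h1
      have h4 := Real.log_nonneg h2
      rw [abs_of_nonneg h4, abs_of_nonneg (h4.trans h3)]
      exact h3
  exact (convex_Ici (0 : ℝ)).norm_image_sub_le_of_norm_hasDerivWithin_le
    (fun x hx => (hC2.deriv_one x hx).hasDerivWithinAt) hbound hr' hr

/-- The tangent-line inequality for the relative entropy of two numbers; all entropy bounds below
are sums of its instances. -/
lemma sub_le_mul_log_sub_log {a b : ℝ} (ha : 0 < a) (hb : 0 < b) :
    a - b ≤ a * (Real.log a - Real.log b) := by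
  rw [← Real.log_div ha.ne' hb.ne']
  have := mul_le_mul_of_nonneg_left (Real.one_sub_inv_le_log_of_pos (div_pos ha hb)) ha.le
  have e : a * (1 - (a / b)⁻¹) = a - b := by field_simp
  linarith

lemma entropyApprox_le (hδ : 0 < δ) (hδ1 : δ ≤ 1) (hM : 0 < M) (hr : 0 ≤ r) :
    entropyApprox δ M r ≤ max (r * Real.log r) 0 + 2 * r := by
  have h1 := sub_le_mul_log_sub_log (show 0 < r + M by positivity) hM
  have h2 := sub_le_mul_log_sub_log hδ (show 0 < r + δ by positivity)
  have h3 : r * Real.log (r + δ) ≤ max (r * Real.log r) 0 + r := by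
    rcases le_total r 1 with h | h
    · have e1 : Real.log (r + δ) ≤ r + δ - 1 := Real.log_le_sub_one_of_pos (by positivity)
      have e2 : r * Real.log (r + δ) ≤ r * 1 := by gcongr; linarith
      linarith [le_max_right (r * Real.log r) 0]
    · have e1 := sub_le_mul_log_sub_log (show 0 < r by linarith) (show 0 < r + δ by positivity)
      linarith [le_max_left (r * Real.log r) 0]
  rw [entropyApprox]
  linarith

/-- The Fenchel–Young inequality: `exp(y - 1)` is the convex conjugate of `r log r`. -/
lemma mul_sub_exp_le_mul_log (hr : 0 ≤ r) (y : ℝ) :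
    r * y - Real.exp (y - 1) ≤ r * Real.log r := by
  rcases hr.eq_or_lt with rfl | hr
  · simp [(Real.exp_pos _).le]
  · have := sub_le_mul_log_sub_log hr (Real.exp_pos (y - 1))
    rw [Real.log_exp] at this
    linarith

/-- The duality bound survives regularization at the cost of a factor `2`, uniformly in `δ` and in
all `M` above a threshold. With `e = exp(y - 1)`, the mass `r + M` is split into the fractions `e/M`
and `1 - e/M` and compared with `r` and `M` (log-sum inequality); the remaining `M log(1 - e/M)` is
at least `-2e` as `e ≤ M/2`. -/
lemma mul_sub_exp_le_entropyApprox (hδ : 0 < δ) (hM : 0 < M) (hr : 0 ≤ r)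
    (hy : Real.exp (y - 1) ≤ M / 2) :
    r * y - 2 * Real.exp (y - 1) ≤ entropyApprox δ M r := by
  set e := Real.exp (y - 1) with he
  have hepos : 0 < e := Real.exp_pos _
  have hlog : Real.log e = y - 1 := Real.log_exp _
  rcases hr.eq_or_lt with rfl | hr
  · rw [entropyApprox_zero]; linarith
  have h1 : r * Real.log r ≤ (r + δ) * Real.log (r + δ) - δ * Real.log δ := by
    have e1 := Real.log_le_log hr (show r ≤ r + δ by linarith)
    have e2 := Real.log_le_log hδ (show δ ≤ r + δ by linarith)
    have e3 := mul_le_mul_of_nonneg_left e1 hr.le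
    have e4 := mul_le_mul_of_nonneg_left e2 hδ.le
    linarith
  have hMe : 0 < M - e := by linarith
  have hp : 0 < r + M := by linarith
  have h2 := sub_le_mul_log_sub_log hr (show 0 < (r + M) * (e / M) by positivity)
  have h3 := sub_le_mul_log_sub_log hM (show 0 < (r + M) * ((M - e) / M) by positivity)
  have h4 := sub_le_mul_log_sub_log hMe hM
  rw [Real.log_mul hp.ne' (by positivity), Real.log_div hepos.ne' hM.ne', hlog] at h2
  rw [Real.log_mul hp.ne' (by positivity), Real.log_div hMe.ne' hM.ne'] at h3
  have h5 : M * (Real.log (M - e) - Real.log M) ≥ -(2 * e) := by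
    have h6 : -e / (M - e) ≤ Real.log (M - e) - Real.log M := by
      rw [div_le_iff₀ hMe]; linarith
    have h7 : M * (-e / (M - e)) ≤ M * (Real.log (M - e) - Real.log M) := by gcongr
    have h8 : -(2 * e) ≤ M * (-e / (M - e)) := by
      rw [mul_div_assoc', le_div_iff₀ hMe]
      nlinarith
    linarith
  have h9 : (r + M) * (e / M) + (r + M) * ((M - e) / M) = r + M := by
    field_simp; ring
  rw [entropyApprox]
  linarith

end EntropyApprox

/-- Cutoffs at large radius have a uniformly small generator. -/
lemma exists_gen_cutoff_le {n : ℕ} {H : ℝ → ℝ} {σ ν τ L : ℝ} (hH : IsPotential H L) (hν : ν ≠ 0)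
    (hτ : 0 < τ) : ∃ C : ℝ, 0 ≤ C ∧ ∀ N : ℝ, 1 ≤ N → ∀ z : Pos n × ℝ,
      |gen H σ ν τ (fun y : Pos n × ℝ => cutoff (N ^ 2) (‖y.1‖ ^ 2 + y.2 ^ 2)) z| ≤
        C / N * gibbs H σ ν z := by
  obtain ⟨B, hB0, hB⟩ := exists_abs_le_of_periodic hH.period_pos (deriv_periodic hH.periodic)
    (hH.smooth.continuous_deriv (by norm_num))
  obtain ⟨C, hC0, hC⟩ := exists_cutoff_derivs_bound
  set b := B + |σ| with hb
  have hb0 : 0 ≤ b := by positivity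
  have hU : ∀ p, |deriv (effPot H σ) p| ≤ b := fun p => by
    rw [deriv_effPot hH.smooth]
    exact (abs_sub _ _).trans (add_le_add (hB p) le_rfl)
  refine ⟨C * (2 * n + (2 * ν ^ 2 + 4 * b) / τ) + C * (8 * (1 + ν ^ 2 / τ)), by positivity,
    fun N hN z => ?_⟩
  have hN0 : 0 < N := by linarith
  have hN2 : 0 < N ^ 2 := by positivity
  have hg : ContDiff ℝ 2 fun p : ℝ => p ^ 2 := by fun_prop
  have hΨ : ContDiff ℝ 2 fun y : Pos n × ℝ => ‖y.1‖ ^ 2 + y.2 ^ 2 :=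
    (contDiff_fst.norm_sq ℝ).add (hg.comp contDiff_snd)
  have h1 := gen_comp (ν := ν) (τ := τ) (σ := σ) hH.smooth (hasDerivAt_cutoff (N ^ 2))
    (hasDerivAt_cutoffDeriv (N ^ 2)) hΨ z
  obtain ⟨h2, h3, h4⟩ := gen_norm_sq_add (τ := τ) (σ := σ) hH.smooth hν hg z
  have e1 : deriv (fun p : ℝ => p ^ 2) = fun p => 2 * p := by ext p; simp
  have e2 : deriv (fun p : ℝ => 2 * p) z.2 = 2 := by
    simp
  rw [e1, e2] at h2
  rw [e1] at h4
  simp only [] at h2 h4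
  set s := ‖z.1‖ ^ 2 + z.2 ^ 2 with hs
  have hs0 : 0 ≤ s := by positivity
  have hμ := gibbs_pos (H := H) (σ := σ) (ν := ν) z
  rw [h1, h2, h3, h4]
  rcases lt_or_ge (2 * N ^ 2) s with h | h
  · rw [(cutoff_derivs_eq_zero hN2 h).1, (cutoff_derivs_eq_zero hN2 h).2]
    simp only [zero_mul, add_zero, abs_zero]
    positivity
  · obtain ⟨hc1, hc2⟩ := hC (N ^ 2) hN2 s hs0
    have hp : |z.2| ≤ 2 * N := by
      refine abs_le_of_sq_le_sq ?_ (by positivity)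
      nlinarith [sq_nonneg ‖z.1‖]
    have hx : ‖z.1‖ ^ 2 ≤ 2 * N ^ 2 := by nlinarith [sq_nonneg z.2]
    have hp2 : z.2 ^ 2 ≤ 2 * N ^ 2 := by nlinarith [sq_nonneg ‖z.1‖]
    -- First-order terms are `O(N)` on the support and meet a factor `1/N²`; the squared gradient is
    -- `O(N²)` and meets `1/N⁴`. The dependence of the constant on `ν` and `τ` is harmless, since
    -- `N` is sent to infinity with both fixed.
    have d1 : |2 * (n : ℝ) + (ν ^ 2 * 2 - deriv (effPot H σ) z.2 * (2 * z.2)) / τ| ≤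
        (2 * n + (2 * ν ^ 2 + 4 * b) / τ) * N := by
      have f1 : |ν ^ 2 * 2 - deriv (effPot H σ) z.2 * (2 * z.2)| ≤ (2 * ν ^ 2 + 4 * b) * N := by
        calc _ ≤ |ν ^ 2 * 2| + |deriv (effPot H σ) z.2 * (2 * z.2)| := abs_sub _ _
          _ = 2 * ν ^ 2 + |deriv (effPot H σ) z.2| * (2 * |z.2|) := by
              rw [abs_of_nonneg (by positivity), abs_mul, abs_mul, abs_two]; ring
          _ ≤ 2 * ν ^ 2 * N + b * (2 * (2 * N)) := by
              refine add_le_add (le_mul_of_one_le_right (by positivity) hN) ?_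
              gcongr
              exact hU _
          _ = _ := by ring
      calc _ ≤ |2 * (n : ℝ)| + |(ν ^ 2 * 2 - deriv (effPot H σ) z.2 * (2 * z.2)) / τ| :=
            abs_add_le _ _
        _ ≤ 2 * n * N + (2 * ν ^ 2 + 4 * b) * N / τ := by
            rw [abs_of_nonneg (by positivity), abs_div, abs_of_pos hτ]
            refine add_le_add (le_mul_of_one_le_right (by positivity) hN) ?_
            gcongr
        _ = _ := by ring
    have d2 : |4 * ‖z.1‖ ^ 2 + ν ^ 2 / τ * (2 * z.2) ^ 2| ≤ 8 * (1 + ν ^ 2 / τ) * N ^ 2 := by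
      rw [abs_of_nonneg (by positivity)]
      have : ν ^ 2 / τ * (2 * z.2) ^ 2 ≤ ν ^ 2 / τ * (8 * N ^ 2) := by
        gcongr; nlinarith
      nlinarith
    calc _ ≤ |cutoffDeriv (N ^ 2) s| * (gibbs H σ ν z *
            |2 * (n : ℝ) + (ν ^ 2 * 2 - deriv (effPot H σ) z.2 * (2 * z.2)) / τ|) +
          |cutoffDeriv2 (N ^ 2) s| * (gibbs H σ ν z *
            |4 * ‖z.1‖ ^ 2 + ν ^ 2 / τ * (2 * z.2) ^ 2|) := by
          refine (abs_add_le _ _).trans (le_of_eq ?_)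
          rw [abs_mul, abs_mul, abs_mul, abs_mul, abs_of_pos hμ]
      _ ≤ C / N ^ 2 * (gibbs H σ ν z * ((2 * n + (2 * ν ^ 2 + 4 * b) / τ) * N)) +
          C / (N ^ 2) ^ 2 * (gibbs H σ ν z * (8 * (1 + ν ^ 2 / τ) * N ^ 2)) := by gcongr
      _ = (C * (2 * n + (2 * ν ^ 2 + 4 * b) / τ) / N + C * (8 * (1 + ν ^ 2 / τ)) / N ^ 2) *
          gibbs H σ ν z := by
          have f1 : N / N ^ 2 = 1 / N := by field_simp
          have f2 : N ^ 2 / (N ^ 2) ^ 2 = 1 / N ^ 2 := by field_simp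
          linear_combination
            (C * gibbs H σ ν z * (2 * n + (2 * ν ^ 2 + 4 * b) / τ)) * f1 +
            (C * gibbs H σ ν z * (8 * (1 + ν ^ 2 / τ))) * f2
      _ ≤ (C * (2 * n + (2 * ν ^ 2 + 4 * b) / τ) / N + C * (8 * (1 + ν ^ 2 / τ)) / N) *
          gibbs H σ ν z := by
          refine mul_le_mul_of_nonneg_right (add_le_add le_rfl ?_) hμ.le
          exact div_le_div_of_nonneg_left (by positivity) hN0 (le_self_pow₀ hN two_ne_zero)
      _ = _ := by ring

/-! ### Bounds for the relative entropy by moments -/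

section EntropyBounds

variable {n : ℕ} {H : ℝ → ℝ} {σ ν τ : ℝ}

/-- The weight `|p| + |x|²`. -/
def weight (z : Pos n × ℝ) : ℝ := |z.2| + ‖z.1‖ ^ 2

lemma weight_nonneg (z : Pos n × ℝ) : 0 ≤ weight z := by unfold weight; positivity

lemma continuous_weight : Continuous (weight (n := n)) := by unfold weight; fun_prop

lemma integrable_exp_neg_abs : Integrable fun p : ℝ => Real.exp (-|p|) := by
  rw [← integrableOn_univ, ← Set.Iic_union_Ioi (a := (0 : ℝ))]
  refine IntegrableOn.union ?_ ?_
  · refine (integrableOn_exp_Iic 0).congr_fun (fun p hp => ?_) measurableSet_Iic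
    simp [abs_of_nonpos (Set.mem_Iic.1 hp)]
  · refine (integrableOn_exp_neg_Ioi 0).congr_fun (fun p hp => ?_) measurableSet_Ioi
    simp [abs_of_pos (Set.mem_Ioi.1 hp)]

lemma integrable_exp_neg_weight : Integrable fun z : Pos n × ℝ => Real.exp (-weight z) := by
  have h1 : Integrable fun x : Pos n => Real.exp (-‖x‖ ^ 2) := by
    have := (GaussianFourier.integrable_cexp_neg_mul_sq_norm_add (V := Pos n) (b := 1)
      (by simp) 0 0).norm
    refine this.congr (Eventually.of_forall fun x => ?_)
    simp only [Complex.norm_exp]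
    congr 1
    simp [← Complex.ofReal_pow]
  refine (h1.mul_prod integrable_exp_neg_abs).congr (Eventually.of_forall fun z => ?_)
  simp only [← Real.exp_add, weight]
  congr 1
  ring

/-- The slope at which the convex duality inequalities for the entropy are used. -/
def slope (H : ℝ → ℝ) (σ ν : ℝ) (z : Pos n × ℝ) : ℝ :=
  (effPot H σ z.2 - (1 + σ) * weight z) / ν ^ 2

variable {B : ℝ}

lemma abs_effPot_le (hB : ∀ p, |H p| ≤ B) (hσ : 0 ≤ σ) (z : Pos n × ℝ) :
    |effPot H σ z.2| ≤ B + σ * weight z := by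
  have h1 : |σ * z.2| ≤ σ * weight z := by
    rw [abs_mul, abs_of_nonneg hσ]
    gcongr
    unfold weight
    linarith [sq_nonneg ‖z.1‖]
  exact (abs_sub _ _).trans (add_le_add (hB _) h1)

/-- `slope` cancels the potential in `μ`, so the dual term integrates to a finite constant, while
the tilt `σ p` is dominated by `(1 + σ) weight` and `exp(slope - 1)` stays bounded. Hence one
threshold for `M` works at all points, and the price is a multiple of `weight` over `ν²`. -/
lemma slope_facts (hB : ∀ p, |H p| ≤ B) (hσ : 0 ≤ σ) (hν : 0 < ν) (hν1 : ν ≤ 1)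
    (z : Pos n × ℝ) :
    Real.exp (slope H σ ν z - 1) * gibbs H σ ν z ≤ Real.exp (-weight z) ∧
    Real.exp (slope H σ ν z - 1) ≤ Real.exp (B / ν ^ 2) ∧
    |slope H σ ν z| ≤ (B + (1 + 2 * σ) * weight z) / ν ^ 2 := by
  have hw := weight_nonneg z
  have hU := abs_effPot_le hB hσ z
  have hν2 : 0 < ν ^ 2 := by positivity
  refine ⟨?_, ?_, ?_⟩
  · rw [gibbs, ← Real.exp_add]
    refine Real.exp_le_exp.2 ?_
    have h1 : weight z ≤ (1 + σ) * weight z / ν ^ 2 := by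
      rw [le_div_iff₀ hν2]
      have : ν ^ 2 ≤ 1 := pow_le_one₀ hν.le hν1
      calc weight z * ν ^ 2 ≤ weight z * 1 := by gcongr
        _ ≤ (1 + σ) * weight z := by nlinarith
    have h2 : slope H σ ν z + -(effPot H σ z.2) / ν ^ 2 = -((1 + σ) * weight z / ν ^ 2) := by
      rw [slope]; ring
    linarith
  · refine Real.exp_le_exp.2 ?_
    have : slope H σ ν z ≤ B / ν ^ 2 := by
      rw [slope]
      gcongr
      linarith [(abs_le.1 hU).2]
    linarith
  · rw [slope, abs_div, abs_of_pos hν2]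
    gcongr
    refine (abs_sub _ _).trans ?_
    rw [abs_of_nonneg (a := (1 + σ) * weight z) (by positivity)]
    linarith

/-- Duality with the slope above. The lower bound is nonpositive, so it survives multiplication by a
cutoff value `a ∈ [0, 1]`. -/
lemma neg_le_entropyApprox (hB : ∀ p, |H p| ≤ B) (hσ : 0 ≤ σ) (hν : 0 < ν) (hν1 : ν ≤ 1)
    {δ M : ℝ} (hδ : 0 < δ) (hM : 2 * Real.exp (B / ν ^ 2) ≤ M) {a : ℝ} (ha0 : 0 ≤ a)
    (ha1 : a ≤ 1) {u : Pos n → ℝ → ℝ} (z : Pos n × ℝ) (hu : 0 ≤ u z.1 z.2) :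
    -((B + (1 + 2 * σ) * weight z) / ν ^ 2 * u z.1 z.2 + 2 * Real.exp (-weight z)) ≤
      a * (entropyApprox δ M (relDensity H σ ν u z) * gibbs H σ ν z) := by
  obtain ⟨h1, h2, h3⟩ := slope_facts hB hσ hν hν1 z
  have hμ := gibbs_pos (H := H) (σ := σ) (ν := ν) z
  have hM0 : 0 < M := lt_of_lt_of_le (by positivity) hM
  have hr : 0 ≤ relDensity H σ ν u z := mul_nonneg hu (Real.exp_pos _).le
  have h4 := mul_sub_exp_le_entropyApprox (y := slope H σ ν z) hδ hM0 hr (by linarith)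
  have h5 := mul_le_mul_of_nonneg_right h4 hμ.le
  have h6 : relDensity H σ ν u z * slope H σ ν z * gibbs H σ ν z =
      slope H σ ν z * u z.1 z.2 := by
    rw [← gibbs_mul_relDensity (H := H) (σ := σ) (ν := ν) u z]; ring
  have h7 := mul_le_mul_of_nonneg_right ((neg_le_of_abs_le h3)) hu
  have hK : 0 ≤ (B + (1 + 2 * σ) * weight z) / ν ^ 2 * u z.1 z.2 + 2 * Real.exp (-weight z) := by
    have := (abs_nonneg _).trans h3
    positivity
  have h8 : -((B + (1 + 2 * σ) * weight z) / ν ^ 2 * u z.1 z.2 + 2 * Real.exp (-weight z)) ≤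
      entropyApprox δ M (relDensity H σ ν u z) * gibbs H σ ν z := by
    linarith
  calc _ ≤ a * -((B + (1 + 2 * σ) * weight z) / ν ^ 2 * u z.1 z.2
          + 2 * Real.exp (-weight z)) := by nlinarith
    _ ≤ _ := by gcongr

/-- A cutoff value can be replaced by `1` only in front of a nonnegative quantity, so one passes to
the positive part of `r log r`. This exceeds `r log r` by its negative part, which duality controls
through the moment. -/
lemma entropyApprox_le_entropy (hB : ∀ p, |H p| ≤ B) (hσ : 0 ≤ σ) (hν : 0 < ν) (hν1 : ν ≤ 1)
    {δ M : ℝ} (hδ : 0 < δ) (hδ1 : δ ≤ 1) (hM : 0 < M) {a : ℝ} (ha0 : 0 ≤ a)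
    (ha1 : a ≤ 1) {u : Pos n → ℝ → ℝ} (z : Pos n × ℝ) (hu : 0 ≤ u z.1 z.2) :
    a * (entropyApprox δ M (relDensity H σ ν u z) * gibbs H σ ν z) ≤
      u z.1 z.2 * Real.log (u z.1 z.2) + (ν ^ 2)⁻¹ * ((H z.2 - σ * z.2) * u z.1 z.2) +
      ((B + (1 + 2 * σ) * weight z) / ν ^ 2 * u z.1 z.2 + Real.exp (-weight z))
        + 2 * u z.1 z.2 := by
  obtain ⟨h1, -, h3⟩ := slope_facts hB hσ hν hν1 z
  have hμ := gibbs_pos (H := H) (σ := σ) (ν := ν) z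
  set r := relDensity H σ ν u z with hrdef
  have hr : 0 ≤ r := mul_nonneg hu (Real.exp_pos _).le
  have hru : r * gibbs H σ ν z = u z.1 z.2 := gibbs_mul_relDensity u z
  have hlog : r * Real.log r * gibbs H σ ν z =
      u z.1 z.2 * Real.log (u z.1 z.2) + (ν ^ 2)⁻¹ * ((H z.2 - σ * z.2) * u z.1 z.2) := by
    rcases hu.eq_or_lt with h0 | h0
    · have : r = 0 := by rw [hrdef, relDensity, ← h0, zero_mul]
      rw [this, ← h0]; simp
    · have : Real.log r = Real.log (u z.1 z.2) + effPot H σ z.2 / ν ^ 2 := by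
        rw [hrdef, relDensity, Real.log_mul h0.ne' (Real.exp_pos _).ne', Real.log_exp]
      rw [mul_right_comm, hru, this, effPot]
      ring
  have h4 := mul_le_mul_of_nonneg_right (mul_sub_exp_le_mul_log hr (slope H σ ν z)) hμ.le
  have h6 : r * slope H σ ν z * gibbs H σ ν z = slope H σ ν z * u z.1 z.2 := by
    rw [← hru]; ring
  have h7 := mul_le_mul_of_nonneg_right ((neg_le_of_abs_le h3)) hu
  have h8 : max (r * Real.log r) 0 * gibbs H σ ν z ≤ r * Real.log r * gibbs H σ ν z +
      ((B + (1 + 2 * σ) * weight z) / ν ^ 2 * u z.1 z.2 + Real.exp (-weight z)) := by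
    have hX := (abs_nonneg _).trans h3
    rcases le_total 0 (r * Real.log r) with h | h
    · rw [max_eq_left h]
      have : 0 ≤ (B + (1 + 2 * σ) * weight z) / ν ^ 2 * u z.1 z.2 + Real.exp (-weight z) := by
        positivity
      linarith
    · rw [max_eq_right h, zero_mul]
      linarith
  have h9 := mul_le_mul_of_nonneg_right (entropyApprox_le hδ hδ1 hM hr) hμ.le
  have h10 : 0 ≤ (max (r * Real.log r) 0 + 2 * r) * gibbs H σ ν z := by positivity
  calc a * (entropyApprox δ M r * gibbs H σ ν z)
      ≤ a * ((max (r * Real.log r) 0 + 2 * r) * gibbs H σ ν z) := by gcongr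
    _ ≤ 1 * ((max (r * Real.log r) 0 + 2 * r) * gibbs H σ ν z) := by gcongr
    _ = max (r * Real.log r) 0 * gibbs H σ ν z + 2 * u z.1 z.2 := by rw [← hru]; ring
    _ ≤ _ := by rw [← hlog]; linarith

end EntropyBounds

/-! ### Uniform bound on the entropy drop and removal of the localization. -/

section Assembly

variable {n : ℕ} {H : ℝ → ℝ} {σ ν τ : ℝ} {ρ : ℝ → Pos n → ℝ → ℝ}

lemma InitialBounds.weight_le {C₀ : ℝ} {u : Pos n → ℝ → ℝ} (hI : InitialBounds H σ ν C₀ u)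
    (hu : Integrable fun z : Pos n × ℝ => u z.1 z.2) (hu1 : ∫ z : Pos n × ℝ, u z.1 z.2 = 1)
    (hu0 : ∀ x p, 0 ≤ u x p) {g : Pos n × ℝ → ℝ} (hg : Continuous g) {a b : ℝ} (ha : 0 ≤ a)
    (hg0 : ∀ z, 0 ≤ g z) (hgab : ∀ z, g z ≤ a * (‖z.1‖ ^ 2 + z.2 ^ 2) + b) :
    Integrable (fun z : Pos n × ℝ => g z * u z.1 z.2) ∧
      ∫ z : Pos n × ℝ, g z * u z.1 z.2 ≤ a * C₀ + b := by
  have h1 : Integrable fun z : Pos n × ℝ =>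
      a * ((‖z.1‖ ^ 2 + z.2 ^ 2) * u z.1 z.2) + b * u z.1 z.2 :=
    (hI.integrable_moment.const_mul a).add (hu.const_mul b)
  have hle : ∀ z : Pos n × ℝ, g z * u z.1 z.2 ≤
      a * ((‖z.1‖ ^ 2 + z.2 ^ 2) * u z.1 z.2) + b * u z.1 z.2 := fun z => by
    have := mul_le_mul_of_nonneg_right (hgab z) (hu0 z.1 z.2)
    linarith
  have hint : Integrable fun z : Pos n × ℝ => g z * u z.1 z.2 := by
    refine h1.mono' (hg.aestronglyMeasurable.mul hu.aestronglyMeasurable)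
      (Eventually.of_forall fun z => ?_)
    rw [Real.norm_of_nonneg (mul_nonneg (hg0 z) (hu0 _ _))]
    exact hle z
  refine ⟨hint, (integral_mono hint h1 hle).trans ?_⟩
  rw [integral_add (hI.integrable_moment.const_mul a) (hu.const_mul b), integral_const_mul,
    integral_const_mul, hu1, mul_one]
  have := hI.moment_le
  unfold secondMoment at this
  gcongr

/-- The drop of the localized entropy is controlled by the initial bounds and by the moments at
the final time. -/
lemma IsSolution.locEntropy_sub_le {B C₀ : ℝ} (sol : IsSolution H σ ν τ ρ) (hH : ContDiff ℝ 3 H)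
    (hB : ∀ p, |H p| ≤ B) (hσ : 0 ≤ σ) (hν : 0 < ν) (hν1 : ν ≤ 1)
    (hI : InitialBounds H σ ν C₀ (ρ 0)) {δ M : ℝ} (hδ : 0 < δ) (hδ1 : δ ≤ 1)
    (hM : 2 * Real.exp (B / ν ^ 2) ≤ M) {η : Pos n × ℝ → ℝ} (hη : Continuous η)
    (hηs : HasCompactSupport η) (hη0 : ∀ z, 0 ≤ η z) (hη1 : ∀ z, η z ≤ 1) {T : ℝ} (hT : 0 ≤ T)
    (hw : Integrable fun z : Pos n × ℝ => weight z * ρ T z.1 z.2) :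
    IsSolution.locEntropy (entropyApprox δ M) H σ ν η (ρ 0)
        - IsSolution.locEntropy (entropyApprox δ M) H σ ν η (ρ T) ≤
      (C₀ + 2 * B + (1 + 2 * σ) * (C₀ + 1)
        + (1 + 2 * σ) * ∫ z : Pos n × ℝ, weight z * ρ T z.1 z.2) / ν ^ 2
        + (3 * (∫ z : Pos n × ℝ, Real.exp (-weight z)) + 2) := by
  have hM0 : 0 < M := lt_of_lt_of_le (by positivity) hM
  obtain ⟨Λ, hΛ0, hΛ⟩ := exists_lipschitz_entropyApprox hδ hM0
  have hint := (sol.tendsto_locEntropy hH measurable_entropyApprox entropyApprox_zero hΛ hη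
    hηs).1
  have hm0 := sol.unit_mass 0 le_rfl
  have hmT := sol.unit_mass T hT
  have hE := integrable_exp_neg_weight (n := n)
  obtain ⟨hw0, hw0le⟩ := hI.weight_le hm0.1 hm0.2 (sol.nonneg 0 le_rfl) continuous_weight
    (a := 1) (b := 1) zero_le_one weight_nonneg fun z => by
      unfold weight
      nlinarith [sq_nonneg (|z.2| - 1), sq_abs z.2]
  have hX : ∀ t, (Integrable fun z : Pos n × ℝ => weight z * ρ t z.1 z.2) → 0 ≤ t →
      Integrable (fun z : Pos n × ℝ => (B + (1 + 2 * σ) * weight z) / ν ^ 2 * ρ t z.1 z.2) ∧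
      ∫ z : Pos n × ℝ, (B + (1 + 2 * σ) * weight z) / ν ^ 2 * ρ t z.1 z.2 =
        (B + (1 + 2 * σ) * ∫ z : Pos n × ℝ, weight z * ρ t z.1 z.2) / ν ^ 2 := by
    intro t hwt ht
    have hm := sol.unit_mass t ht
    have e : (fun z : Pos n × ℝ => (B + (1 + 2 * σ) * weight z) / ν ^ 2 * ρ t z.1 z.2) =
        fun z => B / ν ^ 2 * ρ t z.1 z.2 + (1 + 2 * σ) / ν ^ 2 * (weight z * ρ t z.1 z.2) := by
      ext z; ring
    rw [e]
    refine ⟨(hm.1.const_mul _).add (hwt.const_mul _), ?_⟩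
    rw [integral_add (hm.1.const_mul _) (hwt.const_mul _), integral_const_mul,
      integral_const_mul, hm.2]
    ring
  obtain ⟨hX0, hX0e⟩ := hX 0 hw0 le_rfl
  obtain ⟨hXT, hXTe⟩ := hX T hw hT
  -- Only the moment at time `T` enters here; finiteness of the entropy at time `T` is not needed.
  have hlow : -((B + (1 + 2 * σ) * ∫ z : Pos n × ℝ, weight z * ρ T z.1 z.2) / ν ^ 2
      + 2 * ∫ z : Pos n × ℝ, Real.exp (-weight z)) ≤
      IsSolution.locEntropy (entropyApprox δ M) H σ ν η (ρ T) := by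
    rw [← hXTe, ← integral_const_mul, ← integral_add hXT (hE.const_mul 2), ← integral_neg]
    exact integral_mono (hXT.add (hE.const_mul 2)).neg (hint T hT) fun z =>
      neg_le_entropyApprox hB hσ hν hν1 hδ hM (hη0 z) (hη1 z) z (sol.nonneg T hT _ _)
  have hUint : Integrable fun z : Pos n × ℝ => (H z.2 - σ * z.2) * ρ 0 z.1 z.2 := by
    have h1 : Integrable fun z : Pos n × ℝ => B * ρ 0 z.1 z.2 + σ * (weight z * ρ 0 z.1 z.2) :=
      (hm0.1.const_mul B).add (hw0.const_mul σ)
    have hUc : Continuous fun z : Pos n × ℝ => H z.2 - σ * z.2 := by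
      have := hH.continuous
      fun_prop
    refine h1.mono' (hUc.aestronglyMeasurable.mul hm0.1.aestronglyMeasurable)
      (Eventually.of_forall fun z => ?_)
    rw [Real.norm_eq_abs, abs_mul, abs_of_nonneg (sol.nonneg 0 le_rfl z.1 z.2)]
    have := mul_le_mul_of_nonneg_right (abs_effPot_le hB hσ z) (sol.nonneg 0 le_rfl z.1 z.2)
    rw [effPot] at this
    linarith
  have hup : IsSolution.locEntropy (entropyApprox δ M) H σ ν η (ρ 0) ≤
      energy H σ ν (ρ 0) / ν ^ 2 +
        ((B + (1 + 2 * σ) * ∫ z : Pos n × ℝ, weight z * ρ 0 z.1 z.2) / ν ^ 2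
          + ∫ z : Pos n × ℝ, Real.exp (-weight z)) + 2 := by
    have hen : energy H σ ν (ρ 0) / ν ^ 2 =
        (∫ z : Pos n × ℝ, ρ 0 z.1 z.2 * Real.log (ρ 0 z.1 z.2)) +
          ∫ z : Pos n × ℝ, (ν ^ 2)⁻¹ * ((H z.2 - σ * z.2) * ρ 0 z.1 z.2) := by
      rw [energy, integral_const_mul, integral_const_mul]
      field_simp
    have h2 : (2 : ℝ) = ∫ z : Pos n × ℝ, 2 * ρ 0 z.1 z.2 := by
      rw [integral_const_mul, hm0.2, mul_one]
    have i1 := hI.integrable_entropy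
    have i2 := hUint.const_mul (ν ^ 2)⁻¹
    have i3 := hm0.1.const_mul 2
    rw [hen, ← hX0e]
    refine le_trans ?_ (add_le_add le_rfl h2.ge)
    have i12 : Integrable fun z : Pos n × ℝ => ρ 0 z.1 z.2 * Real.log (ρ 0 z.1 z.2) +
        (ν ^ 2)⁻¹ * ((H z.2 - σ * z.2) * ρ 0 z.1 z.2) := i1.add i2
    have i34 : Integrable fun z : Pos n × ℝ =>
        (B + (1 + 2 * σ) * weight z) / ν ^ 2 * ρ 0 z.1 z.2 + Real.exp (-weight z) := hX0.add hE
    rw [← integral_add i1 i2, ← integral_add hX0 hE, ← integral_add i12 i34]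
    have i5 := i12.add i34
    refine le_trans ?_ (integral_add i5 i3).le
    exact integral_mono (hint 0 le_rfl) (i5.add i3) fun z =>
      entropyApprox_le_entropy hB hσ hν hν1 hδ hδ1 hM0 (hη0 z) (hη1 z) z
        (sol.nonneg 0 le_rfl _ _)
  have h1 : energy H σ ν (ρ 0) / ν ^ 2 ≤ C₀ / ν ^ 2 := by
    gcongr
    exact hI.energy_le
  have h2 : (B + (1 + 2 * σ) * ∫ z : Pos n × ℝ, weight z * ρ 0 z.1 z.2) / ν ^ 2 ≤
      (B + (1 + 2 * σ) * (C₀ + 1)) / ν ^ 2 := by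
    gcongr
    linarith
  have h3 : (C₀ + 2 * B + (1 + 2 * σ) * (C₀ + 1)
        + (1 + 2 * σ) * ∫ z : Pos n × ℝ, weight z * ρ T z.1 z.2) / ν ^ 2 =
      C₀ / ν ^ 2 + (B + (1 + 2 * σ) * (C₀ + 1)) / ν ^ 2 +
      (B + (1 + 2 * σ) * ∫ z : Pos n × ℝ, weight z * ρ T z.1 z.2) / ν ^ 2 := by ring
  linarith

/-- Joint measurability in time and space, needed to apply Fatou's lemma in the time variable. -/
lemma IsSolution.aemeasurable_locDiss (sol : IsSolution H σ ν τ ρ) (hH : ContDiff ℝ 3 H)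
    {β'' : ℝ → ℝ} (hβ : ContinuousOn β'' (Set.Ici 0)) {η : Pos n × ℝ → ℝ} (hη : Continuous η)
    (T : ℝ) :
    AEMeasurable (fun w : ℝ × Pos n × ℝ =>
      ENNReal.ofReal (IsSolution.locDiss β'' H σ ν τ η (ρ w.1) w.2))
      ((volume.restrict (Set.Ioc 0 T)).prod volume) := by
  refine AEMeasurable.ennreal_ofReal ?_
  set G : ℝ × Pos n × ℝ → ℝ := fun w => relDensity H σ ν (ρ w.1) w.2 with hG
  have hU := (contDiff_effPot (σ := σ) hH).of_le (show (2 : WithTop ℕ∞) ≤ 3 by norm_num)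
  have hGC : ContDiffOn ℝ 2 G {w | 0 < w.1} :=
    sol.regular.mul (ContDiff.contDiffOn (by fun_prop))
  have hderiv : ∀ w : ℝ × Pos n × ℝ, 0 < w.1 →
      fderiv ℝ (relDensity H σ ν (ρ w.1)) w.2 dirP = fderiv ℝ G w (0, dirP) := by
    intro w hw
    have h1 : HasFDerivAt G (fderiv ℝ G w) (w.1, w.2) :=
      ((hGC.contDiffAt (isOpen_posTime.mem_nhds hw)).differentiableAt (by norm_num)).hasFDerivAt
    have h2 := HasFDerivAt.comp w.2 (f := fun z : Pos n × ℝ => ((w.1, z) : ℝ × Pos n × ℝ)) h1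
      (hasFDerivAt_prodMk_right w.1 w.2)
    have h3 : fderiv ℝ (relDensity H σ ν (ρ w.1)) w.2 = _ := h2.fderiv
    rw [h3]
    simp
  have hfd : ContinuousOn (fun w : ℝ × Pos n × ℝ =>
      fderiv ℝ (relDensity H σ ν (ρ w.1)) w.2 dirP) {w | 0 < w.1} :=
    ((hGC.continuousOn_fderiv_of_isOpen isOpen_posTime (by norm_num)).clm_apply
      continuousOn_const).congr fun w hw => hderiv w hw
  have hgc : Continuous (gibbs (n := n) H σ ν) := (contDiff_gibbs hH).continuous
  have hcont : ContinuousOn (fun w : ℝ × Pos n × ℝ =>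
      IsSolution.locDiss β'' H σ ν τ η (ρ w.1) w.2) {w | 0 < w.1} := by
    refine continuousOn_const.mul (((hη.comp continuous_snd).continuousOn.mul
      (hβ.comp hGC.continuousOn fun w hw => ?_)).mul
      ((hgc.comp continuous_snd).continuousOn.mul (hfd.pow 2)))
    exact sol.relDensity_nonneg (le_of_lt hw) w.2
  have hr : (volume.restrict (Set.Ioc 0 T)).prod (volume : Measure (Pos n × ℝ)) =
      (volume.prod volume).restrict (Set.Ioc 0 T ×ˢ Set.univ) := by
    rw [← Measure.prod_restrict, Measure.restrict_univ]
  rw [hr]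
  exact (hcont.mono fun w hw => hw.1.1).aemeasurable (measurableSet_Ioc.prod MeasurableSet.univ)

/-- Removing the localization from the dissipation. -/
lemma IsSolution.lintegral_dissipation_le (sol : IsSolution H σ ν τ ρ) (hH : ContDiff ℝ 3 H)
    (hτ : 0 < τ) {M N : ℕ → ℝ} (hM : Tendsto M atTop atTop) (hM0 : ∀ k, 0 < M k)
    (hN : ∀ k : ℕ, (k : ℝ) + 1 ≤ N k) {T : ℝ} {E : ℝ≥0∞}
    (hE : ∀ k : ℕ, ∫⁻ t in Set.Ioc 0 T, ∫⁻ z, ENNReal.ofReal (IsSolution.locDiss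
      (fun r => (r + 1 / ((k : ℝ) + 1))⁻¹ - (r + M k)⁻¹) H σ ν τ
      (fun y : Pos n × ℝ => cutoff (N k ^ 2) (‖y.1‖ ^ 2 + y.2 ^ 2)) (ρ t) z) ≤ E) :
    ENNReal.ofReal (ν ^ 2 / τ) * ∫⁻ t in Set.Ioc 0 T, dissipation H σ ν (ρ t) ≤ E := by
  set η : ℕ → Pos n × ℝ → ℝ := fun k y => cutoff (N k ^ 2) (‖y.1‖ ^ 2 + y.2 ^ 2) with hη
  set β'' : ℕ → ℝ → ℝ := fun k r => (r + 1 / ((k : ℝ) + 1))⁻¹ - (r + M k)⁻¹ with hβ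
  have hηc : ∀ k, Continuous (η k) := fun k => contDiff_cutoff.continuous.comp (by fun_prop)
  have hmeas : ∀ k, AEMeasurable (fun w : ℝ × Pos n × ℝ =>
      ENNReal.ofReal (IsSolution.locDiss (β'' k) H σ ν τ (η k) (ρ w.1) w.2))
      ((volume.restrict (Set.Ioc 0 T)).prod volume) := fun k =>
    sol.aemeasurable_locDiss hH
      (isC2OnNonneg_entropyApprox (by positivity) (hM0 k)).continuousOn (hηc k) T
  have hlim : ∀ t, 0 < t → ∀ z : Pos n × ℝ,
      ENNReal.ofReal (ν ^ 2 / τ * ((deriv (ρ t z.1) z.2 + (ν ^ 2)⁻¹ * (deriv H z.2 - σ) *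
        ρ t z.1 z.2) ^ 2 / ρ t z.1 z.2)) ≤
      liminf (fun k => ENNReal.ofReal (IsSolution.locDiss (β'' k) H σ ν τ (η k) (ρ t) z))
        atTop := by
    intro t ht z
    rcases (sol.nonneg t ht.le z.1 z.2).eq_or_lt with h0 | h0
    -- Where the density vanishes, the quotient is `0` by the convention for division.
    · rw [← h0]; simp
    · have hf : 0 < relDensity H σ ν (ρ t) z := mul_pos h0 (Real.exp_pos _)
      have hg := gibbs_pos (H := H) (σ := σ) (ν := ν) z
      have l1 : Tendsto (fun k => η k z) atTop (𝓝 1) := by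
        refine tendsto_const_nhds.congr' ?_
        obtain ⟨K, hK⟩ := exists_nat_ge (‖z.1‖ ^ 2 + z.2 ^ 2)
        filter_upwards [eventually_ge_atTop K] with k hk
        have h1 : (K : ℝ) ≤ k := Nat.cast_le.2 hk
        have h2 := hN k
        have h3 : (0 : ℝ) ≤ k := k.cast_nonneg
        have h4 : N k ≤ N k ^ 2 := le_self_pow₀ (by linarith) two_ne_zero
        exact (cutoff_eq_one (by nlinarith) (by linarith)).symm
      have l2 : Tendsto (fun k => β'' k (relDensity H σ ν (ρ t) z)) atTop
          (𝓝 (relDensity H σ ν (ρ t) z)⁻¹) := by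
        have h1 := (tendsto_one_div_add_atTop_nhds_zero_nat (𝕜 := ℝ)).const_add
          (relDensity H σ ν (ρ t) z)
        rw [add_zero] at h1
        have h2 : Tendsto (fun k => (relDensity H σ ν (ρ t) z + M k)⁻¹) atTop (𝓝 0) :=
          tendsto_inv_atTop_zero.comp (tendsto_atTop_add_const_left _ _ hM)
        simpa [hβ] using (h1.inv₀ hf.ne').sub h2
      have l3 := ((l1.mul l2).mul_const (gibbs H σ ν z *
        fderiv ℝ (relDensity H σ ν (ρ t)) z dirP ^ 2)).const_mul (ν ^ 2 / τ)
      have l4 := ENNReal.tendsto_ofReal l3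
      -- The flux is `μ ∂_p f`, so its square divided by `ρ = f μ` is `f⁻¹ μ (∂_p f)²`, the
      -- dissipation density for `β''(r) = 1/r`.
      have hval : (deriv (ρ t z.1) z.2 + (ν ^ 2)⁻¹ * (deriv H z.2 - σ) * ρ t z.1 z.2) ^ 2 /
          ρ t z.1 z.2 = 1 * (relDensity H σ ν (ρ t) z)⁻¹ *
          (gibbs H σ ν z * fderiv ℝ (relDensity H σ ν (ρ t)) z dirP ^ 2) := by
        rw [← sol.gibbs_mul_fderiv_dirP hH ht z,
          ← gibbs_mul_relDensity (H := H) (σ := σ) (ν := ν) (ρ t) z]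
        field_simp
      rw [hval]
      exact l4.liminf_eq.ge
  have hslice : ∀ t, 0 < t → ENNReal.ofReal (ν ^ 2 / τ) * dissipation H σ ν (ρ t) ≤
      liminf (fun k => ∫⁻ z, ENNReal.ofReal
        (IsSolution.locDiss (β'' k) H σ ν τ (η k) (ρ t) z)) atTop := by
    intro t ht
    have hfC := contDiff_relDensity (σ := σ) (ν := ν) hH (sol.contDiff_slice ht)
    have hmz : ∀ k, AEMeasurable (fun z => ENNReal.ofReal
        (IsSolution.locDiss (β'' k) H σ ν τ (η k) (ρ t) z)) volume := by
      intro k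
      refine (Continuous.measurable ?_).aemeasurable.ennreal_ofReal
      have c1 : Continuous fun z => β'' k (relDensity H σ ν (ρ t) z) :=
        (isC2OnNonneg_entropyApprox (by positivity) (hM0 k)).continuousOn.comp_continuous
          hfC.continuous fun z => sol.relDensity_nonneg ht.le z
      exact continuous_const.mul (((hηc k).mul c1).mul ((contDiff_gibbs hH).continuous.mul
        ((contDiff_fderiv_apply_const hfC dirP).continuous.pow 2)))
    rw [dissipation, ← lintegral_const_mul' _ _ ENNReal.ofReal_ne_top]
    refine le_trans (lintegral_mono fun z => ?_) (lintegral_liminf_le' hmz)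
    rw [← ENNReal.ofReal_mul (by positivity)]
    exact hlim t ht z
  calc ENNReal.ofReal (ν ^ 2 / τ) * ∫⁻ t in Set.Ioc 0 T, dissipation H σ ν (ρ t)
      = ∫⁻ t in Set.Ioc 0 T, ENNReal.ofReal (ν ^ 2 / τ) * dissipation H σ ν (ρ t) :=
        (lintegral_const_mul' _ _ ENNReal.ofReal_ne_top).symm
    _ ≤ ∫⁻ t in Set.Ioc 0 T, liminf (fun k => ∫⁻ z, ENNReal.ofReal
        (IsSolution.locDiss (β'' k) H σ ν τ (η k) (ρ t) z)) atTop :=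
        setLIntegral_mono_ae' measurableSet_Ioc
          (Eventually.of_forall fun t ht => hslice t ht.1)
    _ ≤ liminf (fun k => ∫⁻ t in Set.Ioc 0 T, ∫⁻ z, ENNReal.ofReal
        (IsSolution.locDiss (β'' k) H σ ν τ (η k) (ρ t) z)) atTop :=
        lintegral_liminf_le' fun k => (hmeas k).lintegral_prod_right'
    _ ≤ E := liminf_le_of_frequently_le' (Frequently.of_forall hE)

end Assembly

end TiltedFP

end

/-! ### Choice of constants and proof of the lemma. -/

open TiltedFP in
theorem lemma2p7 (n : ℕ) (H : ℝ → ℝ) (L σ P Q : ℝ)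
    (hH : TiltedFP.IsPotential H L) (hσ : 0 ≤ σ) (hσ' : σ < TiltedFP.sigmaUpper H)
    (hPQ : TiltedFP.IsWell H L σ P Q) (C₀ : ℝ) :
    ∃ C : ℝ, 0 < C ∧ ∃ ν₀ : ℝ, 0 < ν₀ ∧
      ∀ ν : ℝ, 0 < ν → ν < ν₀ →
      ∀ ρ : ℝ → TiltedFP.Pos n → ℝ → ℝ,
        TiltedFP.IsSolution H σ ν (TiltedFP.tau H L σ P Q ν) ρ →
        TiltedFP.InitialBounds H σ ν C₀ (ρ 0) →
        ∀ T : ℝ, 0 < T →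
          ∫⁻ t in Set.Ioc 0 T, TiltedFP.dissipation H σ ν (ρ t)
            ≤ ENNReal.ofReal (TiltedFP.tau H L σ P Q ν * (ν ^ 4)⁻¹ * (C * (1 + T))) := by
  have hS := hH.smooth
  obtain ⟨B, hB0, hB⟩ := exists_abs_le_of_periodic hH.period_pos hH.periodic hS.continuous
  obtain ⟨c, A, ν₁, hc, hA, hν₁, hlyap⟩ := hPQ.exists_lyapunov hH hσ hσ'
  set I := ∫ z : Pos n × ℝ, Real.exp (-weight z) with hI
  have hI0 : 0 ≤ I := integral_nonneg fun z => (Real.exp_pos _).le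
  -- `S` bounds the initial Lyapunov moment, using `φ ≤ A (1 + |p|) ≤ A (2 + p²)`. Then `a₁` and
  -- `a₂` are the constant term and the coefficient of `T` in the final bound; the last `1` in `a₂`
  -- is the cutoff error per unit time. Absolute values are taken since `C₀` may be negative, and `ν
  -- ≤ 1` lets terms without `ν⁻²` be absorbed.
  set S := (1 + A) * C₀ + 2 * A with hSdef
  set a₁ := C₀ + 2 * B + (1 + 2 * σ) * (C₀ + 1)
    + (1 + 2 * σ) * ((1 + 1 / c) * S + A / c) + (3 * I + 2) with ha₁
  set a₂ := (1 + 2 * σ) * ((1 + 1 / c) * (2 * n + A)) + 1 with ha₂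
  refine ⟨|a₁| + |a₂| + 1, by positivity, min ν₁ 1, lt_min hν₁ one_pos,
    fun ν hν hνlt ρ sol hinit T hT => ?_⟩
  have hν1 : ν ≤ 1 := (hνlt.trans_le (min_le_right _ _)).le
  obtain ⟨φ, hφ, hφ0, hφl, hφu, hφg⟩ := hlyap ν hν (hνlt.trans_le (min_le_left _ _))
  have hτ : 0 < tau H L σ P Q ν :=
    mul_pos (hPQ.kramersConst_pos hH hσ hσ') (Real.exp_pos _)
  set τ := tau H L σ P Q ν with hτdef
  have hm0 := sol.unit_mass 0 le_rfl
  have hmT := sol.unit_mass T hT.le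
  have hν2 : 0 < ν ^ 2 := by positivity
  obtain ⟨hΦ0, hΦ0le⟩ := hinit.weight_le hm0.1 hm0.2 (sol.nonneg 0 le_rfl)
    (g := fun z => ‖z.1‖ ^ 2 + φ z.2) (a := 1 + A) (b := 2 * A)
    (by have := hφ.continuous; fun_prop) (by positivity)
    (fun z => add_nonneg (sq_nonneg _) (hφ0 _)) fun z => by
      have h1 := hφu z.2
      have h2 : |z.2| ≤ 1 + z.2 ^ 2 := by nlinarith [sq_nonneg (|z.2| - 1), sq_abs z.2]
      have h3 := mul_le_mul_of_nonneg_left h2 hA.le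
      have h4 := mul_nonneg hA.le (sq_nonneg ‖z.1‖)
      linarith [sq_nonneg z.2]
  obtain ⟨hΦT, hΦTle⟩ := sol.moment_le hS hν.ne' hτ hφ hφ0 hc hA.le hφl hφg hΦ0 hT
  have hwle : ∀ z : Pos n × ℝ, weight z * ρ T z.1 z.2 ≤
      (1 + 1 / c) * ((‖z.1‖ ^ 2 + φ z.2) * ρ T z.1 z.2) + A / c * ρ T z.1 z.2 := by
    intro z
    have h1 : weight z ≤ (1 + 1 / c) * (‖z.1‖ ^ 2 + φ z.2) + A / c := by
      have h2 : |z.2| ≤ 1 / c * φ z.2 + A / c := by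
        rw [one_div_mul_eq_div, ← add_div, le_div_iff₀ hc]
        linarith [hφl z.2]
      have h3 : 0 ≤ 1 / c * ‖z.1‖ ^ 2 := by positivity
      unfold weight
      linarith [hφ0 z.2]
    have := mul_le_mul_of_nonneg_right h1 (sol.nonneg T hT.le z.1 z.2)
    linarith
  have hdom := (hΦT.const_mul (1 + 1 / c)).add (hmT.1.const_mul (A / c))
  have hw : Integrable fun z : Pos n × ℝ => weight z * ρ T z.1 z.2 := by
    refine hdom.mono' (continuous_weight.aestronglyMeasurable.mul hmT.1.aestronglyMeasurable)
      (Eventually.of_forall fun z => ?_)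
    rw [Real.norm_of_nonneg (mul_nonneg (weight_nonneg z) (sol.nonneg T hT.le _ _))]
    exact hwle z
  have hwT : ∫ z : Pos n × ℝ, weight z * ρ T z.1 z.2 ≤
      (1 + 1 / c) * (S + (2 * n + A) * T) + A / c := by
    refine (integral_mono hw hdom hwle).trans ?_
    rw [integral_add' (hΦT.const_mul _) (hmT.1.const_mul _), integral_const_mul,
      integral_const_mul, hmT.2, mul_one]
    gcongr
    linarith
  obtain ⟨C, hC0, hC⟩ := exists_gen_cutoff_le (n := n) (σ := σ) hH hν.ne' hτ
  -- The offset keeps every `M k` above the threshold of the duality bound.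
  set M : ℕ → ℝ := fun k => k + 2 * Real.exp (B / ν ^ 2) with hM
  have hM0 : ∀ k, 0 < M k := fun k => by simp only [hM]; positivity
  have hMtop : Tendsto M atTop atTop :=
    tendsto_atTop_add_const_right _ _ tendsto_natCast_atTop_atTop
  have hδ : ∀ k : ℕ, (0 : ℝ) < 1 / ((k : ℝ) + 1) := fun k => by positivity
  choose Λ hΛ0 hΛ using fun k => exists_lipschitz_entropyApprox (hδ k) (hM0 k)
  -- The slope `Λ k` has no bound uniform in `k`, so the cutoff radius is chosen after it: `Λ k * C
  -- / N k ≤ 1` keeps the localization error at most `1` per unit time.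
  set N : ℕ → ℝ := fun k => max (k + 1) (Λ k * C) with hN
  have hN1 : ∀ k : ℕ, (k : ℝ) + 1 ≤ N k := fun k => le_max_left _ _
  have hmain := sol.lintegral_dissipation_le (T := T)
    (E := ENNReal.ofReal ((|a₁| + |a₂| + 1) * (1 + T) / ν ^ 2)) hS hτ hMtop hM0 hN1 fun k => by
    have hNk : 1 ≤ N k := by
      have := hN1 k
      have : (0 : ℝ) ≤ k := k.cast_nonneg
      linarith
    have hNk0 : 0 < N k := by linarith
    have hηC : ContDiff ℝ 2 fun y : Pos n × ℝ => cutoff (N k ^ 2) (‖y.1‖ ^ 2 + y.2 ^ 2) :=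
      contDiff_cutoff.comp ((contDiff_fst.norm_sq ℝ).add (contDiff_snd.pow 2))
    have hηs : HasCompactSupport fun y : Pos n × ℝ =>
        cutoff (N k ^ 2) (‖y.1‖ ^ 2 + y.2 ^ 2) :=
      hasCompactSupport_of_coercive (g := fun p => p ^ 2) (c := 1) (A := 1) one_pos
        (fun p => sq_nonneg p) (fun p => by nlinarith [sq_nonneg (|p| - 1), sq_abs p])
        fun s hs => cutoff_eq_zero (by positivity) hs
    have hβ := isC2OnNonneg_entropyApprox (hδ k) (hM0 k)
    have hle : 1 / ((k : ℝ) + 1) ≤ M k := by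
      have h1 : 1 / ((k : ℝ) + 1) ≤ 1 := by
        rw [div_le_one (by positivity)]
        linarith [k.cast_nonneg (α := ℝ)]
      have h2 : 1 ≤ Real.exp (B / ν ^ 2) := Real.one_le_exp (by positivity)
      simp only [hM]
      linarith [k.cast_nonneg (α := ℝ)]
    have hgen : ∀ (z : Pos n × ℝ) (r : ℝ), 0 ≤ r → entropyApprox (1 / ((k : ℝ) + 1)) (M k) r *
        gen H σ ν τ (fun y : Pos n × ℝ => cutoff (N k ^ 2) (‖y.1‖ ^ 2 + y.2 ^ 2)) z ≤
        1 * (r * gibbs H σ ν z) := by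
      intro z r hr
      have h1 := hΛ k r 0 hr le_rfl
      rw [entropyApprox_zero, sub_zero, sub_zero, abs_of_nonneg hr] at h1
      have h2 := hC (N k) hNk z
      have hg := gibbs_pos (H := H) (σ := σ) (ν := ν) z
      refine (le_abs_self _).trans ?_
      rw [abs_mul]
      calc _ ≤ Λ k * r * (C / N k * gibbs H σ ν z) :=
            mul_le_mul h1 h2 (abs_nonneg _) (mul_nonneg (hΛ0 k) hr)
        _ = Λ k * C / N k * (r * gibbs H σ ν z) := by ring
        _ ≤ _ := by
            gcongr
            rw [div_le_one hNk0]
            exact le_max_right _ _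
    refine (sol.locEntropy_le hS hν.ne' hτ hβ measurable_entropyApprox entropyApprox_zero
      (hΛ k) hηC hηs (fun z r hr => mul_nonneg (cutoff_nonneg _ _) (sub_nonneg.2 ?_))
      hgen hT).2.trans (ENNReal.ofReal_le_ofReal ?_)
    · have := hδ k
      gcongr
    · have hδ1 : 1 / ((k : ℝ) + 1) ≤ 1 := by
        rw [div_le_one (by positivity)]
        linarith [k.cast_nonneg (α := ℝ)]
      have h1 := sol.locEntropy_sub_le hS hB hσ hν hν1 hinit (hδ k) hδ1
        (M := M k) (by simp only [hM]; linarith [k.cast_nonneg (α := ℝ)]) hηC.continuous hηs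
        (fun z => cutoff_nonneg _ _) (fun z => cutoff_le_one _ _) hT.le hw
      have h2 : 3 * I + 2 + T ≤ (3 * I + 2 + T) / ν ^ 2 := by
        rw [le_div_iff₀ hν2]
        exact mul_le_of_le_one_right (by positivity) (pow_le_one₀ hν.le hν1)
      have h3 := mul_le_mul_of_nonneg_left hwT (show 0 ≤ 1 + 2 * σ by positivity)
      have h4 : (C₀ + 2 * B + (1 + 2 * σ) * (C₀ + 1)
          + (1 + 2 * σ) * (∫ z : Pos n × ℝ, weight z * ρ T z.1 z.2) + (3 * I + 2 + T)) / ν ^ 2 ≤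
          (|a₁| + |a₂| + 1) * (1 + T) / ν ^ 2 := by
        gcongr
        have h5 : a₁ ≤ |a₁| := le_abs_self _
        have h6 : a₂ * T ≤ |a₂| * T := by gcongr; exact le_abs_self _
        have h7 : 0 ≤ |a₁| * T := by positivity
        have h8 := abs_nonneg a₂
        linarith
      rw [add_div] at h4
      linarith
  -- Undoing the factor `ν²/τ` supplies the second `ν⁻²`; the first comes from the entropy being
  -- `ℰ/ν²`.
  have hfin : ∫⁻ t in Set.Ioc 0 T, dissipation H σ ν (ρ t) = ENNReal.ofReal (τ / ν ^ 2) *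
      (ENNReal.ofReal (ν ^ 2 / τ) * ∫⁻ t in Set.Ioc 0 T, dissipation H σ ν (ρ t)) := by
    rw [← mul_assoc, ← ENNReal.ofReal_mul (by positivity),
      show τ / ν ^ 2 * (ν ^ 2 / τ) = 1 by field_simp, ENNReal.ofReal_one, one_mul]
  rw [hfin]
  refine (mul_le_mul_right hmain _).trans ?_
  rw [← ENNReal.ofReal_mul (by positivity)]
  refine ENNReal.ofReal_le_ofReal (le_of_eq ?_)
  field_simp
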